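/- **Conventions.** A finite Markov decision process has states $s$, finite nonempty sets $A_s$ of actions, transition probabilities $p(s'\mid s,a)$ and rewards $r(s,a)$; a sink is absorbing with reward $0$. A policy $\pi$ picks $\pi(s)\in A_s$ for every $s$. Under the *total reward criterion*, $\mathrm{Val}^\pi(s)$ is the limit, as $T\to\infty$, of the expected reward of the first $T$ steps from $s$ (if it exists for every $s$), and $\mathrm{Appeal}^\pi(s,a)=r(s,a)+\sum_{s'}p(s'\mid s,a)\mathrm{Val}^\pi(s')$. Under the *average reward criterion*, $\mathrm{Val}^\pi(s)=(g(s),h(s))$, where $g$ is the gain (the limit of $\frac1T$ times the expected reward of the first $T$ steps) and $h$ the bias (the Cesàro limit of the expected accumulated excess of the reward over the gain), $\mathrm{Appeal}^\pi(s,a)=\bigl(\sum_{s'}p(s'\mid s,a)g(s'),\;r(s,a)-g(s)+\sum_{s'}p(s'\mid s,a)h(s')\bigr)$, and pairs are compared lexicographically. A state is switchable if some $a\in A_s$ has $\mathrm{Appeal}^\pi(s,a)>\mathrm{Val}^\pi(s)$. In each iteration, Greedy PI switches every switchable state to an action of greatest appeal (ties broken arbitrarily) and leaves the other states unchanged; it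 stops when no state is switchable. A policy is optimal if it maximizes the value of every state among all policies that have values. **The full construction.** Let $n\ge1$ and $f(i)=3+6i$. The parameters are reals $r(i)$ and $c(i)$ ($1\le i\le n$) with $c(1)=0$; costs $\epsilon(c_i),\epsilon(d_i)>0$ ($1\le i\le n+1$); and, for $2\le i\le n$ and $1\le j\le f(i)$, reals $\delta^i_j$ and probabilities $p^i_j,\alpha_i\in(0,1]$. The states are a sink, $w_i,c_i,d_i$ ($1\le i\le n+1$), $b_i$ ($1\le i\le n$) and $b_i^-,b_i^+$ ($2\le i\le n$); put $b_1^-:=b_1$. Actions are deterministic with reward $0$ unless stated otherwise. * $w_i$ ($i\le n$) has an action to $b_j^-$ for each $j$ with $i\le j\le n$, and one to the sink; $w_{n+1}$ goes to the sink. * For $i\le n$: $c_i$ has action $0$ to $w_{i+1}$ and action $1$ to $b_i^-$ with reward $-\epsilon(c_i)$; $d_i$ has action $0$ to $w_{i+1}$ and action $1$ to $c_i$ with reward $-\epsilon(d_i)$. * $c_{n+1}$ goes to $d_{n+1}$ with reward $-\epsilon(c_{n+1})$, and $d_{n+1}$ goes to the sink with reward $-\epsilon(d_{n+1})$. * $b_1$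 has action $0$ to $w_2$ and action $1$ to $d_2$ with reward $r(1)$. * For $i\ge2$: $b_i^-$ goes to $b_i$ with reward $-c(i)$, and $b_i^+$ goes to $d_{i+1}$ with reward $r(i)$. The state $b_i$ has action $1$, which goes to $b_i^+$ with probability $\alpha_i$ and stays at $b_i$ otherwise; action $a^i_0$ to $w_1$; and actions $a^i_j$ ($1\le j\le f(i)$), each of which goes to $b_1$, collecting $\delta^i_j$, with probability $p^i_j$, and stays at $b_i$ with reward $0$ otherwise. In the all-zero policy every $w_i$ goes to the sink, $b_1$ and $c_i,d_i$ ($i\le n$) choose $0$, and $b_i$ chooses $a^i_0$ for $i\ge2$. For a policy let $B=\{i: b_i \text{ chooses } 1\}$. The policy satisfies the *weak invariant* if for all $i\le n$: $c_i,d_i$ choose $1$ when $i\in B$ and $0$ when $i\notin B$, and $w_i$ chooses the action to $b_\ell^-$ with $\ell=\min\{k\in B:k\ge i\}$, or to the sink if there is no such $k$. Let $\epsilon_{\max}$ be the largest of the small costs $\epsilon(\cdot)$ and $\delta_{\max}$ the largest $\delta^i_j$ ($0$ if $n=1$). The parameters are *admissible* if, with values and appeals under the total reward criterion: 1. $r(i)-c(i)-2n\epsilon_{\max}-\delta_{\max}>\sum_{j<i}r(j)$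 for all $i$; 2. $c(i)>\delta_{\max}+2n\epsilon_{\max}+\sum_{j<i}r(j)$ for all $i\ge2$; 3. under the weak invariant, $\mathrm{Val}(b_1)\le r(1)+\sum_{i\in B,\,i>1}(r(i)-c(i))$; 4. under the weak invariant, for every $i\in B$, with $u_i=r(i)+\sum_{j\in B,\,j>i}(r(j)-c(j))$, one has $u_i-2(n-i+1)\epsilon_{\max}\le\mathrm{Val}(b_i)\le u_i$; 5. under the weak invariant, if $i\ge2$ and $b_i$ chooses $a^i_j$, then $b_i$ is switchable and its unique action of greatest appeal is $a^i_{j+1}$ if $j\ne f(i)$, and $1$ if $j=f(i)$. **Theorem.** Let $n\ge1$. For all admissible parameters, under the total reward criterion and likewise under the average reward criterion, Greedy PI can be run from the all-zero policy (every policy it reaches has well-defined values), and each of its runs arrives at an optimal policy, where it stops, after some number $T\ge2^n$ of iterations; no earlier policy of the run is optimal, and at each earlier policy some state is switchable. The run simulates a binary counter: there are times $0=\tau_0<\tau_1<\dots<\tau_{2^n-1}=T$ such that at time $\tau_k$ the bits ($b_i$ chooses $1$ or not, $b_1$ being the least significant bit) are the binary digits of $k$. Moreover, the parameters $r(i)=2^{2i+1}$,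 $c(i)=2^{2i}$ for $i\ge2$, $c(1)=0$, $\epsilon(c_i)=\epsilon(d_i)=2^{-100n}$, $\delta^i_j=3j\cdot2^{-100n}$, $p^i_j=2^{-2j}$, $\alpha_i=2^{-1000n}$ are admissible. -/

import Mathlib

open Filter Topology

noncomputable section

/-! ## Markov decision processes, criteria, and Greedy policy iteration -/

/-- A finite Markov decision process. `avail s` is the set `A_s` of actions available at `s`,
`p s a s'` is `p(s' | s, a)` and `r s a` is the (expected) reward of taking `a` at `s`.
A sink is an absorbing state whose only action has reward `0`.
Values of `p` and `r` at unavailable actions are never used. -/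
structure MDP (S Act : Type) [Fintype S] where
  avail : S → Finset Act
  avail_nonempty : ∀ s, (avail s).Nonempty
  p : S → Act → S → ℝ
  r : S → Act → ℝ
  p_nonneg : ∀ s, ∀ a ∈ avail s, ∀ s', 0 ≤ p s a s'
  p_sum : ∀ s, ∀ a ∈ avail s, ∑ s', p s a s' = 1

namespace MDP

variable {S Act : Type} [Fintype S] [DecidableEq S] {L : Type} [LinearOrder L]

/-- Positional policies. -/
def Policy (M : MDP S Act) : Type := {π : S → Act // ∀ s, π s ∈ M.avail s}

/-- Transition matrix of the Markov chain induced by a policy. -/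
def transition (M : MDP S Act) (π : M.Policy) : Matrix S S ℝ := fun s s' => M.p s (π.1 s) s'

/-- One-step reward vector of a policy. -/
def reward (M : MDP S Act) (π : M.Policy) : S → ℝ := fun s => M.r s (π.1 s)

/-- The expectation of `∑_{t < T} x(s_t)` for the chain started at `s`. -/
def partialSum (M : MDP S Act) (π : M.Policy) (x : S → ℝ) (T : ℕ) (s : S) : ℝ :=
  ∑ t ∈ Finset.range T, ((M.transition π ^ t).mulVec x) s

/-- `v` is the total reward value of `π`: at every state the expected reward collected in the
first `T` steps converges to `v` as `T → ∞`. -/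
def HasTotalValue (M : MDP S Act) (π : M.Policy) (v : S → ℝ) : Prop :=
  ∀ s, Tendsto (fun T => M.partialSum π (M.reward π) T s) atTop (𝓝 (v s))

/-- `g` is the gain of `π`: the long-run average of the expected reward. -/
def HasGain (M : MDP S Act) (π : M.Policy) (g : S → ℝ) : Prop :=
  ∀ s, Tendsto (fun T : ℕ => M.partialSum π (M.reward π) T s / T) atTop (𝓝 (g s))

/-- `h` is the bias of a policy `π` with gain `g`: the Cesàro limit of the expected
accumulated excess of the reward over the gain. -/
def HasBias (M : MDP S Act) (π : M.Policy) (g h : S → ℝ) : Prop :=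
  ∀ s, Tendsto (fun N : ℕ =>
    (∑ T ∈ Finset.range N, M.partialSum π (fun s' => M.reward π s' - g s') T s) / N)
    atTop (𝓝 (h s))

/-- A criterion relates a policy to its values and to the appeals of the actions, both of which
lie in some linear order `L`. -/
abbrev Criterion (M : MDP S Act) (L : Type) : Type :=
  M.Policy → (S → L) → (S → Act → L) → Prop

/-- Total reward criterion, with
`Appeal(s, a) = r(s, a) + ∑_{s'} p(s' | s, a) * Val(s')`. -/
def totalReward (M : MDP S Act) : M.Criterion ℝ := fun π val appeal =>
  M.HasTotalValue π val ∧ ∀ s a, appeal s a = M.r s a + ∑ s', M.p s a s' * val s'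

/-- Average reward criterion: actions are compared first by gain and then, among actions of equal
gain, by bias. -/
def averageReward (M : MDP S Act) : M.Criterion (ℝ ×ₗ ℝ) := fun π val appeal =>
  ∃ g h : S → ℝ, M.HasGain π g ∧ M.HasBias π g h ∧
    (∀ s, val s = toLex (g s, h s)) ∧
    ∀ s a, appeal s a =
      toLex (∑ s', M.p s a s' * g s', M.r s a - g s + ∑ s', M.p s a s' * h s')

/-- `s` is switchable: some available action has an appeal above the value of `s`. -/
def Switchable (M : MDP S Act) (val : S → L) (appeal : S → Act → L) (s : S) : Prop :=
  ∃ a ∈ M.avail s, val s < appeal s a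

/-- One iteration of Greedy PI: every switchable state switches to an action of greatest appeal,
the other states keep their action. Part of the claim is that `π` has well-defined values. -/
def GreedyStep (M : MDP S Act) (crit : M.Criterion L) (π π' : M.Policy) : Prop :=
  ∃ val appeal, crit π val appeal ∧ ∀ s,
    (M.Switchable val appeal s → ∀ a ∈ M.avail s, appeal s a ≤ appeal s (π'.1 s)) ∧
    (¬ M.Switchable val appeal s → π'.1 s = π.1 s)

/-- `ρ` is a sequence of policies produced by Greedy PI from `π₀` (`ρ t` is the policy after
`t` iterations; it stays constant once no state is switchable). -/
def IsGreedyRun (M : MDP S Act) (crit : M.Criterion L) (π₀ : M.Policy) (ρ : ℕ → M.Policy) : Prop :=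
  ρ 0 = π₀ ∧ ∀ t, M.GreedyStep crit (ρ t) (ρ (t + 1))

/-- `π` is optimal: it maximizes the value of every state among all policies that have values. -/
def IsOptimal (M : MDP S Act) (crit : M.Criterion L) (π : M.Policy) : Prop :=
  ∃ val appeal, crit π val appeal ∧
    ∀ π' val' appeal', crit π' val' appeal' → ∀ s, val' s ≤ val s

/-- No state is switchable under `π`, that is, policy iteration stops at `π`. -/
def IsTerminal (M : MDP S Act) (crit : M.Criterion L) (π : M.Policy) : Prop :=
  ∃ val appeal, crit π val appeal ∧ ∀ s, ¬ M.Switchable val appeal s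

end MDP

/-! ## The full construction

Bits are indexed by `i : Fin n`; the index `i` stands for bit number `i + 1`, so `b 0` is `b_1`,
`w 0` is `w_1` and `w (Fin.last n)` is `w_{n+1}`. -/

namespace FullConstruction

/-- The states. `bMinus`, `bPlus` exist for `b_2, …, b_n` only; `cTop`, `dTop` are
`c_{n+1}`, `d_{n+1}`. -/
inductive State (n : ℕ) [NeZero n] : Type
  | sink : State n
  | w (i : Fin (n + 1)) : State n
  | b (i : Fin n) : State n
  | bMinus (i : {i : Fin n // i ≠ 0}) : State n
  | bPlus (i : {i : Fin n // i ≠ 0}) : State n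
  | c (i : Fin n) : State n
  | d (i : Fin n) : State n
  | cTop : State n
  | dTop : State n
  deriving DecidableEq, Fintype

/-- The actions. `zero` and `one` are the actions `0` and `1`; `delay j` is `a^i_j` at `b_i`;
`toBit j` and `toSink` are the actions of the `w_i`; `only` is the action of a state that has
just one. -/
inductive Action (n : ℕ) : Type
  | zero : Action n
  | one : Action n
  | delay (j : ℕ) : Action n
  | toBit (j : Fin n) : Action n
  | toSink : Action n
  | only : Action n
  deriving DecidableEq

/-- `f(i) = 3 + 6 i` for the one-based bit number. -/
def f {n : ℕ} (i : Fin n) : ℕ := 3 + 6 * (i.val + 1)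

/-- The parameter values. `p i j` is the probability that `a^i_j` leaves `b_i`, `δ i j` the reward
collected when it does, and `α i` the probability that action `1` of `b_i` leaves `b_i`.
`εc`, `εd` are the small costs at the `c` and `d` states (`Fin.last n` for the top ones).
Only `δ i j`, `p i j` with `i ≠ 0`, `1 ≤ j ≤ f i`, and `α i` with `i ≠ 0`, are used. -/
structure Params (n : ℕ) [NeZero n] where
  r : Fin n → ℝ
  c : Fin n → ℝ
  εc : Fin (n + 1) → ℝ
  εd : Fin (n + 1) → ℝ
  δ : Fin n → ℕ → ℝ
  p : Fin n → ℕ → ℝ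
  α : Fin n → ℝ
  c_first : c 0 = 0
  εc_pos : ∀ i, 0 < εc i
  εd_pos : ∀ i, 0 < εd i
  p_pos : ∀ i j, 0 < p i j
  p_le_one : ∀ i j, p i j ≤ 1
  α_pos : ∀ i, 0 < α i
  α_le_one : ∀ i, α i ≤ 1

variable {n : ℕ} [NeZero n]

/-- The state through which bit `i` is entered: `b_1` itself, and `b_i^-` for the other bits. -/
def entry (i : Fin n) : State n :=
  if h : i = 0 then State.b 0 else State.bMinus ⟨i, h⟩

/-- The state `d_{i+1}` above bit `i`. -/
def dNext (i : Fin n) : State n :=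
  if h : i.val + 1 < n then State.d ⟨i.val + 1, h⟩ else State.dTop

/-- The distribution that goes to `x`. -/
def goto (x : State n) : State n → ℝ := fun s => if s = x then 1 else 0

/-- The distribution that goes to `x` with probability `q` and to `y` otherwise. -/
def lottery (q : ℝ) (x y : State n) : State n → ℝ := fun s => q * goto x s + (1 - q) * goto y s

/-- The available actions. -/
def avail : State n → Finset (Action n)
  | .w i => insert Action.toSink
      ((Finset.univ.filter fun j : Fin n => i ≤ j.castSucc).image Action.toBit)
  | .b i => if i = 0 then {Action.zero, Action.one}
      else insert Action.one ((Finset.range (f i + 1)).image Action.delay)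
  | .c _ => {Action.zero, Action.one}
  | .d _ => {Action.zero, Action.one}
  | _ => {Action.only}

/-- The transition probabilities (the last line only concerns the sink and unavailable actions). -/
def trans (P : Params n) : State n → Action n → State n → ℝ
  | .w _, .toBit j => goto (entry j)
  | .w _, .toSink => goto .sink
  | .b i, .zero => goto (.w i.succ)
  | .b i, .one => if h : i = 0 then goto (dNext i) else lottery (P.α i) (.bPlus ⟨i, h⟩) (.b i)
  | .b _, .delay 0 => goto (.w 0)
  | .b i, .delay (j + 1) => lottery (P.p i (j + 1)) (.b 0) (.b i)
  | .bMinus i, .only => goto (.b i.1)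
  | .bPlus i, .only => goto (dNext i.1)
  | .c i, .zero => goto (.w i.succ)
  | .c i, .one => goto (entry i)
  | .d i, .zero => goto (.w i.succ)
  | .d i, .one => goto (.c i)
  | .cTop, .only => goto .dTop
  | .dTop, .only => goto .sink
  | _, _ => goto .sink

/-- The expected rewards. The reward `δ i j` of `a^i_j` is collected on the transition that leaves
`b_i`, hence the factor `p i j`. -/
def rew (P : Params n) : State n → Action n → ℝ
  | .b i, .one => if i = 0 then P.r i else 0
  | .b i, .delay (j + 1) => P.p i (j + 1) * P.δ i (j + 1)
  | .bMinus i, .only => - P.c i.1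
  | .bPlus i, .only => P.r i.1
  | .c i, .one => - P.εc i.castSucc
  | .d i, .one => - P.εd i.castSucc
  | .cTop, .only => - P.εc (Fin.last n)
  | .dTop, .only => - P.εd (Fin.last n)
  | _, _ => 0

/-- `x` is a probability distribution on the states. -/
def IsDistr (x : State n → ℝ) : Prop := (∀ s, 0 ≤ x s) ∧ ∑ s, x s = 1

theorem isDistr_goto (x : State n) : IsDistr (goto x) := by
  refine ⟨fun s => ?_, ?_⟩
  · unfold goto; split <;> norm_num
  · simp [goto]

theorem isDistr_lottery {q : ℝ} (h0 : 0 < q) (h1 : q ≤ 1) (x y : State n) :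
    IsDistr (lottery q x y) := by
  refine ⟨fun s => ?_, ?_⟩
  · have hx := (isDistr_goto x).1 s
    have hy := (isDistr_goto y).1 s
    have : 0 ≤ 1 - q := by linarith
    unfold lottery
    positivity
  · simp only [lottery, Finset.sum_add_distrib, ← Finset.mul_sum, (isDistr_goto _).2]
    ring

theorem isDistr_trans (P : Params n) (s : State n) (a : Action n) : IsDistr (trans P s a) := by
  unfold trans
  split <;> first
    | exact isDistr_goto _
    | exact isDistr_lottery (P.p_pos _ _) (P.p_le_one _ _) _ _
    | (split
       · exact isDistr_goto _
       · exact isDistr_lottery (P.α_pos _) (P.α_le_one _) _ _)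

theorem avail_nonempty (s : State n) : (avail s).Nonempty := by
  cases s <;> simp only [avail] <;> first
    | exact Finset.insert_nonempty _ _
    | exact Finset.singleton_nonempty _
    | (split <;> exact Finset.insert_nonempty _ _)

/-- The Markov decision process of the full construction. -/
def mdp (P : Params n) : MDP (State n) (Action n) where
  avail := avail
  avail_nonempty := avail_nonempty
  p := trans P
  r := rew P
  p_nonneg := fun s a _ => (isDistr_trans P s a).1
  p_sum := fun s a _ => (isDistr_trans P s a).2

/-- Underlying function of the all-zero policy. -/
def zeroAction : State n → Action n
  | .w _ => .toSink
  | .b i => if i = 0 then .zero else .delay 0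
  | .c _ => .zero
  | .d _ => .zero
  | _ => .only

theorem zeroAction_mem (s : State n) : zeroAction s ∈ avail s := by
  cases s <;> simp only [avail, zeroAction] <;> first
    | simp
    | (split <;> simp)

/-- The all-zero policy: every `w_i` goes to the sink, `b_1` and all `c_i`, `d_i` choose `0`, and
`b_i` chooses `a^i_0` for `i > 1`. -/
def zeroPolicy (P : Params n) : (mdp P).Policy := ⟨zeroAction, zeroAction_mem⟩

/-- The set `B` of bits that are set to `1`. -/
def setBits {P : Params n} (π : (mdp P).Policy) : Finset (Fin n) :=
  Finset.univ.filter fun i => π.1 (.b i) = .one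

/-- The weak invariant. `c_i` and `d_i` agree with bit `i`, and `w_i` goes to the least set bit
`ℓ ≥ i`, or to the sink if there is none. (A bit outside `B` has any action other than `1`.) -/
def WeakInvariant {P : Params n} (π : (mdp P).Policy) : Prop :=
  (∀ i ∈ setBits π, π.1 (.c i) = .one ∧ π.1 (.d i) = .one) ∧
  (∀ i ∉ setBits π, π.1 (.c i) = .zero ∧ π.1 (.d i) = .zero) ∧
  (∀ i ℓ : Fin n, ℓ ∈ setBits π → i ≤ ℓ → (∀ k ∈ setBits π, i ≤ k → ℓ ≤ k) →
    π.1 (.w i.castSucc) = .toBit ℓ) ∧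
  (∀ i : Fin n, (∀ k ∈ setBits π, ¬ i ≤ k) → π.1 (.w i.castSucc) = .toSink)

namespace Params

/-- The largest small cost. -/
def εmax (P : Params n) : ℝ :=
  Finset.univ.sup' Finset.univ_nonempty fun i : Fin (n + 1) => max (P.εc i) (P.εd i)

/-- The largest small reward (`0` if `n = 1`, where no such reward occurs). -/
def δmax (P : Params n) : ℝ :=
  sSup {x : ℝ | ∃ i : Fin n, i ≠ 0 ∧ ∃ j : ℕ, 1 ≤ j ∧ j ≤ f i ∧ x = P.δ i j}

/-- `r(i) - c(i) - 2 n ε_max - δ_max > ∑_{j < i} r(j)` for all `i`. -/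
def RewardGap (P : Params n) : Prop :=
  ∀ i : Fin n, ∑ j ∈ Finset.Iio i, P.r j < P.r i - P.c i - 2 * n * P.εmax - P.δmax

/-- `c(i) > δ_max + 2 n ε_max + ∑_{j < i} r(j)` for all `i > 1`
(there is no cost at `b_1`, where `c(1) = 0` by convention). -/
def CostGap (P : Params n) : Prop :=
  ∀ i : Fin n, i ≠ 0 → P.δmax + 2 * n * P.εmax + ∑ j ∈ Finset.Iio i, P.r j < P.c i

/-- Under the weak invariant, `Val(b_1) ≤ r(1) + ∑_{i ∈ B, i > 1} (r(i) - c(i))`. -/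
def FirstBitBound (P : Params n) : Prop :=
  ∀ (π : (mdp P).Policy) (v : State n → ℝ), WeakInvariant π → (mdp P).HasTotalValue π v →
    v (.b 0) ≤ P.r 0 + ∑ i ∈ setBits π with i ≠ 0, (P.r i - P.c i)

/-- Under the weak invariant, for every `i ∈ B`, the value of `b_i` is at most
`u = r(i) + ∑_{j > i, j ∈ B} (r(j) - c(j))` and at least `u - 2 (n - i + 1) ε_max` (for the
one-based `i`, so that `n - i + 1` is `n - i` for the zero-based index). -/
def SetBitBounds (P : Params n) : Prop :=
  ∀ (π : (mdp P).Policy) (v : State n → ℝ), WeakInvariant π → (mdp P).HasTotalValue π v →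
    ∀ i ∈ setBits π,
      P.r i + ∑ j ∈ setBits π with i < j, (P.r j - P.c j)
          - 2 * ((n : ℝ) - (i.val : ℝ)) * P.εmax ≤ v (.b i) ∧
      v (.b i) ≤ P.r i + ∑ j ∈ setBits π with i < j, (P.r j - P.c j)

/-- Under the weak invariant, if `b_i` (`i > 1`) selects `a^i_j`, then `b_i` is switchable and its
(unique) action of greatest appeal is `a^i_{j+1}` if `j ≠ f(i)` and `1` if `j = f(i)`. -/
def GadgetOrder (P : Params n) : Prop :=
  ∀ (π : (mdp P).Policy) (val : State n → ℝ) (appeal : State n → Action n → ℝ),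
    WeakInvariant π → (mdp P).totalReward π val appeal →
    ∀ (i : Fin n) (j : ℕ), i ≠ 0 → π.1 (.b i) = .delay j →
      (mdp P).Switchable val appeal (.b i) ∧
      ∀ a ∈ avail (State.b i), a ≠ (if j = f i then .one else .delay (j + 1)) →
        appeal (.b i) a < appeal (.b i) (if j = f i then .one else .delay (j + 1))

/-- The five propositions about the parameter values. -/
structure Admissible (P : Params n) : Prop where
  rewardGap : P.RewardGap
  costGap : P.CostGap
  firstBitBound : P.FirstBitBound
  setBitBounds : P.SetBitBounds
  gadgetOrder : P.GadgetOrder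

/-- The standard parameter values, for the one-based `i`: `r(i) = 2^(2i+1)`,
`c(i) = 2^(2i)` for `i > 1`, `c(1) = 0`, all small costs are `ε = 2^(-100n)`, `δ_j = 3 j δ` with
`δ = 2^(-100n)`, `p_j = 2^(-2j)`, and action `1` leaves `b_i` with probability `2^(-1000n)`. -/
def standard (n : ℕ) [NeZero n] : Params n where
  r i := 2 ^ (2 * (i.val + 1) + 1)
  c i := if i = 0 then 0 else 2 ^ (2 * (i.val + 1))
  εc _ := (1 / 2) ^ (100 * n)
  εd _ := (1 / 2) ^ (100 * n)
  δ _ j := 3 * j * (1 / 2) ^ (100 * n)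
  p _ j := (1 / 2) ^ (2 * j)
  α _ := (1 / 2) ^ (1000 * n)
  c_first := by simp
  εc_pos := fun _ => by positivity
  εd_pos := fun _ => by positivity
  p_pos := fun _ _ => by positivity
  p_le_one := fun _ _ => pow_le_one₀ (by norm_num) (by norm_num)
  α_pos := fun _ => by positivity
  α_le_one := fun _ => pow_le_one₀ (by norm_num) (by norm_num)

end Params

/-- Greedy PI from the all-zero policy under the criterion `crit` counts in binary and needs at
least `2^n` iterations: runs exist, and every run `ρ` arrives at an optimal policy, at which it
stops, after exactly `T ≥ 2^n` iterations, no earlier policy being optimal or a stopping point;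
and at increasing times `τ 0 = 0, τ 1, …, τ (2^n - 1) = T` the bits spell the numbers
`0, 1, …, 2^n - 1` in binary. -/
def CountsInBinary {L : Type} [LinearOrder L] (P : Params n)
    (crit : (mdp P).Criterion L) : Prop :=
  (∃ ρ, (mdp P).IsGreedyRun crit (zeroPolicy P) ρ) ∧
  ∀ ρ, (mdp P).IsGreedyRun crit (zeroPolicy P) ρ →
    ∃ T : ℕ, 2 ^ n ≤ T ∧
      (mdp P).IsOptimal crit (ρ T) ∧ (mdp P).IsTerminal crit (ρ T) ∧
      (∀ t < T, ¬ (mdp P).IsOptimal crit (ρ t) ∧ ¬ (mdp P).IsTerminal crit (ρ t)) ∧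
      ∃ τ : ℕ → ℕ, StrictMonoOn τ (Set.Iio (2 ^ n)) ∧ τ 0 = 0 ∧ τ (2 ^ n - 1) = T ∧
        ∀ k < 2 ^ n, ∀ i : Fin n, i ∈ setBits (ρ (τ k)) ↔ k.testBit i.val = true

end FullConstruction

end

noncomputable section

set_option linter.unusedSectionVars false

/-! Entering a set bit and collecting its reward pays $r(i)-c(i)$, more than all lower rewards
together (`Ladder.profit`), while the entry cost of an unset bit exceeds what can be won below it
(`Evaluates.entry_lt`). Values along $w_i$ and $d_i$ obey simple equations (`Ladder`) and differ by
at most two small costs, so every comparison at a $w$, $c$, $d$ or set $b$ state reduces to these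
two gaps.

At a policy satisfying the weak invariant, one iteration only advances the delay actions and sets
$b_1$ (`steady_step`). Under $a^i_j$ the self-loop makes $b_i$ worth exactly
$\mathrm{Val}(b_1)+\delta^i_j$, so switching to $a^i_{j'}$ gains
$p^i_{j'}(\delta^i_{j'}-\delta^i_j)$ whatever the rest of the policy does. This continues until the
least unset bit $\ell$ has run through its delays and takes action $1$; higher bits have longer
delays and are still waiting. Next $w_k$ ($k\le\ell$) and $c_\ell$ discover bit $\ell$
(`first_step`), but $d_\ell$ lags one iteration behind. The lower bits, which continue through the
$d$ states, therefore miss bit $\ell$ and are worth less than $w_1$, so they all reset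
(`second_step_aux`). This is the carry of a binary increment.

All these choices are forced, hence Greedy PI follows the map `Config.step`
(`Config.greedyStep_total_iff`) and counting is a statement about its iterates
(`Config.exists_times`). There is one degenerate case, `Params.Stuck`: with a single bit $d_1$ may
never find switching profitable, and the run ends one iteration sooner.

At the last policy no appeal exceeds the value, so $v$ is superharmonic for every policy; since $v$
is negative at $c_{n+1},d_{n+1}$ only, a bounded potential controls the remainder $P^Tv$
(`cesaro_partialSum_le`), which gives optimality. For the average criterion, a policy with a total
value $v$ has gain $0$ and bias $v$, so both criteria produce the same steps. -/

/-- A recursion `e (T + 1) = q * e T + η T` with `0 ≤ q < 1` and `η → 0` forces `e → 0`. -/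
theorem tendsto_zero_of_contracting {q : ℝ} (h0 : 0 ≤ q) (h1 : q < 1) {e η : ℕ → ℝ}
    (hη : Tendsto η atTop (𝓝 0)) (he : ∀ T, e (T + 1) = q * e T + η T) :
    Tendsto e atTop (𝓝 0) := by
  rw [Metric.tendsto_atTop] at hη ⊢
  intro ε hε
  have hq : 0 < (1 - q) * (ε / 2) := mul_pos (by linarith) (by linarith)
  obtain ⟨N, hN⟩ := hη _ hq
  have key : ∀ k, |e (N + k)| ≤ q ^ k * |e N| + ε / 2 := by
    intro k
    induction k with
    | zero => simp; linarith
    | succ k ih =>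
      have h2 := hN (N + k) (by omega)
      rw [Real.dist_eq, sub_zero] at h2
      have h3 : |e (N + (k + 1))| ≤ q * |e (N + k)| + |η (N + k)| := by
        rw [← add_assoc, he]
        refine (abs_add_le _ _).trans ?_
        rw [abs_mul, abs_of_nonneg h0]
      have h4 := mul_le_mul_of_nonneg_left ih h0
      calc _ ≤ _ := h3
        _ ≤ q * (q ^ k * |e N| + ε / 2) + (1 - q) * (ε / 2) := by linarith
        _ = _ := by ring
  have hpow : Tendsto (fun k => q ^ k * |e N|) atTop (𝓝 (0 * |e N|)) :=
    (tendsto_pow_atTop_nhds_zero_of_lt_one h0 h1).mul_const _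
  rw [zero_mul, Metric.tendsto_atTop] at hpow
  obtain ⟨K, hK⟩ := hpow (ε / 2) (by linarith)
  refine ⟨N + K, fun T hT => ?_⟩
  obtain ⟨k, rfl⟩ : ∃ k, T = N + k := ⟨T - N, by omega⟩
  have h5 := hK k (by omega)
  rw [Real.dist_eq, sub_zero] at h5 ⊢
  have h6 := le_abs_self (q ^ k * |e N|)
  linarith [key k]

/-! ### One-step equations and convergence of total rewards -/

namespace MDP

variable {S Act : Type} [Fintype S] [DecidableEq S] {L : Type} [LinearOrder L]
  {M : MDP S Act} {π : M.Policy}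

theorem mulVec_pow_succ (x : S → ℝ) (t : ℕ) (s : S) :
    ((M.transition π ^ (t + 1)).mulVec x) s =
      ∑ s', M.p s (π.1 s) s' * ((M.transition π ^ t).mulVec x) s' := by
  rw [pow_succ', ← Matrix.mulVec_mulVec]
  rfl

/-- Conditions on the first step rather than the last, so that a state is described by its
successors. -/
theorem partialSum_succ (x : S → ℝ) (T : ℕ) (s : S) :
    M.partialSum π x (T + 1) s =
      x s + ∑ s', M.p s (π.1 s) s' * M.partialSum π x T s' := by
  unfold partialSum
  rw [Finset.sum_range_succ']
  simp only [mulVec_pow_succ, pow_zero, Matrix.one_mulVec, Finset.mul_sum]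
  rw [Finset.sum_comm, add_comm]

theorem HasTotalValue.bellman {v : S → ℝ} (h : M.HasTotalValue π v) (s : S) :
    v s = M.r s (π.1 s) + ∑ s', M.p s (π.1 s) s' * v s' := by
  have h1 := (h s).comp (tendsto_add_atTop_nat 1)
  refine tendsto_nhds_unique h1 ?_
  have h2 : (fun T => M.partialSum π (M.reward π) T s) ∘ (fun a => a + 1) = fun T =>
      M.r s (π.1 s) + ∑ s', M.p s (π.1 s) s' * M.partialSum π (M.reward π) T s' := by
    funext T
    exact partialSum_succ _ _ _
  rw [h2]
  exact tendsto_const_nhds.add (tendsto_finsetSum _ fun s' _ => (h s').const_mul _)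

theorem HasTotalValue.unique {v v' : S → ℝ} (h : M.HasTotalValue π v)
    (h' : M.HasTotalValue π v') : v = v' :=
  funext fun s => tendsto_nhds_unique (h s) (h' s)

/-- The expected total reward from `s` converges. -/
def HasValueAt (M : MDP S Act) (π : M.Policy) (s : S) : Prop :=
  ∃ x, Tendsto (fun T => M.partialSum π (M.reward π) T s) atTop (𝓝 x)

theorem exists_hasTotalValue (h : ∀ s, M.HasValueAt π s) : ∃ v, M.HasTotalValue π v :=
  ⟨fun s => (h s).choose, fun s => (h s).choose_spec⟩

/-- The chain spends $1/q$ steps at `s` in expectation, which suggests the limit $x+r/q$; the error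
contracts by $1-q$ per step up to a perturbation coming from `t` that tends to zero. Deterministic
moves are the case $q=1$. -/
theorem hasValueAt_of_lottery {s t : S} {q : ℝ} (h0 : 0 < q) (h1 : q ≤ 1)
    (hp : ∀ x : S → ℝ, ∑ s', M.p s (π.1 s) s' * x s' = q * x t + (1 - q) * x s)
    (ht : M.HasValueAt π t) : M.HasValueAt π s := by
  obtain ⟨x, hx⟩ := ht
  refine ⟨x + M.reward π s / q, ?_⟩
  have he : Tendsto (fun T => M.partialSum π (M.reward π) T s - (x + M.reward π s / q))
      atTop (𝓝 0) := by
    refine tendsto_zero_of_contracting (q := 1 - q)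
      (η := fun T => q * (M.partialSum π (M.reward π) T t - x)) (by linarith) (by linarith) ?_ ?_
    · simpa using (hx.sub_const x).const_mul q
    · intro T
      rw [partialSum_succ, hp]
      field_simp
      ring
  simpa using he.add_const (x + M.reward π s / q)

theorem partialSum_of_absorbing {s : S} (hr : M.r s (π.1 s) = 0)
    (hp : ∀ x : S → ℝ, ∑ s', M.p s (π.1 s) s' * x s' = x s) :
    ∀ T, M.partialSum π (M.reward π) T s = 0 := by
  intro T
  induction T with
  | zero => simp [partialSum]
  | succ T ih => rw [partialSum_succ, hp, ih, reward, hr, add_zero]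

theorem exists_greedyStep {crit : M.Criterion L} {val : S → L} {appeal : S → Act → L}
    (h : crit π val appeal) : ∃ π', M.GreedyStep crit π π' := by
  classical
  have hmax : ∀ s, ∃ a ∈ M.avail s, ∀ b ∈ M.avail s, appeal s b ≤ appeal s a := fun s =>
    Finset.exists_max_image _ _ (M.avail_nonempty s)
  choose g hg hg' using hmax
  refine ⟨⟨fun s => if M.Switchable val appeal s then g s else π.1 s, fun s => ?_⟩,
    val, appeal, h, fun s => ⟨fun hs => ?_, fun hs => ?_⟩⟩
  · dsimp only
    split
    · exact hg s
    · exact π.2 s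
  · simpa [hs] using hg' s
  · simp [hs]

theorem GreedyStep.of_not_switchable {crit : M.Criterion L} {val : S → L} {appeal : S → Act → L}
    (h : crit π val appeal) (hs : ∀ s, ¬ M.Switchable val appeal s) : M.GreedyStep crit π π :=
  ⟨val, appeal, h, fun s => ⟨fun h' => absurd h' (hs s), fun _ => rfl⟩⟩

/-! ### The average reward criterion for policies with a total value -/

theorem HasTotalValue.hasGain {v : S → ℝ} (h : M.HasTotalValue π v) :
    M.HasGain π (fun _ => 0) := fun s => by
  simpa using (h s).div_atTop tendsto_natCast_atTop_atTop

theorem tendsto_cesaro {u : ℕ → ℝ} {l : ℝ} (h : Tendsto u atTop (𝓝 l)) :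
    Tendsto (fun N : ℕ => (∑ T ∈ Finset.range N, u T) / N) atTop (𝓝 l) := by
  simpa [div_eq_inv_mul] using h.cesaro

theorem HasTotalValue.hasBias {v : S → ℝ} (h : M.HasTotalValue π v) :
    M.HasBias π (fun _ => 0) v := fun s => by
  simp only [sub_zero]
  exact tendsto_cesaro (h s)

/-- Bounded partial sums have zero average, and a convergent sequence has its limit as Cesàro limit.
Gain and bias are unique, so the average data are the total data behind a zero coordinate. -/
theorem HasTotalValue.averageReward_iff {v : S → ℝ} (h : M.HasTotalValue π v)
    {val : S → ℝ ×ₗ ℝ} {appeal : S → Act → ℝ ×ₗ ℝ} :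
    M.averageReward π val appeal ↔ (∀ s, val s = toLex (0, v s)) ∧
      ∀ s a, appeal s a = toLex (0, M.r s a + ∑ s', M.p s a s' * v s') := by
  constructor
  · rintro ⟨g, b, hg, hb, h1, h2⟩
    obtain rfl : g = fun _ => 0 := funext fun s => tendsto_nhds_unique (hg s) (h.hasGain s)
    obtain rfl : b = v := funext fun s => tendsto_nhds_unique (hb s) (h.hasBias s)
    exact ⟨h1, fun s a => by simpa using h2 s a⟩
  · rintro ⟨h1, h2⟩
    exact ⟨fun _ => 0, v, h.hasGain, h.hasBias, h1, fun s a => by simpa using h2 s a⟩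

theorem toLex_zero_lt_iff {x y : ℝ} :
    (toLex ((0 : ℝ), x) : ℝ ×ₗ ℝ) < toLex (0, y) ↔ x < y := by
  simp [Prod.Lex.toLex_lt_toLex]

theorem toLex_zero_le_iff {x y : ℝ} :
    (toLex ((0 : ℝ), x) : ℝ ×ₗ ℝ) ≤ toLex (0, y) ↔ x ≤ y := by
  simp [Prod.Lex.toLex_le_toLex]

theorem switchable_toLex_iff {v : S → ℝ} {ap : S → Act → ℝ} {val : S → ℝ ×ₗ ℝ}
    {appeal : S → Act → ℝ ×ₗ ℝ} (h1 : ∀ s, val s = toLex (0, v s))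
    (h2 : ∀ s a, appeal s a = toLex (0, ap s a)) (s : S) :
    M.Switchable val appeal s ↔ M.Switchable v ap s := by
  simp only [Switchable, h1, h2, toLex_zero_lt_iff]

theorem HasTotalValue.greedyStep_average_iff {v : S → ℝ} (h : M.HasTotalValue π v)
    {π' : M.Policy} :
    M.GreedyStep M.averageReward π π' ↔ M.GreedyStep M.totalReward π π' := by
  constructor
  · rintro ⟨val, appeal, hc, hs⟩
    obtain ⟨h1, h2⟩ := h.averageReward_iff.1 hc
    refine ⟨v, _, ⟨h, fun _ _ => rfl⟩, fun s => ?_⟩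
    have := hs s
    rw [switchable_toLex_iff h1 h2] at this
    simpa only [h2, toLex_zero_le_iff] using this
  · rintro ⟨val, appeal, ⟨hv, h2⟩, hs⟩
    obtain rfl := h.unique hv
    refine ⟨fun s => toLex (0, v s), fun s a => toLex (0, appeal s a),
      h.averageReward_iff.2 ⟨fun _ => rfl, fun s a => by rw [h2]⟩, fun s => ?_⟩
    rw [switchable_toLex_iff (fun _ => rfl) (fun _ _ => rfl)]
    simpa only [toLex_zero_le_iff] using hs s

/-! ### Optimality of policies at which policy iteration stops -/

/-- The appeals depend on the values only. -/
def AppealDetermined (crit : M.Criterion L) : Prop :=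
  ∀ π π' val appeal appeal', crit π val appeal → crit π' val appeal' → appeal = appeal'

theorem appealDetermined_totalReward : AppealDetermined M.totalReward := by
  rintro π π' val ap ap' ⟨-, h⟩ ⟨-, h'⟩
  funext s a
  rw [h, h']

theorem appealDetermined_averageReward : AppealDetermined M.averageReward := by
  rintro π π' val ap ap' ⟨g, b, -, -, h1, h2⟩ ⟨g', b', -, -, h1', h2'⟩
  have h3 : ∀ s, (g s, b s) = (g' s, b' s) := fun s =>
    toLex.injective ((h1 s).symm.trans (h1' s))
  obtain rfl : g = g' := funext fun s => congrArg Prod.fst (h3 s)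
  obtain rfl : b = b' := funext fun s => congrArg Prod.snd (h3 s)
  funext s a
  rw [h2, h2']

/-- Policy iteration stops at `π`, and its values dominate those of all policies. -/
def IsTerminalOptimal (M : MDP S Act) (crit : M.Criterion L) (π : M.Policy) : Prop :=
  ∃ val appeal, crit π val appeal ∧ (∀ s, ¬ M.Switchable val appeal s) ∧
    ∀ π' val' appeal', crit π' val' appeal' → ∀ s, val' s ≤ val s

/-- Two value functions that dominate all others are equal, and equal values give equal appeals.
Used in contrapositive form, to see that policies which still move are not optimal. -/
theorem IsTerminalOptimal.isTerminal_of_isOptimal {crit : M.Criterion L}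
    (hd : AppealDetermined crit) (h : M.IsTerminalOptimal crit π) {π' : M.Policy}
    (h' : M.IsOptimal crit π') : M.IsTerminal crit π' := by
  obtain ⟨val, ap, hc, hs, hdom⟩ := h
  obtain ⟨val', ap', hc', hdom'⟩ := h'
  obtain rfl : val = val' := funext fun s => le_antisymm (hdom' _ _ _ hc s) (hdom _ _ _ hc' s)
  obtain rfl := hd _ _ _ _ _ hc hc'
  exact ⟨val, ap, hc', hs⟩

/-! ### Upper bounds from a superharmonic function with a compensating potential -/

section Dominance

variable {v u : S → ℝ}

/-- Iterates $r+Pv\le v$ along an arbitrary policy. The remainder $P^Tv$ may be negative; the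
potential `u` below serves to bound it. -/
theorem partialSum_add_le
    (hv : ∀ s, ∀ a ∈ M.avail s, M.r s a + ∑ s', M.p s a s' * v s' ≤ v s)
    (π : M.Policy) (T : ℕ) (s : S) :
    M.partialSum π (M.reward π) T s + ((M.transition π ^ T).mulVec v) s ≤ v s := by
  induction T generalizing s with
  | zero => simp [partialSum]
  | succ T ih =>
    rw [partialSum_succ, mulVec_pow_succ, add_assoc, ← Finset.sum_add_distrib]
    refine le_trans ?_ (hv s _ (π.2 s))
    refine add_le_add le_rfl (Finset.sum_le_sum fun s' _ => ?_)
    rw [← mul_add]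
    exact mul_le_mul_of_nonneg_left (ih s') (M.p_nonneg _ _ (π.2 s) _)

/-- At every step `u` drops in expectation by at least the negative part of `v`. Being nonnegative,
it bounds the total expected negative part of `v` along a trajectory, uniformly in the number of
steps. -/
theorem neg_le_partialSum
    (hu : ∀ s, ∀ a ∈ M.avail s, ∑ s', M.p s a s' * u s' ≤ u s + min (v s) 0)
    (hu0 : ∀ s, 0 ≤ u s)
    (π : M.Policy) (N : ℕ) (s : S) : -u s ≤ M.partialSum π v N s := by
  induction N generalizing s with
  | zero => simpa [partialSum] using hu0 s
  | succ N ih =>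
    rw [partialSum_succ]
    have h1 : ∑ s', M.p s (π.1 s) s' * -u s' ≤
        ∑ s', M.p s (π.1 s) s' * M.partialSum π v N s' :=
      Finset.sum_le_sum fun s' _ =>
        mul_le_mul_of_nonneg_left (ih s') (M.p_nonneg _ _ (π.2 s) _)
    simp only [mul_neg, Finset.sum_neg_distrib] at h1
    have h2 := hu s _ (π.2 s)
    have h3 := min_le_left (v s) 0
    linarith

theorem neg_le_mulVec_pow
    (hu : ∀ s, ∀ a ∈ M.avail s, ∑ s', M.p s a s' * u s' ≤ u s + min (v s) 0)
    (hu0 : ∀ s, 0 ≤ u s)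
    (π : M.Policy) (T : ℕ) (s : S) :
    -u s ≤ ((M.transition π ^ T).mulVec v) s := by
  induction T generalizing s with
  | zero =>
    have h2 := hu s _ (π.2 s)
    have h3 : 0 ≤ ∑ s', M.p s (π.1 s) s' * u s' :=
      Finset.sum_nonneg fun s' _ => mul_nonneg (M.p_nonneg _ _ (π.2 s) _) (hu0 s')
    have h4 := min_le_left (v s) 0
    simp only [pow_zero, Matrix.one_mulVec]
    linarith
  | succ T ih =>
    rw [mulVec_pow_succ]
    have h1 : ∑ s', M.p s (π.1 s) s' * -u s' ≤
        ∑ s', M.p s (π.1 s) s' * ((M.transition π ^ T).mulVec v) s' :=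
      Finset.sum_le_sum fun s' _ =>
        mul_le_mul_of_nonneg_left (ih s') (M.p_nonneg _ _ (π.2 s) _)
    simp only [mul_neg, Finset.sum_neg_distrib] at h1
    have h2 := hu s _ (π.2 s)
    have h3 := min_le_right (v s) 0
    linarith

/-- The sum of the first $N$ remainders $P^Tv$ is at least $-u$, so their average is negligible and
only the superharmonic bound survives. A Cesàro limit suffices for both criteria. -/
theorem cesaro_partialSum_le
    (hv : ∀ s, ∀ a ∈ M.avail s, M.r s a + ∑ s', M.p s a s' * v s' ≤ v s)
    (hu : ∀ s, ∀ a ∈ M.avail s, ∑ s', M.p s a s' * u s' ≤ u s + min (v s) 0)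
    (hu0 : ∀ s, 0 ≤ u s)
    (π : M.Policy) (s : S) {x : ℝ}
    (h : Tendsto (fun N : ℕ => (∑ T ∈ Finset.range N, M.partialSum π (M.reward π) T s) / N)
      atTop (𝓝 x)) : x ≤ v s := by
  have h1 : ∀ N : ℕ, ∑ T ∈ Finset.range N, M.partialSum π (M.reward π) T s ≤ N * v s + u s := by
    intro N
    have h2 := Finset.sum_le_sum fun T (_ : T ∈ Finset.range N) => partialSum_add_le hv π T s
    rw [Finset.sum_add_distrib, Finset.sum_const, Finset.card_range, nsmul_eq_mul] at h2
    have h3 := neg_le_partialSum hu hu0 π N s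
    unfold partialSum at h2 h3 ⊢
    linarith
  have h4 : Tendsto (fun N : ℕ => v s + u s / N) atTop (𝓝 (v s + 0)) :=
    tendsto_const_nhds.add (tendsto_const_nhds.div_atTop tendsto_natCast_atTop_atTop)
  rw [add_zero] at h4
  refine le_of_tendsto_of_tendsto h h4 ?_
  filter_upwards [eventually_gt_atTop 0] with N hN
  have hN' : (0 : ℝ) < N := by exact_mod_cast hN
  rw [div_le_iff₀ hN', add_mul, div_mul_cancel₀ _ hN'.ne']
  linarith [h1 N]

/-- The partial sums are bounded above by $v+u$, independently of $T$. -/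
theorem HasGain.nonpos
    (hv : ∀ s, ∀ a ∈ M.avail s, M.r s a + ∑ s', M.p s a s' * v s' ≤ v s)
    (hu : ∀ s, ∀ a ∈ M.avail s, ∑ s', M.p s a s' * u s' ≤ u s + min (v s) 0)
    (hu0 : ∀ s, 0 ≤ u s)
    {π : M.Policy} {g : S → ℝ} (h : M.HasGain π g) (s : S) : g s ≤ 0 := by
  have h4 : Tendsto (fun N : ℕ => (v s + u s) / (N : ℝ)) atTop (𝓝 0) :=
    tendsto_const_nhds.div_atTop tendsto_natCast_atTop_atTop
  refine le_of_tendsto_of_tendsto' (h s) h4 fun T => ?_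
  have h1 := partialSum_add_le hv π T s
  have h2 := neg_le_mulVec_pow hu hu0 π T s
  exact div_le_div_of_nonneg_right (by linarith) (Nat.cast_nonneg _)

/-- Divide the one-step equation by $T$; the single reward and the factor $(T+1)/T$ disappear in the
limit. -/
theorem HasGain.harmonic {π : M.Policy} {g : S → ℝ} (h : M.HasGain π g) (s : S) :
    g s = ∑ s', M.p s (π.1 s) s' * g s' := by
  have h1 : Tendsto (fun T : ℕ => M.partialSum π (M.reward π) (T + 1) s / ((T + 1 : ℕ) : ℝ))
      atTop (𝓝 (g s)) := (h s).comp (tendsto_add_atTop_nat 1)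
  have h2 : Tendsto (fun T : ℕ => ((T + 1 : ℕ) : ℝ) / (T : ℝ)) atTop (𝓝 1) := by
    have : Tendsto (fun T : ℕ => 1 + 1 / (T : ℝ)) atTop (𝓝 (1 + 0)) :=
      tendsto_const_nhds.add (tendsto_const_nhds.div_atTop tendsto_natCast_atTop_atTop)
    rw [add_zero] at this
    refine this.congr' ?_
    filter_upwards [eventually_gt_atTop 0] with N hN
    have hN' : (N : ℝ) ≠ 0 := by exact_mod_cast hN.ne'
    push_cast
    field_simp
  have h3 : Tendsto (fun T : ℕ => M.reward π s / (T : ℝ) +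
      ∑ s', M.p s (π.1 s) s' * (M.partialSum π (M.reward π) T s' / T)) atTop
      (𝓝 (0 + ∑ s', M.p s (π.1 s) s' * g s')) :=
    (tendsto_const_nhds.div_atTop tendsto_natCast_atTop_atTop).add
      (tendsto_finsetSum _ fun s' _ => (h s').const_mul _)
  have h4 := h1.mul h2
  rw [mul_one] at h4
  rw [zero_add] at h3
  refine tendsto_nhds_unique h4 (h3.congr' ?_)
  filter_upwards [eventually_gt_atTop 0] with N hN
  have hN' : (N : ℝ) ≠ 0 := by exact_mod_cast hN.ne'
  have hN'' : ((N + 1 : ℕ) : ℝ) ≠ 0 := by positivity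
  rw [div_mul_div_cancel₀ hN'', partialSum_succ, add_div, Finset.sum_div]
  simp only [mul_div_assoc]

/-- Since $Pg=g$, the expected gain after any number of steps is still $g(s)=0$, even if the chain
visits states of nonzero gain. -/
theorem partialSum_sub_gain {π : M.Policy} {g : S → ℝ} (h : M.HasGain π g) {s : S}
    (hs : g s = 0) (T : ℕ) :
    M.partialSum π (fun s' => M.reward π s' - g s') T s = M.partialSum π (M.reward π) T s := by
  have hpow : ∀ t s, ((M.transition π ^ t).mulVec g) s = g s := by
    intro t
    induction t with
    | zero => simp
    | succ t ih => intro s; rw [mulVec_pow_succ, h.harmonic s]; simp only [ih]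
  unfold partialSum
  refine Finset.sum_congr rfl fun t _ => ?_
  have : (fun s' => M.reward π s' - g s') = M.reward π - g := rfl
  rw [this, Matrix.mulVec_sub, Pi.sub_apply, hpow, hs, sub_zero]

theorem isTerminalOptimal_totalReward
    (hu : ∀ s, ∀ a ∈ M.avail s, ∑ s', M.p s a s' * u s' ≤ u s + min (v s) 0)
    (hu0 : ∀ s, 0 ≤ u s)
    (h : M.HasTotalValue π v)
    (hs : ∀ s, ¬ M.Switchable v (fun s a => M.r s a + ∑ s', M.p s a s' * v s') s) :
    M.IsTerminalOptimal M.totalReward π := by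
  refine ⟨v, _, ⟨h, fun _ _ => rfl⟩, hs, ?_⟩
  rintro π' v' ap' ⟨h', -⟩ s
  refine cesaro_partialSum_le (fun s a ha => ?_) hu hu0 π' s (tendsto_cesaro (h' s))
  by_contra hlt
  exact hs s ⟨a, ha, not_le.1 hlt⟩

theorem isTerminalOptimal_averageReward
    (hu : ∀ s, ∀ a ∈ M.avail s, ∑ s', M.p s a s' * u s' ≤ u s + min (v s) 0)
    (hu0 : ∀ s, 0 ≤ u s)
    (h : M.HasTotalValue π v)
    (hs : ∀ s, ¬ M.Switchable v (fun s a => M.r s a + ∑ s', M.p s a s' * v s') s) :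
    M.IsTerminalOptimal M.averageReward π := by
  refine ⟨fun s => toLex (0, v s),
    fun s a => toLex (0, M.r s a + ∑ s', M.p s a s' * v s'),
    h.averageReward_iff.2 ⟨fun _ => rfl, fun _ _ => rfl⟩, fun s => ?_, ?_⟩
  · rw [switchable_toLex_iff (fun _ => rfl) (fun _ _ => rfl)]
    exact hs s
  rintro π' val' ap' ⟨g, b, hg, hb, h1, -⟩ s
  have hv : ∀ s, ∀ a ∈ M.avail s, M.r s a + ∑ s', M.p s a s' * v s' ≤ v s := by
    intro s a ha
    by_contra hlt
    exact hs s ⟨a, ha, not_le.1 hlt⟩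
  rw [h1, Prod.Lex.toLex_le_toLex]
  -- A negative gain already loses in the first coordinate; at gain zero the bias is the Cesàro
  -- limit of the plain partial sums.
  rcases (HasGain.nonpos hv hu hu0 hg s).lt_or_eq with hlt | heq
  · exact Or.inl hlt
  · refine Or.inr ⟨heq, cesaro_partialSum_le hv hu hu0 π' s ?_⟩
    have := hb s
    simpa only [partialSum_sub_gain hg heq] using this

end Dominance

end MDP

namespace FullConstruction

variable {n : ℕ} [NeZero n]

/-! ### Appeals as functions of the values -/

/-- The appeal of an action under the total reward criterion, for given values. -/
def appealOf (P : Params n) (v : State n → ℝ) (s : State n) (a : Action n) : ℝ :=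
  rew P s a + ∑ s', trans P s a s' * v s'

/-- The states `d_1, …, d_n, d_{n+1}`. -/
def dAt (k : Fin (n + 1)) : State n :=
  if h : k.val < n then .d ⟨k.val, h⟩ else .dTop

theorem dNext_eq (i : Fin n) : dNext i = dAt i.succ := by
  simp [dNext, dAt]

@[simp] theorem dAt_castSucc (i : Fin n) : dAt i.castSucc = .d i := by
  simp [dAt]

@[simp] theorem dAt_last : dAt (Fin.last n) = (.dTop : State n) := by
  simp [dAt]

theorem sum_goto (x : State n) (v : State n → ℝ) : ∑ s', goto x s' * v s' = v x := by
  simp [goto]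

theorem sum_lottery (q : ℝ) (x y : State n) (v : State n → ℝ) :
    ∑ s', lottery q x y s' * v s' = q * v x + (1 - q) * v y := by
  simp only [lottery, add_mul, Finset.sum_add_distrib, mul_assoc, ← Finset.mul_sum, sum_goto]

section Appeals

variable (P : Params n) (v : State n → ℝ)

theorem appealOf_w_toBit (k : Fin (n + 1)) (l : Fin n) :
    appealOf P v (.w k) (.toBit l) = v (entry l) := by
  simp [appealOf, trans, rew, sum_goto]

theorem appealOf_w_toSink (k : Fin (n + 1)) : appealOf P v (.w k) .toSink = v .sink := by
  simp [appealOf, trans, rew, sum_goto]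

theorem appealOf_b_zero (i : Fin n) : appealOf P v (.b i) .zero = v (.w i.succ) := by
  simp [appealOf, trans, rew, sum_goto]

theorem appealOf_first_one : appealOf P v (.b 0) .one = P.r 0 + v (dAt (Fin.succ 0)) := by
  simp [appealOf, trans, rew, sum_goto, dNext_eq]

theorem appealOf_b_one (i : Fin n) (h : i ≠ 0) :
    appealOf P v (.b i) .one = P.α i * v (.bPlus ⟨i, h⟩) + (1 - P.α i) * v (.b i) := by
  simp [appealOf, trans, rew, sum_lottery, h]

theorem appealOf_b_delay_zero (i : Fin n) :
    appealOf P v (.b i) (.delay 0) = v (.w 0) := by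
  simp [appealOf, trans, rew, sum_goto]

theorem appealOf_b_delay (i : Fin n) {j : ℕ} (hj : 1 ≤ j) :
    appealOf P v (.b i) (.delay j) =
      v (.b i) + P.p i j * (P.δ i j + v (.b 0) - v (.b i)) := by
  obtain ⟨j, rfl⟩ : ∃ k, j = k + 1 := ⟨j - 1, by omega⟩
  simp only [appealOf, trans, rew, sum_lottery]
  ring

theorem appealOf_bMinus (i : {i : Fin n // i ≠ 0}) :
    appealOf P v (.bMinus i) .only = -P.c i + v (.b i) := by
  simp [appealOf, trans, rew, sum_goto]

theorem appealOf_bPlus (i : {i : Fin n // i ≠ 0}) :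
    appealOf P v (.bPlus i) .only = P.r i + v (dAt i.1.succ) := by
  simp [appealOf, trans, rew, sum_goto, dNext_eq]

theorem appealOf_c_zero (i : Fin n) : appealOf P v (.c i) .zero = v (.w i.succ) := by
  simp [appealOf, trans, rew, sum_goto]

theorem appealOf_c_one (i : Fin n) :
    appealOf P v (.c i) .one = -P.εc i.castSucc + v (entry i) := by
  simp [appealOf, trans, rew, sum_goto]

theorem appealOf_d_zero (i : Fin n) : appealOf P v (.d i) .zero = v (.w i.succ) := by
  simp [appealOf, trans, rew, sum_goto]

theorem appealOf_d_one (i : Fin n) :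
    appealOf P v (.d i) .one = -P.εd i.castSucc + v (.c i) := by
  simp [appealOf, trans, rew, sum_goto]

theorem appealOf_cTop : appealOf P v .cTop .only = -P.εc (Fin.last n) + v .dTop := by
  simp [appealOf, trans, rew, sum_goto]

theorem appealOf_dTop : appealOf P v .dTop .only = -P.εd (Fin.last n) + v .sink := by
  simp [appealOf, trans, rew, sum_goto]

end Appeals

/-! ### Equations satisfied by the values of a policy -/

/-- `v` satisfies the equations for the values of the policy `π`, and vanishes at the sink. -/
structure Evaluates (P : Params n) (π : State n → Action n) (v : State n → ℝ) : Prop where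
  sink : v .sink = 0
  eq : ∀ s, v s = appealOf P v s (π s)

variable {P : Params n}

theorem evaluates_of_hasTotalValue {π : (mdp P).Policy} {v : State n → ℝ}
    (h : (mdp P).HasTotalValue π v) : Evaluates P π.1 v := by
  refine ⟨?_, h.bellman⟩
  have h0 := MDP.partialSum_of_absorbing (M := mdp P) (π := π) (s := .sink) rfl
    (fun x => sum_goto _ _)
  refine tendsto_nhds_unique (h .sink) ?_
  simp only [h0]
  exact tendsto_const_nhds

theorem eq_only {π : (mdp P).Policy} {s : State n} (h : avail s = {.only}) : π.1 s = .only := by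
  have := π.2 s
  rw [show (mdp P).avail s = {.only} from h] at this
  simpa using this

namespace Evaluates

variable {π : (mdp P).Policy} {v : State n → ℝ}

theorem dTop (h : Evaluates P π.1 v) : v .dTop = -P.εd (Fin.last n) := by
  rw [h.eq, eq_only rfl, appealOf_dTop, h.sink, add_zero]

theorem cTop (h : Evaluates P π.1 v) : v .cTop = -P.εc (Fin.last n) - P.εd (Fin.last n) := by
  rw [h.eq, eq_only rfl, appealOf_cTop, h.dTop]
  ring

theorem entry (h : Evaluates P π.1 v) (i : Fin n) : v (entry i) = -P.c i + v (.b i) := by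
  unfold FullConstruction.entry
  split_ifs with h0
  · rw [h0, P.c_first]; simp
  · rw [h.eq, eq_only rfl, appealOf_bMinus]

theorem bPlus (h : Evaluates P π.1 v) (i : {i : Fin n // i ≠ 0}) :
    v (.bPlus i) = P.r i + v (dAt i.1.succ) := by
  rw [h.eq, eq_only rfl, appealOf_bPlus]

/-- The self-loop only delays the exit: the positive probability $\alpha_i$ cancels. The same
happens for $p^i_j$ in `b_delay`. -/
theorem b_one (h : Evaluates P π.1 v) {i : Fin n} (hi : π.1 (.b i) = .one) :
    v (.b i) = P.r i + v (dAt i.succ) := by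
  by_cases h0 : i = 0
  · subst h0
    rw [h.eq, hi, appealOf_first_one]
  · have h1 := h.eq (.b i)
    rw [hi, appealOf_b_one P v i h0, h.bPlus] at h1
    have h2 : P.α i * v (.b i) = P.α i * (P.r i + v (dAt i.succ)) := by linarith
    exact mul_left_cancel₀ (P.α_pos i).ne' h2

theorem b_zero (h : Evaluates P π.1 v) {i : Fin n} (hi : π.1 (.b i) = .zero) :
    v (.b i) = v (.w i.succ) := by
  rw [h.eq, hi, appealOf_b_zero]

theorem b_delay_zero (h : Evaluates P π.1 v) {i : Fin n} (hi : π.1 (.b i) = .delay 0) :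
    v (.b i) = v (.w 0) := by
  rw [h.eq, hi, appealOf_b_delay_zero]

theorem b_delay (h : Evaluates P π.1 v) {i : Fin n} {j : ℕ} (hj : 1 ≤ j)
    (hi : π.1 (.b i) = .delay j) : v (.b i) = v (.b 0) + P.δ i j := by
  have h1 := h.eq (.b i)
  rw [hi, appealOf_b_delay P v i hj] at h1
  have h2 : P.p i j * (P.δ i j + v (.b 0) - v (.b i)) = 0 := by linarith
  rcases mul_eq_zero.1 h2 with h3 | h3
  · exact absurd h3 (P.p_pos i j).ne'
  · linarith

end Evaluates

/-! ### Consequences of the gaps between the rewards and costs -/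

namespace Params

variable (P : Params n)

theorem εc_le (i : Fin (n + 1)) : P.εc i ≤ P.εmax :=
  (le_max_left _ _).trans (Finset.le_sup' (fun i => max (P.εc i) (P.εd i)) (Finset.mem_univ i))

theorem εd_le (i : Fin (n + 1)) : P.εd i ≤ P.εmax :=
  (le_max_right _ _).trans (Finset.le_sup' (fun i => max (P.εc i) (P.εd i)) (Finset.mem_univ i))

theorem εmax_pos : 0 < P.εmax := (P.εc_pos 0).trans_le (P.εc_le 0)

theorem bddAbove_δ :
    BddAbove {x : ℝ | ∃ i : Fin n, i ≠ 0 ∧ ∃ j : ℕ, 1 ≤ j ∧ j ≤ f i ∧ x = P.δ i j} := by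
  refine ((Finset.univ.biUnion fun i : Fin n =>
    (Finset.range (f i + 1)).image (P.δ i)).finite_toSet.subset ?_).bddAbove
  rintro x ⟨i, -, j, -, hj, rfl⟩
  simp only [Finset.coe_biUnion, Set.mem_iUnion, Finset.mem_coe, Finset.mem_image,
    Finset.mem_range, Finset.mem_univ]
  exact ⟨i, trivial, j, by omega, rfl⟩

theorem δ_le {i : Fin n} (hi : i ≠ 0) {j : ℕ} (h1 : 1 ≤ j) (hj : j ≤ f i) : P.δ i j ≤ P.δmax :=
  le_csSup P.bddAbove_δ ⟨i, hi, j, h1, hj, rfl⟩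

/-- The total reward of the bits below `k`. -/
def rewardBelow (k : Fin (n + 1)) : ℝ := ∑ i : Fin n with i.castSucc < k, P.r i

theorem rewardBelow_succ (i : Fin n) :
    P.rewardBelow i.succ = P.rewardBelow i.castSucc + P.r i := by
  have : (Finset.univ.filter fun j : Fin n => j.castSucc < i.succ) =
      insert i (Finset.univ.filter fun j : Fin n => j.castSucc < i.castSucc) := by
    ext j
    simp only [Finset.mem_filter, Finset.mem_univ, true_and, Finset.mem_insert, Fin.lt_def,
      Fin.val_castSucc, Fin.val_succ, Fin.ext_iff]
    omega
  rw [rewardBelow, this, Finset.sum_insert (by simp), add_comm]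
  rfl

theorem rewardBelow_castSucc (i : Fin n) :
    P.rewardBelow i.castSucc = ∑ j ∈ Finset.Iio i, P.r j := by
  refine Finset.sum_congr ?_ fun _ _ => rfl
  ext j
  simp

/-- The conditions on rewards and costs. -/
structure Gaps (P : Params n) : Prop where
  rewardGap : P.RewardGap
  costGap : P.CostGap
  δmax_nonneg : 0 ≤ P.δmax

/-- The case in which there is only one bit, whose reward does not make up for the
costs on the way from `d_1`. -/
def Stuck (P : Params n) : Prop :=
  n = 1 ∧ P.r 0 ≤ P.εc (Fin.castSucc 0) + P.εd (Fin.castSucc 0) + P.εd (Fin.last n)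

variable {P}

theorem one_le_cast : (1 : ℝ) ≤ n := by
  exact_mod_cast Nat.one_le_iff_ne_zero.2 (NeZero.ne n)

theorem εmax_le : P.εmax ≤ n * P.εmax :=
  le_mul_of_one_le_left P.εmax_pos.le one_le_cast

namespace Gaps

/-- Strong induction: once the lower rewards are positive, the cost gap bounds $c(i)$ below, and the
reward gap then bounds $r(i)$. -/
theorem c_nonneg_and_r_pos (h : P.Gaps) (i : Fin n) : 0 ≤ P.c i ∧ 0 < P.r i := by
  have key : ∀ m : ℕ, ∀ i : Fin n, i.val = m → 0 ≤ P.c i ∧ 0 < P.r i := by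
    intro m
    induction m using Nat.strong_induction_on with
    | _ m ih =>
      rintro i rfl
      have hs : 0 ≤ ∑ j ∈ Finset.Iio i, P.r j :=
        Finset.sum_nonneg fun j hj => (ih j (by simpa using hj) j rfl).2.le
      have h1 := h.rewardGap i
      have h2 := h.costGap i
      have h3 := εmax_le (P := P)
      have h4 := P.εmax_pos
      have h5 := h.δmax_nonneg
      by_cases h0 : i = 0
      · subst h0
        rw [P.c_first] at h1 ⊢
        exact ⟨le_rfl, by linarith⟩
      · have h6 := h2 h0
        exact ⟨by linarith, by linarith⟩
  exact key _ i rfl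

theorem c_nonneg (h : P.Gaps) (i : Fin n) : 0 ≤ P.c i := (h.c_nonneg_and_r_pos i).1

theorem r_pos (h : P.Gaps) (i : Fin n) : 0 < P.r i := (h.c_nonneg_and_r_pos i).2

theorem rewardBelow_nonneg (h : P.Gaps) (k : Fin (n + 1)) : 0 ≤ P.rewardBelow k :=
  Finset.sum_nonneg fun i _ => (h.r_pos i).le

theorem lt_c (h : P.Gaps) {i : Fin n} (hi : i ≠ 0) :
    P.rewardBelow i.castSucc + P.δmax < P.c i := by
  have h1 := h.costGap i hi
  have h3 := εmax_le (P := P)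
  have h4 := P.εmax_pos
  rw [rewardBelow_castSucc]
  linarith

theorem lt_sub (h : P.Gaps) (i : Fin n) :
    P.rewardBelow i.castSucc + P.δmax + 2 * n * P.εmax < P.r i - P.c i := by
  have h1 := h.rewardGap i
  rw [rewardBelow_castSucc]
  linarith

end Gaps

end Params

/-! ### The values along the ladder formed by the states `w_i` and `d_i` -/

/-- The equations for the values `w k` of `w_k` and `d k` of `d_k`, at the levels from `lo` on,
when `B` is the set of bits that are set. -/
structure Ladder (P : Params n) (B : Finset (Fin n)) (lo : Fin (n + 1))
    (w d : Fin (n + 1) → ℝ) : Prop where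
  w_last : w (Fin.last n) = 0
  d_last : d (Fin.last n) = -P.εd (Fin.last n)
  w_mem : ∀ i ∈ B, lo ≤ i.castSucc → w i.castSucc = P.r i - P.c i + d i.succ
  d_mem : ∀ i ∈ B, lo ≤ i.castSucc →
    d i.castSucc = w i.castSucc - P.εc i.castSucc - P.εd i.castSucc
  w_notMem : ∀ i ∉ B, lo ≤ i.castSucc → w i.castSucc = w i.succ
  d_notMem : ∀ i ∉ B, lo ≤ i.castSucc → d i.castSucc = w i.succ

namespace Ladder

variable {B : Finset (Fin n)} {lo : Fin (n + 1)} {w d : Fin (n + 1) → ℝ}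

theorem d_le_w (h : Ladder P B lo w d) {k : Fin (n + 1)} (hk : lo ≤ k) : d k ≤ w k := by
  cases k using Fin.lastCases with
  | last => rw [h.w_last, h.d_last]; linarith [P.εd_pos (Fin.last n)]
  | cast i =>
    by_cases hi : i ∈ B
    · rw [h.d_mem i hi hk]
      linarith [P.εd_pos i.castSucc, P.εc_pos i.castSucc]
    · rw [h.d_notMem i hi hk, h.w_notMem i hi hk]

theorem w_le_d_last (h : Ladder P B lo w d) :
    w (Fin.last n) ≤ d (Fin.last n) + P.εmax := by
  rw [h.w_last, h.d_last]; linarith [P.εd_le (Fin.last n)]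

theorem w_le_d (h : Ladder P B lo w d) {k : Fin (n + 1)} (hk : lo ≤ k) :
    w k ≤ d k + 2 * P.εmax := by
  cases k using Fin.lastCases with
  | last => linarith [h.w_le_d_last, P.εmax_pos]
  | cast i =>
    by_cases hi : i ∈ B
    · rw [h.d_mem i hi hk]
      linarith [P.εd_le i.castSucc, P.εc_le i.castSucc]
    · rw [h.d_notMem i hi hk, h.w_notMem i hi hk]
      linarith [P.εmax_pos]

/-- Four small costs are the worst case: two for having $d_{i+1}$ in place of $w_{i+1}$, and two for
entering the bit through $d_i$ and $c_i$. -/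
theorem four_le (hn : n ≠ 1) : 4 * P.εmax ≤ 2 * n * P.εmax := by
  have h2 : (2 : ℝ) ≤ n := by
    have := NeZero.ne n
    exact_mod_cast (show 2 ≤ n by omega)
  have := mul_le_mul_of_nonneg_right h2 P.εmax_pos.le
  linarith

theorem eq_last_of_eq_one (hn : n = 1) (i : Fin n) : i.succ = Fin.last n := by
  ext; simp; omega

/-- Entering the bit `i` through its entry and collecting its reward pays off. -/
theorem profit (h : Ladder P B lo w d) (hg : P.Gaps) {i : Fin n} (hi : lo ≤ i.succ) :
    P.rewardBelow i.castSucc + P.δmax + P.εmax + w i.succ < P.r i - P.c i + d i.succ := by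
  have h1 := hg.lt_sub i
  -- For one bit the gap leaves only $2\epsilon_{\max}$, but then level $i+1$ is the top one, where
  -- $w$ and $d$ differ by a single cost.
  by_cases hn : n = 1
  · have h2 := h.w_le_d_last
    rw [← eq_last_of_eq_one hn i] at h2
    have h3 := Params.εmax_le (P := P)
    linarith
  · have h2 := four_le (P := P) hn
    linarith [h.w_le_d hi, P.εmax_pos]

/-- The same, starting at `d_i`. -/
theorem profit_d (h : Ladder P B lo w d) (hg : P.Gaps) (hs : ¬ P.Stuck) {i : Fin n}
    (hi : lo ≤ i.succ) :
    w i.succ < P.r i - P.c i + d i.succ - P.εc i.castSucc - P.εd i.castSucc := by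
  -- For one bit three small costs are to be paid and the reward gap need not cover them; the
  -- failure of `Stuck` is exactly what is needed.
  by_cases hn : n = 1
  · have h0 : i = 0 := by ext; simp; omega
    subst h0
    simp only [Params.Stuck, hn, true_and, not_le] at hs
    rw [eq_last_of_eq_one hn 0, h.w_last, h.d_last, P.c_first]
    linarith
  · have h1 := hg.lt_sub i
    have h2 := four_le (P := P) hn
    linarith [h.w_le_d hi, P.εd_le i.castSucc, P.εc_le i.castSucc,
      hg.rewardBelow_nonneg i.castSucc, hg.δmax_nonneg]

theorem w_succ_lt (h : Ladder P B lo w d) (hg : P.Gaps) {i : Fin n} (hB : i ∈ B)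
    (hi : lo ≤ i.castSucc) : P.εmax + w i.succ < w i.castSucc := by
  rw [h.w_mem i hB hi]
  linarith [h.profit hg (hi.trans i.castSucc_lt_succ.le), P.εmax_pos,
    hg.rewardBelow_nonneg i.castSucc, hg.δmax_nonneg]

theorem w_succ_le (h : Ladder P B lo w d) (hg : P.Gaps) {i : Fin n}
    (hi : lo ≤ i.castSucc) : w i.succ ≤ w i.castSucc := by
  by_cases hB : i ∈ B
  · linarith [h.w_succ_lt hg hB hi, P.εmax_pos]
  · exact (h.w_notMem i hB hi).ge

theorem w_castSucc_le (h : Ladder P B lo w d) (hg : P.Gaps) {i : Fin n}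
    (hi : lo ≤ i.castSucc) : w i.castSucc ≤ w i.succ + P.r i := by
  by_cases hB : i ∈ B
  · rw [h.w_mem i hB hi]
    linarith [h.d_le_w (hi.trans i.castSucc_lt_succ.le), hg.c_nonneg i]
  · rw [h.w_notMem i hB hi]
    linarith [hg.r_pos i]

theorem w_antitone (h : Ladder P B lo w d) (hg : P.Gaps) {j k : Fin (n + 1)} (hj : lo ≤ j)
    (hjk : j ≤ k) : w k ≤ w j := by
  induction k using Fin.induction with
  | zero => rw [le_antisymm hjk (Fin.zero_le _)]
  | succ i ih =>
    rcases hjk.eq_or_lt with rfl | hlt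
    · rfl
    · have h1 : j ≤ i.castSucc := Fin.le_castSucc_iff.2 hlt
      exact (h.w_succ_le hg (hj.trans h1)).trans (ih h1)

/-- Each level passed contributes at most its reward, so $w_k$ plus the rewards below $k$ grows with
$k$. This caps what lower bits can add. -/
theorem w_le (h : Ladder P B lo w d) (hg : P.Gaps) {j k : Fin (n + 1)} (hj : lo ≤ j)
    (hjk : j ≤ k) : w j + P.rewardBelow j ≤ w k + P.rewardBelow k := by
  induction k using Fin.induction with
  | zero => rw [le_antisymm hjk (Fin.zero_le _)]
  | succ i ih =>
    rcases hjk.eq_or_lt with rfl | hlt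
    · rfl
    · have h1 : j ≤ i.castSucc := Fin.le_castSucc_iff.2 hlt
      rw [P.rewardBelow_succ]
      linarith [h.w_castSucc_le hg (hj.trans h1), ih h1]

theorem w_nonneg (h : Ladder P B lo w d) (hg : P.Gaps) {k : Fin (n + 1)} (hk : lo ≤ k) :
    0 ≤ w k := by
  rw [← h.w_last]
  exact h.w_antitone hg hk (Fin.le_last k)

end Ladder

/-! ### The least set bit from a given level on -/

/-- The action of `w_k` that goes to the least bit of `B` from `k` on, or to the sink. -/
def target (B : Finset (Fin n)) (k : Fin (n + 1)) : Action n :=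
  if h : (B.filter (k ≤ ·.castSucc)).Nonempty then
    .toBit ((B.filter (k ≤ ·.castSucc)).min' h) else .toSink

section Target

variable {B B' : Finset (Fin n)}

theorem target_congr {k k' : Fin (n + 1)}
    (h : ∀ i : Fin n, i ∈ B ∧ k ≤ i.castSucc ↔ i ∈ B' ∧ k' ≤ i.castSucc) :
    target B k = target B' k' := by
  have : B.filter (k ≤ ·.castSucc) = B'.filter (k' ≤ ·.castSucc) := by
    ext i
    simpa only [Finset.mem_filter] using h i
  simp only [target, this]

theorem target_eq_toBit {k : Fin (n + 1)} {l : Fin n} (hl : l ∈ B) (hk : k ≤ l.castSucc)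
    (hmin : ∀ m ∈ B, k ≤ m.castSucc → l ≤ m) : target B k = .toBit l := by
  have hne : (B.filter (k ≤ ·.castSucc)).Nonempty := ⟨l, Finset.mem_filter.2 ⟨hl, hk⟩⟩
  rw [target, dif_pos hne]
  congr 1
  refine le_antisymm (Finset.min'_le _ _ (Finset.mem_filter.2 ⟨hl, hk⟩)) ?_
  have := Finset.mem_filter.1 (Finset.min'_mem _ hne)
  exact hmin _ this.1 this.2

theorem target_eq_toSink {k : Fin (n + 1)} (h : ∀ m ∈ B, ¬ k ≤ m.castSucc) :
    target B k = .toSink := by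
  rw [target, dif_neg]
  rintro ⟨m, hm⟩
  rw [Finset.mem_filter] at hm
  exact h m hm.1 hm.2

theorem target_mem {i : Fin n} (hi : i ∈ B) : target B i.castSucc = .toBit i :=
  target_eq_toBit hi le_rfl fun _ _ h => by simpa using h

theorem target_notMem {i : Fin n} (hi : i ∉ B) : target B i.castSucc = target B i.succ := by
  refine target_congr fun m => ?_
  constructor
  · rintro ⟨hm, h⟩
    refine ⟨hm, ?_⟩
    have : i ≠ m := fun h => hi (h ▸ hm)
    simp only [Fin.le_def, Fin.val_castSucc, Fin.val_succ, ne_eq, Fin.ext_iff] at h this ⊢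
    omega
  · rintro ⟨hm, h⟩
    exact ⟨hm, i.castSucc_lt_succ.le.trans h⟩

theorem target_mem_avail (B : Finset (Fin n)) (k : Fin (n + 1)) :
    target B k ∈ avail (State.w k) := by
  unfold target
  split
  · rename_i h
    have := Finset.mem_filter.1 (Finset.min'_mem _ h)
    simp [avail, this.2]
  · simp [avail]

end Target

theorem w_last_eq (π : (mdp P).Policy) : π.1 (.w (Fin.last n)) = .toSink := by
  have h := π.2 (.w (Fin.last n))
  simp only [mdp, avail, Finset.mem_insert, Finset.mem_image, Finset.mem_filter,
    Finset.mem_univ, true_and] at h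
  rcases h with h | ⟨j, hj, -⟩
  · exact h
  · exact absurd hj (not_le.2 j.castSucc_lt_last)

theorem mem_setBits {π : (mdp P).Policy} {i : Fin n} : i ∈ setBits π ↔ π.1 (.b i) = .one := by
  simp [setBits]

theorem w_eq_target {π : (mdp P).Policy} (h : WeakInvariant π) (k : Fin (n + 1)) :
    π.1 (.w k) = target (setBits π) k := by
  cases k using Fin.lastCases with
  | last =>
    rw [w_last_eq, target_eq_toSink fun m _ => not_le.2 m.castSucc_lt_last]
  | cast i =>
    by_cases hne : ((setBits π).filter (i.castSucc ≤ ·.castSucc)).Nonempty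
    · have hm := Finset.mem_filter.1 (Finset.min'_mem _ hne)
      rw [target, dif_pos hne]
      exact h.2.2.1 i _ hm.1 (by simp) fun m hm hle =>
        Finset.min'_le _ _ (Finset.mem_filter.2 ⟨hm, by simpa using hle⟩)
    · rw [target, dif_neg hne]
      refine h.2.2.2 i fun m hm hle => hne ⟨m, Finset.mem_filter.2 ⟨hm, by simpa using hle⟩⟩

theorem b_first_eq {π : (mdp P).Policy} (h : π.1 (.b 0) ≠ .one) : π.1 (.b 0) = .zero := by
  have := π.2 (.b 0)
  simp only [mdp, avail, if_true, Finset.mem_insert, Finset.mem_singleton] at this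
  tauto

theorem b_avail {i : Fin n} (hi : i ≠ 0) {a : Action n} :
    a ∈ avail (State.b i) ↔ a = .one ∨ ∃ j ≤ f i, a = .delay j := by
  simp only [avail, hi, if_false, Finset.mem_insert, Finset.mem_image, Finset.mem_range,
    Nat.lt_succ_iff, eq_comm]

/-! ### The values of a policy along the ladder -/

namespace Evaluates

variable {π : (mdp P).Policy} {v : State n → ℝ}

/-- The lower limit `lo` is needed because during an increment of bit $\ell$ the equations hold only
above level $\ell$. -/
theorem ladder (h : Evaluates P π.1 v) {B : Finset (Fin n)} {lo : Fin (n + 1)}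
    (hw : ∀ k, lo ≤ k → π.1 (.w k) = target B k)
    (hb : ∀ i ∈ B, lo ≤ i.castSucc → π.1 (.b i) = .one ∧ π.1 (.c i) = .one)
    (hd : ∀ i, lo ≤ i.castSucc → π.1 (.d i) = if i ∈ B then .one else .zero) :
    Ladder P B lo (fun k => v (.w k)) (fun k => v (dAt k)) where
  w_last := by
    rw [h.eq, w_last_eq, appealOf_w_toSink, h.sink]
  d_last := by
    rw [dAt_last, h.dTop]
  w_mem i hi hlo := by
    rw [h.eq, hw _ hlo, target_mem hi, appealOf_w_toBit, h.entry, h.b_one (hb i hi hlo).1]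
    ring
  d_mem i hi hlo := by
    rw [dAt_castSucc, h.eq (.d i), hd i hlo, if_pos hi, appealOf_d_one, h.eq (.c i),
      (hb i hi hlo).2, appealOf_c_one, h.eq (.w _), hw _ hlo, target_mem hi, appealOf_w_toBit]
    ring
  w_notMem i hi hlo := by
    -- Both $w$ states have the same target, and the appeal of a target does not depend on the
    -- level.
    have h1 := hw _ hlo
    have h2 := hw _ (hlo.trans i.castSucc_lt_succ.le)
    rw [target_notMem hi, ← h2] at h1
    rw [h.eq (.w _), h.eq (.w i.succ), h1, h2]
    cases target B i.succ <;> rfl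
  d_notMem i hi hlo := by
    rw [dAt_castSucc, h.eq (.d i), hd i hlo, if_neg hi, appealOf_d_zero]

theorem ladder_of_weakInvariant (h : Evaluates P π.1 v) (hπ : WeakInvariant π) :
    Ladder P (setBits π) 0 (fun k => v (.w k)) (fun k => v (dAt k)) := by
  refine h.ladder (fun k _ => w_eq_target hπ k)
    (fun i hi _ => ⟨mem_setBits.1 hi, (hπ.1 i hi).1⟩) fun i _ => ?_
  split_ifs with hi
  · exact (hπ.1 i hi).2
  · exact (hπ.2.1 i hi).2

/-- If bit $1$ is set, $w_1$ enters $b_1$ at no cost because $c(1)=0$; otherwise both inherit the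
value of $w_2$. -/
theorem b_first_of_weakInvariant (h : Evaluates P π.1 v) (hπ : WeakInvariant π) :
    v (.b 0) = v (.w 0) := by
  have hL := h.ladder_of_weakInvariant hπ
  by_cases h0 : (0 : Fin n) ∈ setBits π
  · have h1 := hL.w_mem 0 h0 (Fin.zero_le _)
    rw [P.c_first] at h1
    rw [h.b_one (mem_setBits.1 h0)]
    simpa using h1.symm
  · rw [h.b_zero (b_first_eq fun h1 => h0 (mem_setBits.2 h1))]
    exact (hL.w_notMem 0 h0 (Fin.zero_le _)).symm

end Evaluates

/-! ### The policies of the run -/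

/-- The action function in which `A` is the set of bits that are set, `w_k` goes to the least bit
of `W` from `k` on, `C` and `D` are the sets of the `c_i` and `d_i` that choose `1`, and every
unset bit other than the first one chooses its delay action number `j`. -/
def counterAction (A W C D : Finset (Fin n)) (j : ℕ) : State n → Action n
  | .w k => target W k
  | .b i => if i ∈ A then .one else if i = 0 then .zero else .delay (min j (f i))
  | .c i => if i ∈ C then .one else .zero
  | .d i => if i ∈ D then .one else .zero
  | _ => .only

theorem counterAction_mem (A W C D : Finset (Fin n)) (j : ℕ) (s : State n) :
    counterAction A W C D j s ∈ avail s := by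
  cases s with
  | w k => exact target_mem_avail _ _
  | b i =>
    simp only [counterAction, avail]
    split_ifs <;> simp
  | c i => simp only [counterAction, avail]; split_ifs <;> simp
  | d i => simp only [counterAction, avail]; split_ifs <;> simp
  | _ => simp [counterAction, avail]

/-- The policy with action function `counterAction`. -/
def counterPolicy (P : Params n) (A W C D : Finset (Fin n)) (j : ℕ) : (mdp P).Policy :=
  ⟨counterAction A W C D j, counterAction_mem A W C D j⟩

section CounterPolicy

variable {A W C D : Finset (Fin n)} {j : ℕ}

theorem counterPolicy_w (k : Fin (n + 1)) :
    (counterPolicy P A W C D j).1 (.w k) = target W k := rfl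

theorem counterPolicy_b_mem {i : Fin n} (hi : i ∈ A) :
    (counterPolicy P A W C D j).1 (.b i) = .one := by
  simp [counterPolicy, counterAction, hi]

theorem counterPolicy_b_first (h : (0 : Fin n) ∉ A) :
    (counterPolicy P A W C D j).1 (.b 0) = .zero := by
  simp [counterPolicy, counterAction, h]

theorem counterPolicy_b_notMem {i : Fin n} (hi : i ∉ A) (h0 : i ≠ 0) (hj : j ≤ f i) :
    (counterPolicy P A W C D j).1 (.b i) = .delay j := by
  simp [counterPolicy, counterAction, hi, h0, hj]

theorem counterPolicy_c (i : Fin n) :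
    (counterPolicy P A W C D j).1 (.c i) = if i ∈ C then .one else .zero := rfl

theorem counterPolicy_d (i : Fin n) :
    (counterPolicy P A W C D j).1 (.d i) = if i ∈ D then .one else .zero := rfl

theorem setBits_counterPolicy : setBits (counterPolicy P A W C D j) = A := by
  ext i
  rw [mem_setBits]
  simp only [counterPolicy, counterAction]
  split_ifs <;> simp_all

theorem weakInvariant_counterPolicy (B : Finset (Fin n)) :
    WeakInvariant (counterPolicy P B B B B j) := by
  unfold WeakInvariant
  rw [setBits_counterPolicy]
  refine ⟨fun i hi => ?_, fun i hi => ?_, fun i l hl hi hmin => ?_, fun i hi => ?_⟩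
  · simp [counterPolicy_c, counterPolicy_d, hi]
  · simp [counterPolicy_c, counterPolicy_d, hi]
  · exact target_eq_toBit hl (by simpa using hi) fun m hm hle => hmin m hm (by simpa using hle)
  · exact target_eq_toSink fun m hm hle => hi m hm (by simpa using hle)

theorem hasValueAt_of_trans_eq_goto {π : (mdp P).Policy} {s t : State n}
    (h : trans P s (π.1 s) = goto t) (ht : (mdp P).HasValueAt π t) : (mdp P).HasValueAt π s := by
  refine MDP.hasValueAt_of_lottery one_pos le_rfl (fun x => ?_) ht
  change ∑ s', trans P s (π.1 s) s' * x s' = _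
  rw [h, sum_goto]
  ring

theorem hasValueAt_of_trans_eq_lottery {π : (mdp P).Policy} {s t : State n} {q : ℝ} (h0 : 0 < q)
    (h1 : q ≤ 1) (h : trans P s (π.1 s) = lottery q t s) (ht : (mdp P).HasValueAt π t) :
    (mdp P).HasValueAt π s := by
  refine MDP.hasValueAt_of_lottery h0 h1 (fun x => ?_) ht
  change ∑ s', trans P s (π.1 s) s' * x s' = _
  rw [h, sum_lottery]

/-- The inclusions exclude cycles other than self-loops: $w$ and $c$ states enter set bits only, and
these lead upwards to the next $d$. Descending induction on the levels settles $w_k$ and $d_k$; the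
unset bits lead back to $w_1$ or $b_1$, whose values are known by then. -/
theorem exists_hasTotalValue_counterPolicy (hW : W ⊆ A) (hC : C ⊆ A) :
    ∃ v, (mdp P).HasTotalValue (counterPolicy P A W C D j) v := by
  set π := counterPolicy P A W C D j with hπ
  have hsink : (mdp P).HasValueAt π .sink := ⟨0, by
    simp only [MDP.partialSum_of_absorbing (M := mdp P) (π := π) (s := .sink) rfl
      (fun x => sum_goto _ _)]
    exact tendsto_const_nhds⟩
  have hdTop : (mdp P).HasValueAt π .dTop := hasValueAt_of_trans_eq_goto (t := .sink) rfl hsink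
  have hcTop : (mdp P).HasValueAt π .cTop := hasValueAt_of_trans_eq_goto (t := .dTop) rfl hdTop
  have hplus : ∀ i : {i : Fin n // i ≠ 0}, (mdp P).HasValueAt π (dAt i.1.succ) →
      (mdp P).HasValueAt π (.bPlus i) := fun i h =>
    hasValueAt_of_trans_eq_goto (t := dAt i.1.succ) (by rw [← dNext_eq]; rfl) h
  have hset : ∀ i ∈ A, (mdp P).HasValueAt π (dAt i.succ) → (mdp P).HasValueAt π (.b i) := by
    intro i hi h
    have ha : π.1 (.b i) = .one := counterPolicy_b_mem hi
    by_cases h0 : i = 0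
    · subst h0
      refine hasValueAt_of_trans_eq_goto (t := dAt (Fin.succ 0)) ?_ h
      rw [ha, ← dNext_eq]
      simp [trans]
    · refine hasValueAt_of_trans_eq_lottery (P.α_pos i) (P.α_le_one i) (t := .bPlus ⟨i, h0⟩) ?_
        (hplus ⟨i, h0⟩ h)
      rw [ha]
      simp [trans, h0]
  have hentry : ∀ i : Fin n, (mdp P).HasValueAt π (.b i) → (mdp P).HasValueAt π (entry i) := by
    intro i h
    unfold entry
    split_ifs with h0
    · rwa [← h0]
    · exact hasValueAt_of_trans_eq_goto (t := .b i) rfl h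
  have hladder : ∀ k : Fin (n + 1),
      (mdp P).HasValueAt π (.w k) ∧ (mdp P).HasValueAt π (dAt k) := by
    intro k
    induction k using Fin.reverseInduction with
    | last =>
      refine ⟨hasValueAt_of_trans_eq_goto (t := .sink) ?_ hsink, by rwa [dAt_last]⟩
      rw [w_last_eq]
      rfl
    | cast i ih =>
      obtain ⟨hw, hd⟩ := ih
      have he : i ∈ A → (mdp P).HasValueAt π (entry i) := fun hi => hentry i (hset i hi hd)
      have hc : (mdp P).HasValueAt π (.c i) := by
        by_cases hi : i ∈ C
        · exact hasValueAt_of_trans_eq_goto (t := entry i)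
            (by rw [hπ, counterPolicy_c, if_pos hi]; rfl) (he (hC hi))
        · exact hasValueAt_of_trans_eq_goto (t := .w i.succ)
            (by rw [hπ, counterPolicy_c, if_neg hi]; rfl) hw
      constructor
      · by_cases hi : i ∈ W
        · refine hasValueAt_of_trans_eq_goto (t := entry i) ?_ (he (hW hi))
          rw [hπ, counterPolicy_w, target_mem hi]
          rfl
        -- There is no move from $w_i$ to $w_{i+1}$ here; the two states share their target, so
        -- their partial sums coincide.
        · obtain ⟨t, ht⟩ : ∃ t, ∀ k, trans P (.w k) (target W i.succ) = goto t := by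
            unfold target
            split
            · exact ⟨_, fun _ => rfl⟩
            · exact ⟨_, fun _ => rfl⟩
          obtain ⟨x, hx⟩ := hw
          have hsucc : ∀ T, (mdp P).partialSum π ((mdp P).reward π) T (.w i.castSucc) =
              (mdp P).partialSum π ((mdp P).reward π) T (.w i.succ) := by
            intro T
            have hp : (mdp P).p (.w i.castSucc) (π.1 (.w i.castSucc)) =
                (mdp P).p (.w i.succ) (π.1 (.w i.succ)) := by
              change trans P _ _ = trans P _ _
              rw [hπ, counterPolicy_w, counterPolicy_w, target_notMem hi, ht, ht]
            cases T with
            | zero => simp [MDP.partialSum]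
            | succ T =>
              rw [MDP.partialSum_succ, MDP.partialSum_succ, hp]
              rfl
          exact ⟨x, by simpa only [hsucc] using hx⟩
      · rw [dAt_castSucc]
        by_cases hi : i ∈ D
        · exact hasValueAt_of_trans_eq_goto (t := .c i)
            (by rw [hπ, counterPolicy_d, if_pos hi]; rfl) hc
        · exact hasValueAt_of_trans_eq_goto (t := .w i.succ)
            (by rw [hπ, counterPolicy_d, if_neg hi]; rfl) hw
  have hfirst : (mdp P).HasValueAt π (.b 0) := by
    by_cases h0 : (0 : Fin n) ∈ A
    · exact hset 0 h0 (hladder _).2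
    · refine hasValueAt_of_trans_eq_goto (t := .w (Fin.succ 0)) ?_ (hladder _).1
      rw [hπ, counterPolicy_b_first h0]
      rfl
  have hb : ∀ i, (mdp P).HasValueAt π (.b i) := by
    intro i
    by_cases hi : i ∈ A
    · exact hset i hi (hladder _).2
    by_cases h0 : i = 0
    · rwa [h0]
    have ha : π.1 (.b i) = .delay (min j (f i)) := by
      simp [hπ, counterPolicy, counterAction, hi, h0]
    generalize min j (f i) = m at ha
    rcases m with _ | m
    · refine hasValueAt_of_trans_eq_goto (t := .w 0) ?_ (hladder _).1
      rw [ha]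
      rfl
    · refine hasValueAt_of_trans_eq_lottery (P.p_pos i (m + 1)) (P.p_le_one i (m + 1)) (t := .b 0) ?_ hfirst
      rw [ha]
      rfl
  have hc : ∀ i, (mdp P).HasValueAt π (.c i) := by
    intro i
    by_cases hi : i ∈ C
    · exact hasValueAt_of_trans_eq_goto (t := entry i)
        (by rw [hπ, counterPolicy_c, if_pos hi]; rfl) (hentry i (hb i))
    · exact hasValueAt_of_trans_eq_goto (t := .w i.succ)
        (by rw [hπ, counterPolicy_c, if_neg hi]; rfl) (hladder _).1
  refine MDP.exists_hasTotalValue fun s => ?_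
  cases s with
  | sink => exact hsink
  | w k => exact (hladder k).1
  | b i => exact hb i
  | bMinus i => exact hasValueAt_of_trans_eq_goto (t := .b i.1) rfl (hb i)
  | bPlus i => exact hplus i (hladder _).2
  | c i => exact hc i
  | d i => simpa using (hladder i.castSucc).2
  | cTop => exact hcTop
  | dTop => exact hdTop

end CounterPolicy

/-! ### What the order on the actions of a bit says about the parameters -/

/-- The value of `d_{i+1}` if no bit is set. -/
def topCost (P : Params n) (i : Fin n) : ℝ :=
  if i.succ = Fin.last n then -P.εd (Fin.last n) else 0

/-- The plain bound $d\le w$ would lose the cost of $d_{n+1}$, which is present in `gain_one` and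
cannot be dropped when that inequality is applied. -/
theorem Ladder.dAt_le {v : State n → ℝ} {B : Finset (Fin n)}
    {lo : Fin (n + 1)} (hL : Ladder P B lo (fun k => v (.w k)) (fun k => v (dAt k)))
    {i : Fin n} (hi : lo ≤ i.succ) : v (dAt i.succ) ≤ v (.w i.succ) + topCost P i := by
  unfold topCost
  split_ifs with h
  · have h1 := hL.w_last
    have h2 := hL.d_last
    rw [← h] at h1 h2
    rw [h1, h2, h, zero_add]
  · simpa using hL.d_le_w hi

namespace Params.GadgetOrder

variable {i : Fin n}

theorem lt_of_weakInvariant (h : P.GadgetOrder) {π : (mdp P).Policy} {v : State n → ℝ}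
    (hπ : WeakInvariant π) (hv : (mdp P).HasTotalValue π v) (hi : i ≠ 0) {j : ℕ}
    (hj : π.1 (.b i) = .delay j) :
    v (.b i) < appealOf P v (.b i) (if j = f i then .one else .delay (j + 1)) ∧
    ∀ a ∈ avail (State.b i), a ≠ (if j = f i then .one else .delay (j + 1)) →
      appealOf P v (.b i) a < appealOf P v (.b i) (if j = f i then .one else .delay (j + 1)) := by
  obtain ⟨⟨a, ha, hlt⟩, h2⟩ := h π v (appealOf P v) hπ ⟨hv, fun _ _ => rfl⟩ i j hi hj
  refine ⟨?_, h2⟩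
  by_cases hne : a = (if j = f i then .one else .delay (j + 1))
  · rwa [← hne]
  · exact hlt.trans (h2 a ha hne)

/-- A probe: with no bit set, $w_1$ and $b_1$ are worth zero and appeals become expressions in the
parameters. The gadget condition speaks of the weak invariant only, but the inequalities extracted
from this policy also apply in the middle of an increment. -/
theorem exists_values_empty (i : Fin n) (hi : i ≠ 0) (j : ℕ) (hj : j ≤ f i) :
    ∃ v : State n → ℝ, (mdp P).HasTotalValue (counterPolicy P ∅ ∅ ∅ ∅ j) v ∧
      v (.w 0) = 0 ∧ v (.b 0) = 0 ∧ v (.b i) = (if j = 0 then 0 else P.δ i j) ∧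
      v (.bPlus ⟨i, hi⟩) = P.r i + topCost P i := by
  obtain ⟨v, hv⟩ := exists_hasTotalValue_counterPolicy (P := P) (A := ∅) (W := ∅) (C := ∅)
    (D := ∅) (j := j) subset_rfl subset_rfl
  have hE := evaluates_of_hasTotalValue hv
  have hw : ∀ k, v (.w k) = 0 := by
    intro k
    rw [hE.eq, counterPolicy_w, target_eq_toSink (by simp), appealOf_w_toSink, hE.sink]
  have hb0 : v (.b 0) = 0 := by
    rw [hE.b_zero (counterPolicy_b_first (by simp)), hw]
  have hbi : (counterPolicy P ∅ ∅ ∅ ∅ j).1 (.b i) = .delay j :=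
    counterPolicy_b_notMem (by simp) hi hj
  refine ⟨v, hv, hw 0, hb0, ?_, ?_⟩
  · split_ifs with h0
    · subst h0
      rw [hE.b_delay_zero hbi, hw]
    · rw [hE.b_delay (by omega) hbi, hb0, zero_add]
  · rw [hE.bPlus]
    congr 1
    unfold topCost
    split_ifs with h
    · rw [h, dAt_last, hE.dTop]
    · obtain ⟨k, hk⟩ := Fin.exists_castSucc_eq.2 h
      rw [← hk, dAt_castSucc, hE.eq, counterPolicy_d, if_neg (by simp), appealOf_d_zero, hw]

theorem δ_one_pos (h : P.GadgetOrder) (hi : i ≠ 0) : 0 < P.δ i 1 := by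
  obtain ⟨v, hv, hw, hb0, hbi, -⟩ := exists_values_empty (P := P) i hi 0 (Nat.zero_le _)
  have h1 := (h.lt_of_weakInvariant (weakInvariant_counterPolicy ∅) hv hi
    (counterPolicy_b_notMem (by simp) hi (Nat.zero_le _))).1
  rw [if_pos rfl] at hbi
  rw [if_neg (by simp [f]), zero_add, appealOf_b_delay P v i le_rfl, hbi, hb0] at h1
  have h2 : 0 < P.p i 1 * P.δ i 1 := by linarith
  exact pos_of_mul_pos_right h2 (P.p_pos i 1).le

theorem gain_pos (h : P.GadgetOrder) (hi : i ≠ 0) {j : ℕ} (hj : 1 ≤ j) (hjf : j + 1 ≤ f i) :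
    0 < P.p i (j + 1) * (P.δ i (j + 1) - P.δ i j) := by
  obtain ⟨v, hv, hw, hb0, hbi, -⟩ := exists_values_empty (P := P) i hi j (by omega)
  have h1 := (h.lt_of_weakInvariant (weakInvariant_counterPolicy ∅) hv hi
    (counterPolicy_b_notMem (by simp) hi (by omega))).1
  rw [if_neg (by omega)] at hbi
  rw [if_neg (by omega), appealOf_b_delay P v i (by omega), hbi, hb0] at h1
  simpa using h1

theorem gain_max (h : P.GadgetOrder) (hi : i ≠ 0) {j j' : ℕ} (hj : 1 ≤ j) (hjf : j + 1 ≤ f i)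
    (hj' : 1 ≤ j') (hjf' : j' ≤ f i) (hne : j' ≠ j + 1) :
    P.p i j' * (P.δ i j' - P.δ i j) < P.p i (j + 1) * (P.δ i (j + 1) - P.δ i j) := by
  obtain ⟨v, hv, hw, hb0, hbi, -⟩ := exists_values_empty (P := P) i hi j (by omega)
  have h1 := (h.lt_of_weakInvariant (weakInvariant_counterPolicy ∅) hv hi
    (counterPolicy_b_notMem (by simp) hi (by omega))).2 (.delay j')
    ((b_avail hi).2 (Or.inr ⟨j', hjf', rfl⟩))
  rw [if_neg (by omega)] at hbi
  rw [if_neg (by omega), appealOf_b_delay P v i (j := j + 1) (by omega),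
    appealOf_b_delay P v i hj',
    hbi, hb0] at h1
  have := h1 (by simpa using hne)
  simpa using this

/-- Of the comparisons for a delayed bit this is the one that involves the rest of the policy,
through $d_{i+1}$; the empty policy is its worst case by `Ladder.dAt_le`. -/
theorem gain_one (h : P.GadgetOrder) (hi : i ≠ 0) {j : ℕ} (hj : 1 ≤ j) (hjf : j + 1 ≤ f i) :
    P.α i * (P.r i + topCost P i - P.δ i j) <
      P.p i (j + 1) * (P.δ i (j + 1) - P.δ i j) := by
  obtain ⟨v, hv, hw, hb0, hbi, hbp⟩ := exists_values_empty (P := P) i hi j (by omega)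
  have h1 := (h.lt_of_weakInvariant (weakInvariant_counterPolicy ∅) hv hi
    (counterPolicy_b_notMem (by simp) hi (by omega))).2 .one
    ((b_avail hi).2 (Or.inl rfl))
  rw [if_neg (by omega)] at hbi
  rw [if_neg (by omega), appealOf_b_delay P v i (by omega), appealOf_b_one P v i hi,
    hbi, hb0, hbp] at h1
  have := h1 (by simp)
  linarith

theorem δ_lt_succ (h : P.GadgetOrder) (hi : i ≠ 0) {j : ℕ} (hj : 1 ≤ j) (hjf : j + 1 ≤ f i) :
    P.δ i j < P.δ i (j + 1) := by
  have := pos_of_mul_pos_right (h.gain_pos hi hj hjf) (P.p_pos i (j + 1)).le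
  linarith

theorem δ_pos (h : P.GadgetOrder) (hi : i ≠ 0) {j : ℕ} (hj : 1 ≤ j) (hjf : j ≤ f i) :
    0 < P.δ i j := by
  induction j, hj using Nat.le_induction with
  | base => exact h.δ_one_pos hi
  | succ j hj ih => exact (ih (by omega)).trans (h.δ_lt_succ hi hj hjf)

theorem δmax_nonneg (h : P.GadgetOrder) : 0 ≤ P.δmax := by
  by_cases hn : ∃ i : Fin n, i ≠ 0
  · obtain ⟨i, hi⟩ := hn
    exact (h.δ_one_pos hi).le.trans (P.δ_le hi le_rfl (by unfold f; omega))
  -- With a single bit the set is empty, and its supremum is zero by convention.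
  · push Not at hn
    refine Real.sSup_nonneg ?_
    rintro x ⟨i, hi, -⟩
    exact absurd (hn i) hi

end Params.GadgetOrder

theorem Params.Admissible.gaps (h : P.Admissible) : P.Gaps :=
  ⟨h.rewardGap, h.costGap, h.gadgetOrder.δmax_nonneg⟩

/-! ### The choices made by Greedy PI at the individual states -/

theorem eq_counterPolicy {π : (mdp P).Policy} {A W C D : Finset (Fin n)} {j : ℕ}
    (hw : ∀ k, π.1 (.w k) = target W k) (hA : ∀ i ∈ A, π.1 (.b i) = .one)
    (h0 : (0 : Fin n) ∉ A → π.1 (.b 0) = .zero)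
    (hb : ∀ i ∉ A, i ≠ 0 → j ≤ f i ∧ π.1 (.b i) = .delay j)
    (hc : ∀ i, π.1 (.c i) = if i ∈ C then .one else .zero)
    (hd : ∀ i, π.1 (.d i) = if i ∈ D then .one else .zero) :
    π = counterPolicy P A W C D j := by
  refine Subtype.ext (funext fun s => ?_)
  cases s with
  | w k => exact hw k
  | b i =>
    by_cases hi : i ∈ A
    · rw [hA i hi, counterPolicy_b_mem hi]
    by_cases h : i = 0
    · subst h
      rw [h0 hi, counterPolicy_b_first hi]
    · rw [(hb i hi h).2, counterPolicy_b_notMem hi h (hb i hi h).1]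
  | c i => exact hc i
  | d i => exact hd i
  | _ => rw [eq_only rfl]; rfl

/-- `π'` arises from the policy `π` with values `v` by one iteration of Greedy PI. -/
structure GreedyImproves (P : Params n) (v : State n → ℝ) (π π' : (mdp P).Policy) : Prop where
  evaluates : Evaluates P π.1 v
  keep : ∀ s, (∀ a ∈ avail s, appealOf P v s a ≤ v s) → π'.1 s = π.1 s
  choose : ∀ s, ∀ a ∈ avail s, (∀ b ∈ avail s, b ≠ a → appealOf P v s b < appealOf P v s a) →
    π'.1 s = a

theorem exists_greedyImproves {π π' : (mdp P).Policy}
    (h : (mdp P).GreedyStep (mdp P).totalReward π π') :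
    ∃ v, (mdp P).HasTotalValue π v ∧ GreedyImproves P v π π' := by
  obtain ⟨v, appeal, ⟨hv, hap⟩, hs⟩ := h
  obtain rfl : appeal = appealOf P v := funext fun s => funext fun a => hap s a
  have hE := evaluates_of_hasTotalValue hv
  refine ⟨v, hv, hE, fun s hk => (hs s).2 ?_, fun s a ha hmax => ?_⟩
  · rintro ⟨a, ha, hlt⟩
    exact (hk a ha).not_gt hlt
  · by_cases hsw : (mdp P).Switchable v (appealOf P v) s
    · by_contra hne
      exact ((hs s).1 hsw a ha).not_gt (hmax _ (π'.2 s) hne)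
    -- An unswitchable state keeps its action, whose appeal is the value; were it not `a`, the
    -- strictly better `a` would make the state switchable.
    · rw [(hs s).2 hsw]
      by_contra hne
      refine hsw ⟨a, ha, ?_⟩
      rw [hE.eq s]
      exact hmax _ (π.2 s) hne

namespace GreedyImproves

variable {v : State n → ℝ} {π π' : (mdp P).Policy}

theorem w_keep (h : GreedyImproves P v π π') {k : Fin (n + 1)} (h0 : 0 ≤ v (.w k))
    (hk : ∀ m : Fin n, k ≤ m.castSucc → v (entry m) ≤ v (.w k)) :
    π'.1 (.w k) = π.1 (.w k) := by
  refine h.keep _ fun a ha => ?_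
  simp only [avail, Finset.mem_insert, Finset.mem_image, Finset.mem_filter, Finset.mem_univ,
    true_and] at ha
  rcases ha with rfl | ⟨m, hm, rfl⟩
  · rwa [appealOf_w_toSink, h.evaluates.sink]
  · rw [appealOf_w_toBit]
    exact hk m hm

theorem w_switch (h : GreedyImproves P v π π') {k : Fin (n + 1)} {l : Fin n}
    (hl : k ≤ l.castSucc) (h0 : 0 < v (entry l))
    (hk : ∀ m : Fin n, k ≤ m.castSucc → m ≠ l → v (entry m) < v (entry l)) :
    π'.1 (.w k) = .toBit l := by
  refine h.choose _ _ (by simp [avail, hl]) fun a ha hne => ?_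
  simp only [avail, Finset.mem_insert, Finset.mem_image, Finset.mem_filter, Finset.mem_univ,
    true_and] at ha
  rcases ha with rfl | ⟨m, hm, rfl⟩
  · rwa [appealOf_w_toSink, appealOf_w_toBit, h.evaluates.sink]
  · rw [appealOf_w_toBit, appealOf_w_toBit]
    exact hk m hm fun hml => hne (by rw [hml])

theorem c_one (h : GreedyImproves P v π π') {i : Fin n}
    (hi : v (.w i.succ) + P.εc i.castSucc < v (entry i)) : π'.1 (.c i) = .one := by
  refine h.choose _ _ (by simp [avail]) fun a ha hne => ?_
  obtain rfl : a = .zero := by simpa [avail, hne] using ha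
  rw [appealOf_c_zero, appealOf_c_one]
  linarith

theorem c_zero (h : GreedyImproves P v π π') {i : Fin n}
    (hi : v (entry i) < v (.w i.succ) + P.εc i.castSucc) : π'.1 (.c i) = .zero := by
  refine h.choose _ _ (by simp [avail]) fun a ha hne => ?_
  obtain rfl : a = .one := by simpa [avail, hne] using ha
  rw [appealOf_c_zero, appealOf_c_one]
  linarith

theorem d_one (h : GreedyImproves P v π π') {i : Fin n}
    (hi : v (.w i.succ) + P.εd i.castSucc < v (.c i)) : π'.1 (.d i) = .one := by
  refine h.choose _ _ (by simp [avail]) fun a ha hne => ?_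
  obtain rfl : a = .zero := by simpa [avail, hne] using ha
  rw [appealOf_d_zero, appealOf_d_one]
  linarith

theorem d_zero (h : GreedyImproves P v π π') {i : Fin n}
    (hi : v (.c i) < v (.w i.succ) + P.εd i.castSucc) : π'.1 (.d i) = .zero := by
  refine h.choose _ _ (by simp [avail]) fun a ha hne => ?_
  obtain rfl : a = .one := by simpa [avail, hne] using ha
  rw [appealOf_d_zero, appealOf_d_one]
  linarith

/-- Allows for a tie, which occurs at the boundary of `Stuck`: an action of equal appeal does not
make the state switchable. -/
theorem d_keep_zero (h : GreedyImproves P v π π') {i : Fin n} (hπ : π.1 (.d i) = .zero)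
    (hi : v (.c i) ≤ v (.w i.succ) + P.εd i.castSucc) : π'.1 (.d i) = .zero := by
  rw [← hπ]
  refine h.keep _ fun a ha => ?_
  have hv := h.evaluates.eq (.d i)
  rw [hπ, appealOf_d_zero] at hv
  simp only [avail, Finset.mem_insert, Finset.mem_singleton] at ha
  rcases ha with rfl | rfl
  · rw [appealOf_d_zero, hv]
  · rw [appealOf_d_one, hv]
    linarith

theorem b_first_one (h : GreedyImproves P v π π')
    (hi : v (.w (Fin.succ 0)) < P.r 0 + v (dAt (Fin.succ 0))) : π'.1 (.b 0) = .one := by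
  refine h.choose _ _ (by simp [avail]) fun a ha hne => ?_
  obtain rfl : a = .zero := by simpa [avail, hne] using ha
  rwa [appealOf_b_zero, appealOf_first_one]

theorem b_first_zero (h : GreedyImproves P v π π')
    (hi : P.r 0 + v (dAt (Fin.succ 0)) < v (.w (Fin.succ 0))) : π'.1 (.b 0) = .zero := by
  refine h.choose _ _ (by simp [avail]) fun a ha hne => ?_
  obtain rfl : a = .one := by simpa [avail, hne] using ha
  rwa [appealOf_b_zero, appealOf_first_one]

/-- The appeal is a convex combination of staying, worth $v(b_i)$, and leaving, worth
$\delta^i_j+v(b_1)$. -/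
theorem appealOf_b_delay_le {i : Fin n} {j : ℕ} (hj : 1 ≤ j) {x : ℝ} (h1 : v (.b i) ≤ x)
    (h2 : P.δ i j + v (.b 0) ≤ x) : appealOf P v (.b i) (.delay j) ≤ x := by
  rw [appealOf_b_delay P v i hj]
  have h3 := mul_le_mul_of_nonneg_left h2 (P.p_pos i j).le
  have h4 := mul_le_mul_of_nonneg_left h1 (sub_nonneg.2 (P.p_le_one i j))
  linarith

theorem b_keep_one (h : GreedyImproves P v π π') {i : Fin n} (hi : i ≠ 0)
    (hπ : π.1 (.b i) = .one) (h1 : v (.w 0) ≤ v (.b i))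
    (h2 : v (.b 0) + P.δmax ≤ v (.b i)) : π'.1 (.b i) = .one := by
  rw [← hπ]
  refine h.keep _ fun a ha => ?_
  rcases (b_avail hi).1 ha with rfl | ⟨j, hj, rfl⟩
  · rw [← hπ, ← h.evaluates.eq]
  · rcases Nat.eq_zero_or_pos j with rfl | hj0
    · rwa [appealOf_b_delay_zero]
    · exact appealOf_b_delay_le hj0 le_rfl (by linarith [P.δ_le hi hj0 hj])

theorem b_reset (h : GreedyImproves P v π π') {i : Fin n} (hi : i ≠ 0)
    (h1 : v (.b i) < v (.w 0)) (h2 : v (.b 0) + P.δmax < v (.w 0))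
    (h3 : appealOf P v (.b i) .one < v (.w 0)) : π'.1 (.b i) = .delay 0 := by
  refine h.choose _ _ ((b_avail hi).2 (Or.inr ⟨0, Nat.zero_le _, rfl⟩)) fun a ha hne => ?_
  rw [appealOf_b_delay_zero]
  rcases (b_avail hi).1 ha with rfl | ⟨j, hj, rfl⟩
  · exact h3
  · have hj0 : 1 ≤ j := Nat.one_le_iff_ne_zero.2 fun h0 => hne (by rw [h0])
    refine (appealOf_b_delay_le hj0 (le_max_left _ (v (.b 0) + P.δmax)) ?_).trans_lt
      (max_lt h1 h2)
    refine le_trans ?_ (le_max_right _ _)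
    linarith [P.δ_le hi hj0 hj]

/-- The appeal of action `1` at an unset bit stays below that of the next delay action. -/
theorem appealOf_b_one_lt (hE : Evaluates P π.1 v) (hG : P.GadgetOrder) {i : Fin n} (hi : i ≠ 0)
    {j : ℕ} (hj : 1 ≤ j) (hjf : j + 1 ≤ f i) (hπ : π.1 (.b i) = .delay j)
    (hd : v (dAt i.succ) ≤ v (.b 0) + topCost P i) :
    appealOf P v (.b i) .one <
      v (.b i) + P.p i (j + 1) * (P.δ i (j + 1) - P.δ i j) := by
  have h1 := hG.gain_one hi hj hjf
  have h2 : P.α i * (P.r i + v (dAt i.succ) - v (.b i)) ≤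
      P.α i * (P.r i + topCost P i - P.δ i j) := by
    refine mul_le_mul_of_nonneg_left ?_ (P.α_pos i).le
    rw [hE.b_delay hj hπ]
    linarith
  rw [appealOf_b_one P v i hi, hE.bPlus]
  linarith

/-- As $v(b_i)-v(b_1)=\delta^i_j$, the gains of the delay actions are the same as at the empty
policy; the bounds on $w_1$ and $d_{i+1}$ dispose of the reset and of action $1$. -/
theorem b_next (h : GreedyImproves P v π π') (hG : P.GadgetOrder) {i : Fin n} (hi : i ≠ 0)
    {j : ℕ} (hj : 1 ≤ j) (hjf : j + 1 ≤ f i) (hπ : π.1 (.b i) = .delay j)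
    (hw : v (.w 0) ≤ v (.b 0)) (hd : v (dAt i.succ) ≤ v (.b 0) + topCost P i) :
    π'.1 (.b i) = .delay (j + 1) := by
  have hb := h.evaluates.b_delay hj hπ
  refine h.choose _ _ ((b_avail hi).2 (Or.inr ⟨_, hjf, rfl⟩)) fun a ha hne => ?_
  have heq : appealOf P v (.b i) (.delay (j + 1)) =
      v (.b i) + P.p i (j + 1) * (P.δ i (j + 1) - P.δ i j) := by
    rw [appealOf_b_delay P v i (by omega), hb]
    ring
  rw [heq]
  rcases (b_avail hi).1 ha with rfl | ⟨j', hj', rfl⟩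
  · exact appealOf_b_one_lt h.evaluates hG hi hj hjf hπ hd
  · rcases Nat.eq_zero_or_pos j' with rfl | hj0
    · rw [appealOf_b_delay_zero]
      linarith [hG.gain_pos hi hj hjf, hG.δ_pos hi hj (by omega)]
    · have h1 := hG.gain_max hi hj hjf hj0 hj' fun h' => hne (by rw [h'])
      rw [appealOf_b_delay P v i hj0]
      have : P.δ i j' + v (.b 0) - v (.b i) = P.δ i j' - P.δ i j := by rw [hb]; ring
      rw [this]
      linarith

end GreedyImproves

/-! ### Comparisons along the ladder -/

section Comparisons

variable {v : State n → ℝ} {π : (mdp P).Policy} {B : Finset (Fin n)} {lo : Fin (n + 1)}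

theorem Evaluates.entry_one (h : Evaluates P π.1 v) {i : Fin n} (hi : π.1 (.b i) = .one) :
    v (FullConstruction.entry i) = P.r i - P.c i + v (dAt i.succ) := by
  rw [h.entry, h.b_one hi]
  ring

theorem Evaluates.b_le (h : Evaluates P π.1 v) (hg : P.Gaps) {i : Fin n} (hi : i ≠ 0) {j : ℕ}
    (hjf : j ≤ f i) (hj : 1 ≤ j ∨ v (.w 0) = v (.b 0)) (hπ : π.1 (.b i) = .delay j) :
    v (.b i) ≤ v (.b 0) + P.δmax := by
  rcases Nat.eq_zero_or_pos j with rfl | hj0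
  · rw [h.b_delay_zero hπ]
    rcases hj with hj | hj
    · omega
    · linarith [hg.δmax_nonneg]
  · rw [h.b_delay hj0 hπ]
    linarith [P.δ_le hi hj0 hjf]

/-- An unset bit leads to $b_1$ with a bonus of at most $\delta_{\max}$, hence to at most the
rewards below it, and the entry cost exceeds both together. -/
theorem Evaluates.entry_lt (h : Evaluates P π.1 v) (hg : P.Gaps) {i : Fin n} (hi : i ≠ 0)
    (hb : v (.b i) ≤ v (.b 0) + P.δmax)
    (hb0 : v (.b 0) ≤ v (.w i.castSucc) + P.rewardBelow i.castSucc) :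
    v (FullConstruction.entry i) < v (.w i.castSucc) := by
  rw [h.entry]
  linarith [hg.lt_c hi]

end Comparisons

/-! ### The iterations from policies satisfying the weak invariant -/

/-- Set bits are worth exactly what $w_i$ expects and unset ones do not repay their entry cost, so
$w$, $c$ and $d$ stay. Only $b_1$, which always profits from action $1$, and the delayed bits can
move. -/
theorem steady_step (hP : P.Admissible) {B : Finset (Fin n)} {j : ℕ} {π' : (mdp P).Policy}
    (hs : P.Stuck → B = ∅) (hj : ∀ i ∉ B, i ≠ 0 → j ≤ f i)
    (h : (mdp P).GreedyStep (mdp P).totalReward (counterPolicy P B B B B j) π') :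
    (∀ k, π'.1 (.w k) = target B k) ∧ (∀ i, π'.1 (.c i) = if i ∈ B then .one else .zero) ∧
    (∀ i, π'.1 (.d i) = if i ∈ B then .one else .zero) ∧ π'.1 (.b 0) = .one ∧
    (∀ i ∈ B, π'.1 (.b i) = .one) ∧
    ∀ i ∉ B, i ≠ 0 → π'.1 (.b i) = if j = f i then .one else .delay (j + 1) := by
  obtain ⟨v, hv, hI⟩ := exists_greedyImproves h
  have hg := hP.gaps
  have hE := hI.evaluates
  have hW := weakInvariant_counterPolicy (P := P) (j := j) B
  have hL := hE.ladder_of_weakInvariant hW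
  rw [setBits_counterPolicy] at hL
  have hb0 := hE.b_first_of_weakInvariant hW
  have hset : ∀ i ∈ B, v (entry i) = v (.w i.castSucc) := fun i hi => by
    rw [hE.entry_one (counterPolicy_b_mem hi), hL.w_mem i hi (Fin.zero_le _)]
  have hw0 : ∀ k, v (.w 0) ≤ v (.w k) + P.rewardBelow k := fun k => by
    have h1 := hL.w_le hg le_rfl (Fin.zero_le k)
    linarith [hg.rewardBelow_nonneg 0]
  have hunset : ∀ i ∉ B, i ≠ 0 → v (entry i) < v (.w i.castSucc) := fun i hi h0 =>
    hE.entry_lt hg h0 (hE.b_le hg h0 (hj i hi h0) (Or.inr hb0.symm)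
      (counterPolicy_b_notMem hi h0 (hj i hi h0))) (hb0.trans_le (hw0 _))
  have hle : ∀ i, v (entry i) ≤ v (.w i.castSucc) := by
    intro i
    by_cases hi : i ∈ B
    · exact (hset i hi).le
    by_cases h0 : i = 0
    · subst h0
      rw [hE.entry, P.c_first, hb0]
      simp
    · exact (hunset i hi h0).le
  refine ⟨fun k => ?_, fun i => ?_, fun i => ?_, ?_, fun i hi => ?_, fun i hi h0 => ?_⟩
  · exact hI.w_keep (hL.w_nonneg hg (Fin.zero_le _)) fun m hm =>
      (hle m).trans (hL.w_antitone hg (Fin.zero_le _) hm)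
  · split_ifs with hi
    · refine hI.c_one ?_
      have := hL.w_succ_lt hg hi (Fin.zero_le _)
      rw [hset i hi]
      linarith [P.εc_le i.castSucc]
    · refine hI.c_zero ?_
      have := hL.w_notMem i hi (Fin.zero_le _)
      linarith [P.εc_pos i.castSucc, hle i]
  · split_ifs with hi
    · refine hI.d_one ?_
      have hns : ¬ P.Stuck := fun h' => by simp [hs h'] at hi
      have := hL.profit_d hg hns (i := i) (Fin.zero_le _)
      rw [hE.eq (.c i), counterPolicy_c, if_pos hi, appealOf_c_one,
        hE.entry_one (counterPolicy_b_mem hi)]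
      linarith
    · refine hI.d_zero ?_
      rw [hE.eq (.c i), counterPolicy_c, if_neg hi, appealOf_c_zero]
      linarith [P.εd_pos i.castSucc]
  · refine hI.b_first_one ?_
    have := hL.profit hg (i := 0) (Fin.zero_le _)
    rw [P.c_first] at this
    linarith [P.εmax_pos, hg.δmax_nonneg, hg.rewardBelow_nonneg (Fin.castSucc 0)]
  · by_cases h0 : i = 0
    · subst h0
      refine hI.b_first_one ?_
      have := hL.profit hg (i := 0) (Fin.zero_le _)
      rw [P.c_first] at this
      linarith [P.εmax_pos, hg.δmax_nonneg, hg.rewardBelow_nonneg (Fin.castSucc 0)]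
    · have h1 := hset i hi
      rw [hE.entry] at h1
      have h2 := hw0 i.castSucc
      have h3 := hg.lt_c h0
      have h4 := hg.δmax_nonneg
      exact hI.b_keep_one h0 (counterPolicy_b_mem hi) (by linarith) (by linarith)
  · have h1 := hP.gadgetOrder.lt_of_weakInvariant hW hv h0
      (counterPolicy_b_notMem hi h0 (hj i hi h0))
    refine hI.choose _ _ ?_ h1.2
    rw [b_avail h0]
    split_ifs with hjf
    · exact Or.inl rfl
    · exact Or.inr ⟨j + 1, by have := hj i hi h0; omega, rfl⟩

/-- The set bits after an increment that sets the bit `l`, all lower bits being set before. -/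
def increment (B : Finset (Fin n)) (l : Fin n) : Finset (Fin n) := insert l (B.filter (l < ·))

theorem target_increment_le {B : Finset (Fin n)} {l : Fin n} {k : Fin (n + 1)}
    (hk : k ≤ l.castSucc) : target (increment B l) k = .toBit l := by
  refine target_eq_toBit (by simp [increment]) hk fun m hm _ => ?_
  rcases Finset.mem_insert.1 hm with rfl | hm
  · exact le_rfl
  · exact (Finset.mem_filter.1 hm).2.le

theorem target_increment_gt {B : Finset (Fin n)} {l : Fin n} {k : Fin (n + 1)}
    (hk : l.succ ≤ k) : target (increment B l) k = target B k := by
  refine target_congr fun i => ?_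
  refine and_congr_left fun hi => ?_
  have hlt : l < i := by
    have := hk.trans hi
    simp only [Fin.le_def, Fin.lt_def, Fin.val_succ, Fin.val_castSucc] at this ⊢
    omega
  simp [increment, hlt, hlt.ne']

theorem succ_le_of_not_le {l : Fin n} {k : Fin (n + 1)} (hk : ¬ k ≤ l.castSucc) : l.succ ≤ k := by
  simp only [Fin.le_def, Fin.val_succ, Fin.val_castSucc] at hk ⊢
  omega

section Increment

variable {B : Finset (Fin n)} {l : Fin n} {j : ℕ} {π' : (mdp P).Policy}

theorem lt_of_notMem (hlow : ∀ i < l, i ∈ B) {i : Fin n} (hi : i ∉ B) (hil : i ≠ l) : l < i :=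
  lt_of_le_of_ne (not_lt.1 fun h => hi (hlow i h)) hil.symm

theorem ne_zero_of_gt {i : Fin n} (h : l < i) : i ≠ 0 :=
  ((Fin.zero_le l).trans_lt h).ne'

theorem not_stuck_of_ne {i i' : Fin n} (h : i ≠ i') : ¬ P.Stuck := by
  rintro ⟨rfl, -⟩
  exact h (Subsingleton.elim _ _)

/-- The ladder still ignores bit $\ell$, whose entry now beats everything reachable from the levels
up to $\ell$. So $w_k$ ($k\le\ell$) and $c_\ell$ turn to it; $d_\ell$ judges by the value of
$c_\ell$, which still chose $0$, and stays. -/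
theorem first_step (hP : P.Admissible) (hl : l ∉ B) (hlow : ∀ i < l, i ∈ B) (h1 : 1 ≤ j)
    (hj : ∀ i ∉ B, i ≠ l → j + 1 ≤ f i)
    (h : (mdp P).GreedyStep (mdp P).totalReward (counterPolicy P (insert l B) B B B j) π') :
    π' = counterPolicy P (insert l B) (increment B l) (insert l B) B (j + 1) := by
  obtain ⟨v, hv, hI⟩ := exists_greedyImproves h
  have hg := hP.gaps
  have hE := hI.evaluates
  have hL : Ladder P B 0 (fun k => v (.w k)) (fun k => v (dAt k)) :=
    hE.ladder (fun k _ => rfl) (fun i hi _ => ⟨counterPolicy_b_mem (by simp [hi]), by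
      rw [counterPolicy_c, if_pos hi]⟩) fun i _ => counterPolicy_d i
  have hbit : ∀ i ∈ B, (counterPolicy P (insert l B) B B B j).1 (.b i) = .one := fun i hi =>
    counterPolicy_b_mem (by simp [hi])
  have hlbit : (counterPolicy P (insert l B) B B B j).1 (.b l) = .one :=
    counterPolicy_b_mem (by simp)
  have hset : ∀ i ∈ B, v (entry i) = v (.w i.castSucc) := fun i hi => by
    rw [hE.entry_one (hbit i hi), hL.w_mem i hi (Fin.zero_le _)]
  have hlval : P.rewardBelow l.castSucc + P.δmax + P.εmax + v (.w l.succ) < v (entry l) := by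
    rw [hE.entry_one hlbit]
    exact hL.profit hg (Fin.zero_le _)
  have hlw : v (.w l.castSucc) = v (.w l.succ) := hL.w_notMem l hl (Fin.zero_le _)
  have hw0 : ∀ k, v (.w 0) ≤ v (.w k) + P.rewardBelow k := fun k => by
    have h1 := hL.w_le hg le_rfl (Fin.zero_le k)
    linarith [hg.rewardBelow_nonneg 0]
  have hb0 : v (.b 0) = P.r 0 + v (dAt (Fin.succ 0)) := by
    refine hE.b_one (counterPolicy_b_mem ?_)
    rcases eq_or_ne l 0 with rfl | h0
    · simp
    · simp [hlow 0 (Fin.pos_iff_ne_zero.2 h0)]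
  have hfirst : v (.w (Fin.succ 0)) < P.r 0 + v (dAt (Fin.succ 0)) := by
    have := hL.profit hg (i := 0) (Fin.zero_le _)
    rw [P.c_first] at this
    linarith [P.εmax_pos, hg.δmax_nonneg, hg.rewardBelow_nonneg (Fin.castSucc 0)]
  have hw0b0 : v (.w 0) ≤ v (.b 0) := by
    by_cases h0 : (0 : Fin n) ∈ B
    · have := hL.w_mem 0 h0 (Fin.zero_le _)
      rw [P.c_first, sub_zero, ← hb0] at this
      exact this.le
    · rw [hb0]
      exact (hL.w_notMem 0 h0 (Fin.zero_le _)).trans_le hfirst.le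
  -- If $\ell=1$, $b_1$ may already be worth more than $w_1$; its reward is therefore charged to the
  -- rewards below $i$.
  have hb0le : ∀ i : Fin n, i ≠ 0 →
      v (.b 0) ≤ v (.w i.castSucc) + P.rewardBelow i.castSucc := by
    intro i hi
    have hle : Fin.succ 0 ≤ i.castSucc := by
      have := Fin.pos_iff_ne_zero.2 hi
      simp only [Fin.le_def, Fin.lt_def, Fin.val_succ, Fin.val_castSucc] at this ⊢
      omega
    have h2 := hL.w_le hg (Fin.zero_le _) hle
    have h3 := hL.d_le_w (Fin.zero_le (Fin.succ 0))
    rw [P.rewardBelow_succ] at h2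
    linarith [hg.rewardBelow_nonneg (Fin.castSucc 0)]
  have hdelay : ∀ i ∉ B, i ≠ l → i ≠ 0 ∧
      (counterPolicy P (insert l B) B B B j).1 (.b i) = .delay j := fun i hi hil =>
    have h0 := ne_zero_of_gt (lt_of_notMem hlow hi hil)
    ⟨h0, counterPolicy_b_notMem (by simp [hi, hil]) h0 (by have := hj i hi hil; omega)⟩
  have hunset : ∀ i ∉ B, i ≠ l → v (entry i) < v (.w i.castSucc) := fun i hi hil =>
    have h0 := hdelay i hi hil
    hE.entry_lt hg h0.1 (hE.b_le hg h0.1 (by have := hj i hi hil; omega) (Or.inl h1) h0.2)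
      (hb0le i h0.1)
  have hle : ∀ i, i ≠ l → v (entry i) ≤ v (.w i.castSucc) := by
    intro i hil
    by_cases hi : i ∈ B
    · exact (hset i hi).le
    · exact (hunset i hi hil).le
  have hδ := hg.δmax_nonneg
  have hε := P.εmax_pos
  refine eq_counterPolicy (fun k => ?_) (fun i hi => ?_) (fun h0 => ?_) (fun i hi h0 => ?_)
    (fun i => ?_) fun i => ?_
  · by_cases hk : k ≤ l.castSucc
    · rw [target_increment_le hk]
      have hkl : v (.w k) < v (entry l) := by
        have h2 := hL.w_le hg (Fin.zero_le _) hk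
        linarith [hg.rewardBelow_nonneg k]
      refine hI.w_switch hk ?_ fun m hm hml => ?_
      · have h3 := hL.w_nonneg hg (Fin.zero_le k)
        linarith
      · have h3 := hL.w_antitone hg (Fin.zero_le _) hm
        exact ((hle m hml).trans h3).trans_lt hkl
    · rw [target_increment_gt (succ_le_of_not_le hk), ← counterPolicy_w (P := P)]
      refine hI.w_keep (hL.w_nonneg hg (Fin.zero_le _)) fun m hm => ?_
      have hml : m ≠ l := by rintro rfl; exact hk hm
      exact (hle m hml).trans (hL.w_antitone hg (Fin.zero_le _) hm)
  · rcases eq_or_ne i 0 with rfl | h0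
    · exact hI.b_first_one hfirst
    · have h2 : v (.w i.castSucc) + P.c i ≤ v (.b i) := by
        have h3 := hE.entry i
        rcases Finset.mem_insert.1 hi with rfl | hi
        · linarith [hg.rewardBelow_nonneg i.castSucc]
        · linarith [hset i hi]
      have h4 := hg.lt_c h0
      refine hI.b_keep_one h0 (counterPolicy_b_mem hi) ?_ ?_
      · linarith [hw0 i.castSucc]
      · linarith [hb0le i h0]
  · exfalso
    refine h0 (Finset.mem_insert.2 ?_)
    rcases eq_or_ne l 0 with rfl | h0
    · exact Or.inl rfl
    · exact Or.inr (hlow 0 (Fin.pos_iff_ne_zero.2 h0))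
  · obtain ⟨hil, hi⟩ : i ≠ l ∧ i ∉ B := by simpa using hi
    refine ⟨hj i hi hil, hI.b_next hP.gadgetOrder h0 h1 (hj i hi hil) (hdelay i hi hil).2 hw0b0 ?_⟩
    have h2 := hL.dAt_le (Fin.zero_le i.succ)
    have h3 := hL.w_antitone hg le_rfl (Fin.zero_le i.succ)
    linarith
  · split_ifs with hi
    · refine hI.c_one ?_
      have h2 := P.εc_le i.castSucc
      rcases Finset.mem_insert.1 hi with rfl | hi
      · linarith [hg.rewardBelow_nonneg i.castSucc]
      · have := hL.w_succ_lt hg hi (Fin.zero_le _)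
        rw [hset i hi]
        linarith
    · obtain ⟨hil, hi⟩ : i ≠ l ∧ i ∉ B := by simpa using hi
      refine hI.c_zero ?_
      have h2 : v (.w i.castSucc) = v (.w i.succ) := hL.w_notMem i hi (Fin.zero_le _)
      linarith [hunset i hi hil, P.εc_pos i.castSucc]
  · split_ifs with hi
    · refine hI.d_one ?_
      have hns : ¬ P.Stuck := not_stuck_of_ne (i := i) (i' := l) (by rintro rfl; exact hl hi)
      have := hL.profit_d hg hns (i := i) (Fin.zero_le _)
      rw [hE.eq (.c i), counterPolicy_c, if_pos hi, appealOf_c_one, hE.entry_one (hbit i hi)]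
      linarith
    · refine hI.d_zero ?_
      rw [hE.eq (.c i), counterPolicy_c, if_neg hi, appealOf_c_zero]
      linarith [P.εd_pos i.castSucc]

/-- The iteration that completes an increment, except for the state `d_l`. -/
theorem second_step_aux (hP : P.Admissible) (hl : l ∉ B) (hlow : ∀ i < l, i ∈ B) (h1 : 1 ≤ j)
    (hj : ∀ i ∉ B, i ≠ l → j + 1 ≤ f i)
    (h : (mdp P).GreedyStep (mdp P).totalReward
      (counterPolicy P (insert l B) (increment B l) (insert l B) B j) π') :
    (∀ k, π'.1 (.w k) = target (increment B l) k) ∧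
    (∀ i, π'.1 (.c i) = if i ∈ increment B l then .one else .zero) ∧
    (∀ i, i ≠ l → π'.1 (.d i) = if i ∈ increment B l then .one else .zero) ∧
    π'.1 (.d l) = (open Classical in if P.Stuck then .zero else .one) ∧
    (∀ i ∈ increment B l, π'.1 (.b i) = .one) ∧ (l ≠ 0 → π'.1 (.b 0) = .zero) ∧
    ∀ i ∉ increment B l, i ≠ 0 → π'.1 (.b i) = .delay (if l = 0 then j + 1 else 0) := by
  obtain ⟨v, hv, hI⟩ := exists_greedyImproves h
  set π := counterPolicy P (insert l B) (increment B l) (insert l B) B j with hπ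
  have hg := hP.gaps
  have hE := hI.evaluates
  have hδ := hg.δmax_nonneg
  have hε := P.εmax_pos
  have hbit : ∀ i ∈ B, π.1 (.b i) = .one := fun i hi => counterPolicy_b_mem (by simp [hi])
  have hlbit : π.1 (.b l) = .one := counterPolicy_b_mem (by simp)
  have hL : Ladder P B l.succ (fun k => v (.w k)) (fun k => v (dAt k)) :=
    hE.ladder (fun k hk => by rw [hπ, counterPolicy_w, target_increment_gt hk])
      (fun i hi _ => ⟨hbit i hi, by rw [hπ, counterPolicy_c, if_pos (by simp [hi])]⟩)
      fun i _ => counterPolicy_d i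
  have hge : ∀ {i : Fin n}, l < i → l.succ ≤ i.castSucc := fun {i} hi => by
    simp only [Fin.le_def, Fin.lt_def, Fin.val_succ, Fin.val_castSucc] at hi ⊢
    omega
  have hge' : ∀ {i : Fin n}, l < i → l.succ ≤ i.succ := fun {i} hi =>
    Fin.succ_le_succ_iff.2 hi.le
  have hlw : ∀ k : Fin (n + 1), k ≤ l.castSucc → v (.w k) = v (entry l) := fun k hk => by
    rw [hE.eq, hπ, counterPolicy_w, target_increment_le hk, appealOf_w_toBit]
  have hlval : P.rewardBelow l.castSucc + P.δmax + P.εmax + v (.w l.succ) < v (entry l) := by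
    rw [hE.entry_one hlbit]
    exact hL.profit hg le_rfl
  have hSl := hg.rewardBelow_nonneg l.castSucc
  -- As $d_\ell$ still bypasses bit $\ell$, the chain of $d$ states below it ends at $w_{\ell+1}$
  -- and picks up at most the rewards on its way.
  have hlow' : ∀ k : Fin (n + 1), k ≤ l.castSucc → v (.w l.succ) ≤ v (dAt k) ∧
      v (dAt k) + P.rewardBelow k ≤ v (.w l.succ) + P.rewardBelow l.castSucc := by
    intro k
    induction k using Fin.reverseInduction with
    | last => intro hk; exact absurd hk (not_le.2 l.castSucc_lt_last)
    | cast i ih =>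
      intro hk
      rcases (Fin.castSucc_le_castSucc_iff.1 hk).eq_or_lt with rfl | hlt
      · rw [dAt_castSucc, hE.eq (.d i), hπ, counterPolicy_d, if_neg hl, appealOf_d_zero]
        exact ⟨le_rfl, le_rfl⟩
      · have hi := hlow i hlt
        obtain ⟨h2, h3⟩ := ih (by
          simp only [Fin.le_def, Fin.lt_def, Fin.val_succ, Fin.val_castSucc] at hlt ⊢
          omega)
        have h4 : v (dAt i.castSucc) =
            -P.εd i.castSucc + (-P.εc i.castSucc + (P.r i - P.c i + v (dAt i.succ))) := by
          rw [dAt_castSucc, hE.eq (.d i), hπ, counterPolicy_d, if_pos hi, appealOf_d_one,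
            hE.eq (.c i), counterPolicy_c, if_pos (by simp [hi]), appealOf_c_one,
            hE.entry_one (hbit i hi)]
        rw [P.rewardBelow_succ] at h3
        have h5 := hg.lt_sub i
        have h6 := Params.εmax_le (P := P)
        constructor
        · linarith [P.εd_le i.castSucc, P.εc_le i.castSucc, hg.rewardBelow_nonneg i.castSucc]
        · linarith [P.εd_pos i.castSucc, P.εc_pos i.castSucc, hg.c_nonneg i]
  -- This strict deficit of the lower bits against $w_1$, larger than any $\delta$, is what forces
  -- the reset.
  have hblow : ∀ i < l, v (.w l.succ) ≤ v (.b i) ∧ v (.b i) + P.δmax < v (entry l) := by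
    intro i hi
    obtain ⟨h2, h3⟩ := hlow' i.succ (by
      simp only [Fin.le_def, Fin.lt_def, Fin.val_succ, Fin.val_castSucc] at hi ⊢
      omega)
    rw [P.rewardBelow_succ] at h3
    rw [hE.b_one (hbit i (hlow i hi))]
    have := hg.rewardBelow_nonneg i.castSucc
    exact ⟨by linarith [hg.r_pos i], by linarith⟩
  have hw0 : v (.w 0) = v (entry l) := hlw 0 (Fin.zero_le _)
  have hb0 : v (.b 0) ≤ v (entry l) ∧ v (.w l.succ) ≤ v (.b 0) := by
    rcases eq_or_ne l 0 with rfl | h0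
    · have h2 := hE.entry 0
      rw [P.c_first] at h2
      exact ⟨by linarith, by linarith⟩
    · have h2 := hblow 0 (Fin.pos_iff_ne_zero.2 h0)
      exact ⟨by linarith, h2.1⟩
  have hlle : ∀ i : Fin n, l < i →
      v (entry l) ≤ v (.w i.castSucc) + P.rewardBelow i.castSucc := by
    intro i hi
    have h2 := hL.w_le hg le_rfl (hge hi)
    have h3 := hL.d_le_w le_rfl
    rw [P.rewardBelow_succ] at h2
    rw [hE.entry_one hlbit]
    linarith [hg.c_nonneg l]
  have hset : ∀ i ∈ B, l < i → v (entry i) = v (.w i.castSucc) := fun i hi hil => by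
    rw [hE.entry_one (hbit i hi), hL.w_mem i hi (hge hil)]
  have hdelay : ∀ i ∉ B, l < i → i ≠ 0 ∧ π.1 (.b i) = .delay j := fun i hi hil =>
    have h0 := ne_zero_of_gt hil
    ⟨h0, counterPolicy_b_notMem (by simp [hi, hil.ne']) h0
      (by have := hj i hi hil.ne'; omega)⟩
  have hunset : ∀ i ∉ B, l < i → v (entry i) < v (.w i.castSucc) := fun i hi hil =>
    have h0 := hdelay i hi hil
    hE.entry_lt hg h0.1 (hE.b_le hg h0.1 (by have := hj i hi hil.ne'; omega) (Or.inl h1) h0.2)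
      (hb0.1.trans (hlle i hil))
  have hle : ∀ i, l < i → v (entry i) ≤ v (.w i.castSucc) := by
    intro i hil
    by_cases hi : i ∈ B
    · exact (hset i hi hil).le
    · exact (hunset i hi hil).le
  have hmem : ∀ i, i ∈ increment B l ↔ i = l ∨ i ∈ B ∧ l < i := fun i => by simp [increment]
  have hw1 := hL.w_nonneg hg le_rfl
  refine ⟨fun k => ?_, fun i => ?_, fun i hil => ?_, ?_, fun i hi => ?_, fun h0 => ?_,
    fun i hi h0 => ?_⟩
  · rw [← counterPolicy_w (P := P) (A := insert l B) (C := insert l B) (D := B) (j := j), ← hπ]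
    by_cases hk : k ≤ l.castSucc
    · refine hI.w_keep ?_ fun m hm => ?_
      · rw [hlw k hk]
        linarith
      · rw [hlw k hk]
        rcases lt_trichotomy m l with hml | rfl | hml
        · rw [hE.entry]
          linarith [(hblow m hml).2, hg.c_nonneg m]
        · exact le_rfl
        · have h2 := hL.w_antitone hg le_rfl (hge hml)
          linarith [hle m hml]
    · have hlk := succ_le_of_not_le hk
      refine hI.w_keep (hL.w_nonneg hg hlk) fun m hm => ?_
      have hml : l < m := by
        by_contra hc
        exact hk (hm.trans (Fin.castSucc_le_castSucc_iff.2 (not_lt.1 hc)))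
      exact (hle m hml).trans (hL.w_antitone hg hlk hm)
  · rcases lt_trichotomy i l with hil | rfl | hil
    · rw [if_neg (by rw [hmem]; rintro (rfl | ⟨-, h'⟩); exacts [lt_irrefl _ hil, lt_asymm hil h'])]
      refine hI.c_zero ?_
      rw [hE.entry, hlw i.succ (by
        simp only [Fin.le_def, Fin.lt_def, Fin.val_succ, Fin.val_castSucc] at hil ⊢
        omega)]
      linarith [(hblow i hil).2, hg.c_nonneg i, P.εc_pos i.castSucc]
    · rw [if_pos ((hmem i).2 (Or.inl rfl))]
      refine hI.c_one ?_
      linarith [P.εc_le i.castSucc]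
    · by_cases hi : i ∈ B
      · rw [if_pos ((hmem i).2 (Or.inr ⟨hi, hil⟩))]
        refine hI.c_one ?_
        have := hL.w_succ_lt hg hi (hge hil)
        rw [hset i hi hil]
        linarith [P.εc_le i.castSucc]
      · rw [if_neg (by rw [hmem]; rintro (rfl | ⟨h', -⟩); exacts [lt_irrefl _ hil, hi h'])]
        refine hI.c_zero ?_
        have h2 : v (.w i.castSucc) = v (.w i.succ) := hL.w_notMem i hi (hge hil)
        linarith [hunset i hi hil, P.εc_pos i.castSucc]
  · rcases lt_or_gt_of_ne hil with hil | hil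
    · rw [if_neg (by rw [hmem]; rintro (rfl | ⟨-, h'⟩); exacts [lt_irrefl _ hil, lt_asymm hil h'])]
      refine hI.d_zero ?_
      rw [hE.eq (.c i), hπ, counterPolicy_c, if_pos (by simp [hlow i hil]), appealOf_c_one,
        hE.entry, hlw i.succ (by
        simp only [Fin.le_def, Fin.lt_def, Fin.val_succ, Fin.val_castSucc] at hil ⊢
        omega)]
      linarith [(hblow i hil).2, hg.c_nonneg i, P.εc_pos i.castSucc, P.εd_pos i.castSucc]
    · by_cases hi : i ∈ B
      · rw [if_pos ((hmem i).2 (Or.inr ⟨hi, hil⟩))]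
        refine hI.d_one ?_
        have := hL.profit_d hg (not_stuck_of_ne hil.ne) (hge' hil)
        rw [hE.eq (.c i), hπ, counterPolicy_c, if_pos (by simp [hi]), appealOf_c_one,
          hE.entry_one (hbit i hi)]
        linarith
      · rw [if_neg (by rw [hmem]; rintro (rfl | ⟨h', -⟩); exacts [lt_irrefl _ hil, hi h'])]
        refine hI.d_zero ?_
        rw [hE.eq (.c i), hπ, counterPolicy_c, if_neg (by simp [hi, hil.ne']), appealOf_c_zero]
        linarith [P.εd_pos i.castSucc]
  · have hc : v (.c l) = -P.εc l.castSucc + (P.r l - P.c l + v (dAt l.succ)) := by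
      rw [hE.eq (.c l), hπ, counterPolicy_c, if_pos (by simp), appealOf_c_one,
        hE.entry_one hlbit]
    split_ifs with hs
    · refine hI.d_keep_zero (by rw [hπ, counterPolicy_d, if_neg hl]) ?_
      obtain ⟨hn, hr⟩ := hs
      obtain rfl : l = 0 := by ext; simp; omega
      have h2 := hL.w_last
      have h3 := hL.d_last
      rw [← Ladder.eq_last_of_eq_one hn 0] at h2 h3
      rw [← Ladder.eq_last_of_eq_one hn 0] at hr
      rw [hc, P.c_first]
      linarith
    · refine hI.d_one ?_
      have := hL.profit_d hg hs (i := l) le_rfl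
      linarith
  · rcases eq_or_ne i 0 with rfl | h0
    · obtain rfl : (0 : Fin n) = l :=
        ((hmem 0).1 hi).resolve_right fun h' => Fin.not_lt_zero _ h'.2
      refine hI.b_first_one ?_
      rw [hE.entry_one hlbit, P.c_first] at hlval
      linarith
    · have h4 := hg.lt_c h0
      have h3 := hE.entry i
      rcases (hmem i).1 hi with rfl | ⟨hi, hil⟩
      · refine hI.b_keep_one h0 hlbit ?_ ?_
        · linarith [hg.c_nonneg i]
        · linarith [hg.c_nonneg i]
      · rw [hset i hi hil] at h3
        have h5 := hlle i hil
        exact hI.b_keep_one h0 (hbit i hi) (by linarith) (by linarith)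
  · have hpos := Fin.pos_iff_ne_zero.2 h0
    have h2 := hblow 0 hpos
    refine hI.b_first_zero ?_
    rw [← hE.b_one (hbit 0 (hlow 0 hpos)), hlw (Fin.succ 0) (by
        simp only [Fin.le_def, Fin.lt_def, Fin.val_succ, Fin.val_castSucc] at hpos ⊢
        omega)]
    linarith
  · rcases lt_trichotomy i l with hil | rfl | hil
    · have hl0 : l ≠ 0 := ne_zero_of_gt hil
      rw [if_neg hl0]
      have h2 := hblow i hil
      have h3 := hblow 0 (Fin.pos_iff_ne_zero.2 hl0)
      refine hI.b_reset h0 (by linarith) (by linarith) ?_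
      rw [← hbit i (hlow i hil), ← hE.eq]
      linarith
    · exact absurd ((hmem i).2 (Or.inl rfl)) hi
    · have hiB : i ∉ B := fun h' => hi ((hmem i).2 (Or.inr ⟨h', hil⟩))
      have hjf := hj i hiB hil.ne'
      have hdel := (hdelay i hiB hil).2
      have hd : v (dAt i.succ) ≤ v (.b 0) + topCost P i := by
        have h2 := hL.dAt_le (hge' hil)
        have h3 := hL.w_antitone hg le_rfl (hge' hil)
        linarith
      split_ifs with hl0
      · subst hl0
        refine hI.b_next hP.gadgetOrder h0 h1 hjf hdel ?_ hd
        rw [hw0, hE.entry, P.c_first]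
        linarith
      · have h2 := hblow 0 (Fin.pos_iff_ne_zero.2 hl0)
        have h3 := hE.b_delay h1 hdel
        have h4 := P.δ_le h0 h1 (by omega : j ≤ f i)
        refine hI.b_reset h0 (by linarith) (by linarith) ?_
        -- Action $1$ is beaten by the next delay, which cannot exceed $v(b_1)+\delta_{\max}$ and so
        -- stays below $w_1$: the higher unset bits start their delays anew.
        refine (GreedyImproves.appealOf_b_one_lt hE hP.gadgetOrder h0 h1 hjf hdel hd).trans_le ?_
        have h5 := hP.gadgetOrder.δ_lt_succ h0 h1 hjf
        have h6 := P.δ_le h0 (by omega : 1 ≤ j + 1) hjf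
        have h7 := mul_le_of_le_one_left (sub_nonneg.2 h5.le) (P.p_le_one i (j + 1))
        linarith

end Increment

/-! ### The sequence of policies as a sequence of configurations -/

/-- The situations that occur in a run: `steady B j` satisfies the weak invariant with the set
bits `B`, all other bits (but the first) choosing their delay action `j`; `first B l j` and
`second B l j` are the two policies that follow when the bit `l` has just been set. -/
inductive Config (n : ℕ) : Type
  | steady (B : Finset (Fin n)) (j : ℕ)
  | first (B : Finset (Fin n)) (l : Fin n) (j : ℕ)
  | second (B : Finset (Fin n)) (l : Fin n) (j : ℕ)

namespace Config

/-- The policy in a given situation. -/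
def policy (P : Params n) : Config n → (mdp P).Policy
  | steady B j => counterPolicy P B B B B j
  | first B l j => counterPolicy P (insert l B) B B B j
  | second B l j => counterPolicy P (insert l B) (increment B l) (insert l B) B j

open Classical in
/-- The next situation. -/
def step (P : Params n) : Config n → Config n
  | steady B j =>
    if h : Bᶜ.Nonempty then
      if Bᶜ.min' h = 0 ∨ j = f (Bᶜ.min' h) then first B (Bᶜ.min' h) (j + 1)
      else steady B (j + 1)
    else steady B j
  | first B l j => second B l (j + 1)
  | second B l j =>
    if P.Stuck then second B l j else steady (increment B l) (if l = 0 then j + 1 else 0)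

/-- `l` is the least bit that is not in `B`. -/
def IsLeastUnset (B : Finset (Fin n)) (l : Fin n) : Prop := l ∉ B ∧ ∀ i < l, i ∈ B

theorem isLeastUnset_min' {B : Finset (Fin n)} (h : Bᶜ.Nonempty) :
    IsLeastUnset B (Bᶜ.min' h) := by
  refine ⟨by simpa using Finset.min'_mem _ h, fun i hi => ?_⟩
  by_contra hc
  exact (Finset.min'_le _ i (by simpa using hc)).not_gt hi

theorem IsLeastUnset.eq_min' {B : Finset (Fin n)} {l : Fin n} (hl : IsLeastUnset B l)
    (h : Bᶜ.Nonempty) : Bᶜ.min' h = l := by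
  refine le_antisymm (Finset.min'_le _ _ (by simpa using hl.1)) (not_lt.1 fun hlt => ?_)
  exact (isLeastUnset_min' h).1 (hl.2 _ hlt)

/-- The conditions that the situations occurring in a run satisfy. -/
def Valid (P : Params n) : Config n → Prop
  | steady B j => (P.Stuck → B = ∅) ∧ ((0 : Fin n) ∉ B → j = 0) ∧ ∀ i ∉ B, j ≤ f i
  | first B l j => IsLeastUnset B l ∧ 1 ≤ j ∧ ∀ i ∉ B, i ≠ l → j + 2 ≤ f i
  | second B l j => IsLeastUnset B l ∧ 1 ≤ j ∧ ∀ i ∉ B, i ≠ l → j + 1 ≤ f i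

theorem f_add_le {i l : Fin n} (h : l < i) : f l + 6 ≤ f i := by
  unfold f
  have : l.val < i.val := h
  omega

theorem nine_le_f (i : Fin n) : 9 ≤ f i := by
  unfold f
  omega

/-- Consecutive delay lengths differ by six, which leaves room for the iterations of an increment
before another bit could run out. If bit $1$ is unset, the delays have just been reset, so the
immediate setting of $b_1$ starts from $j=0$. -/
theorem Valid.step {C : Config n} (h : C.Valid P) : (C.step P).Valid P := by
  cases C with
  | steady B j =>
    obtain ⟨hs, h0, hj⟩ := h
    simp only [Config.step]
    split_ifs with hne hl
    · have hm := isLeastUnset_min' hne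
      refine ⟨hm, by omega, fun i hi hil => ?_⟩
      have h9 := nine_le_f i
      rcases hl with hl | hl
      · rw [hl] at hm
        rw [h0 hm.1]
        omega
      · have := f_add_le (lt_of_notMem hm.2 hi hil)
        omega
    · push Not at hl
      have hm := isLeastUnset_min' hne
      refine ⟨hs, fun h' => absurd ?_ h', fun i hi => ?_⟩
      · exact hm.2 _ (Fin.pos_iff_ne_zero.2 hl.1)
      · have h1 := hj _ hm.1
        rcases eq_or_ne i (Bᶜ.min' hne) with rfl | hil
        · omega
        · have := f_add_le (lt_of_notMem hm.2 hi hil)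
          omega
    · exact ⟨hs, h0, hj⟩
  | first B l j =>
    obtain ⟨hl, h1, hj⟩ := h
    exact ⟨hl, by omega, fun i hi hil => by have := hj i hi hil; omega⟩
  | second B l j =>
    simp only [Config.step]
    split_ifs with hs h0
    · exact h
    · obtain ⟨hl, h1, hj⟩ := h
      subst h0
      refine ⟨fun h => absurd h hs, fun h => absurd ?_ h, fun i hi => ?_⟩
      · simp [increment]
      · simp only [increment, Finset.mem_insert, Finset.mem_filter, not_or, not_and] at hi
        exact hj i (fun h => hi.2 h (Fin.pos_iff_ne_zero.2 hi.1)) hi.1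
    · exact ⟨fun h => absurd h hs, fun _ => rfl, fun i _ => Nat.zero_le _⟩

theorem increment_subset (B : Finset (Fin n)) (l : Fin n) : increment B l ⊆ insert l B :=
  Finset.insert_subset_insert _ (Finset.filter_subset _ _)

theorem exists_hasTotalValue (P : Params n) (C : Config n) :
    ∃ v, (mdp P).HasTotalValue (C.policy P) v := by
  cases C with
  | steady B j => exact exists_hasTotalValue_counterPolicy subset_rfl subset_rfl
  | first B l j =>
    exact exists_hasTotalValue_counterPolicy (Finset.subset_insert _ _) (Finset.subset_insert _ _)
  | second B l j => exact exists_hasTotalValue_counterPolicy (increment_subset _ _) subset_rfl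

/-- The choice at every state is forced, so the breaking of ties plays no role. -/
theorem policy_step_of_greedyStep (hP : P.Admissible) {C : Config n} (hC : C.Valid P)
    {π' : (mdp P).Policy} (h : (mdp P).GreedyStep (mdp P).totalReward (C.policy P) π') :
    π' = (C.step P).policy P := by
  cases C with
  | steady B j =>
    obtain ⟨hs, h0, hj⟩ := hC
    obtain ⟨hw, hc, hd, hb0, hbB, hb⟩ := steady_step hP hs (fun i hi _ => hj i hi) h
    simp only [step]
    split_ifs with hne hl
    · have hm := isLeastUnset_min' hne
      refine eq_counterPolicy hw (fun i hi => ?_) (fun h => ?_) (fun i hi hi0 => ?_) hc hd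
      · rcases Finset.mem_insert.1 hi with rfl | hi
        · by_cases hm0 : Bᶜ.min' hne = 0
          · rwa [hm0]
          · rw [hb _ hm.1 hm0, if_pos (hl.resolve_left hm0)]
        · exact hbB i hi
      · exfalso
        rw [Finset.mem_insert, not_or] at h
        exact h.2 (hm.2 _ (Fin.pos_iff_ne_zero.2 (Ne.symm h.1)))
      · rw [Finset.mem_insert, not_or] at hi
        have h1 : j + 1 ≤ f i := by
          rcases hl with hl | hl
          · rw [hl] at hm
            rw [h0 hm.1]
            have := nine_le_f i
            omega
          · have := f_add_le (lt_of_notMem hm.2 hi.2 hi.1)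
            omega
        exact ⟨h1, by rw [hb i hi.2 hi0, if_neg (by omega)]⟩
    · push Not at hl
      have hm := isLeastUnset_min' hne
      refine eq_counterPolicy hw hbB (fun h => ?_) (fun i hi hi0 => ?_) hc hd
      · exact absurd (hm.2 _ (Fin.pos_iff_ne_zero.2 hl.1)) h
      · have h1 : j + 1 ≤ f i := by
          have h1 := hj _ hm.1
          rcases eq_or_ne i (Bᶜ.min' hne) with rfl | hil
          · omega
          · have := f_add_le (lt_of_notMem hm.2 hi hil)
            omega
        exact ⟨h1, by rw [hb i hi hi0, if_neg (by omega)]⟩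
    · have hmem : ∀ i, i ∈ B := by
        intro i
        by_contra hi
        exact hne ⟨i, by simpa using hi⟩
      exact eq_counterPolicy hw hbB (fun h => absurd (hmem _) h)
        (fun i hi _ => absurd (hmem i) hi) hc hd
  | first B l j =>
    obtain ⟨hl, h1, hj⟩ := hC
    exact first_step hP hl.1 hl.2 h1 (fun i hi hil => by have := hj i hi hil; omega) h
  | second B l j =>
    obtain ⟨hl, h1, hj⟩ := hC
    obtain ⟨hw, hc, hd, hdl, hb, hb0, hbu⟩ := second_step_aux hP hl.1 hl.2 h1 hj h
    simp only [step]
    split_ifs with hs h0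
    -- There is only one bit here, so everything but $d_1$ has adapted and $d_1$ does not move.
    · rw [if_pos hs] at hdl
      have hil : ∀ i, i = l := fun i => by
        by_contra h
        exact not_stuck_of_ne h hs
      have hmem : ∀ i, i ∈ increment B l := fun i => by simp [increment, hil i]
      have hmem' : ∀ i, i ∈ insert l B := fun i => by simp [hil i]
      refine eq_counterPolicy hw (fun i _ => hb i (hmem i)) (fun h => absurd (hmem' _) h)
        (fun i hi _ => absurd (hmem' i) hi) (fun i => ?_) fun i => ?_
      · rw [hc, if_pos (hmem i), if_pos (hmem' i)]
      · rw [hil i, hdl, if_neg hl.1]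
    all_goals
      rw [if_neg hs] at hdl
      refine eq_counterPolicy hw hb (fun h => hb0 ?_) (fun i hi hi0 => ⟨?_, ?_⟩) hc fun i => ?_
    · rintro rfl
      exact h (by simp [increment])
    · subst h0
      simp only [increment, Finset.mem_insert, Finset.mem_filter, not_or, not_and] at hi
      exact hj i (fun h => hi.2 h (Fin.pos_iff_ne_zero.2 hi.1)) hi.1
    · simpa only [if_pos h0] using hbu i hi hi0
    · rcases eq_or_ne i l with rfl | hil
      · rw [hdl, if_pos (by simp [increment])]
      · exact hd i hil
    · exact h0
    · exact Nat.zero_le _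
    · simpa only [if_neg h0] using hbu i hi hi0
    · rcases eq_or_ne i l with rfl | hil
      · rw [hdl, if_pos (by simp [increment])]
      · exact hd i hil

/-- For the converse, some Greedy step exists since the values do, and uniqueness identifies its
result. -/
theorem greedyStep_total_iff (hP : P.Admissible) {C : Config n} (hC : C.Valid P)
    {π' : (mdp P).Policy} :
    (mdp P).GreedyStep (mdp P).totalReward (C.policy P) π' ↔ π' = (C.step P).policy P := by
  refine ⟨policy_step_of_greedyStep hP hC, ?_⟩
  rintro rfl
  obtain ⟨v, hv⟩ := exists_hasTotalValue P C
  obtain ⟨π'', h⟩ := MDP.exists_greedyStep (M := mdp P) (crit := (mdp P).totalReward)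
    (appeal := appealOf P v) ⟨hv, fun _ _ => rfl⟩
  rwa [← policy_step_of_greedyStep hP hC h]

theorem greedyStep_average_iff (hP : P.Admissible) {C : Config n} (hC : C.Valid P)
    {π' : (mdp P).Policy} :
    (mdp P).GreedyStep (mdp P).averageReward (C.policy P) π' ↔ π' = (C.step P).policy P := by
  obtain ⟨v, hv⟩ := exists_hasTotalValue P C
  rw [hv.greedyStep_average_iff, greedyStep_total_iff hP hC]

/-- The situations in which policy iteration stops. -/
def Final (P : Params n) : Config n → Prop
  | steady B _ => ∀ i, i ∈ B
  | first _ _ _ => False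
  | second _ _ _ => P.Stuck

theorem Final.step_eq {C : Config n} (h : C.Final P) : C.step P = C := by
  cases C with
  | steady B j =>
    have : ¬ Bᶜ.Nonempty := by
      rintro ⟨i, hi⟩
      exact absurd (h i) (by simpa using hi)
    simp [step, this]
  | first B l j => exact h.elim
  | second B l j => simp only [step]; exact if_pos h

theorem Final.mem_setBits {C : Config n} (h : C.Final P) (i : Fin n) :
    i ∈ setBits (C.policy P) := by
  cases C with
  | steady B j => rw [policy, setBits_counterPolicy]; exact h i
  | first B l j => exact h.elim
  | second B l j =>
    rw [policy, setBits_counterPolicy]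
    have : i = l := by
      by_contra hil
      exact not_stuck_of_ne hil h
    simp [this]

/-- In the three phases the least unset bit, $c_\ell$ and $d_\ell$ respectively are seen to move. A
policy with no switchable state would be its own successor. -/
theorem Valid.policy_step_ne {C : Config n} (hC : C.Valid P) (h : ¬ C.Final P) :
    (C.step P).policy P ≠ C.policy P := by
  intro heq
  have key : ∀ s, ((C.step P).policy P).1 s = (C.policy P).1 s := fun s => by rw [heq]
  cases C with
  | steady B j =>
    obtain ⟨-, h0, hj⟩ := hC
    have hne : Bᶜ.Nonempty := by
      by_contra hne
      refine h fun i => ?_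
      by_contra hi
      exact hne ⟨i, by simpa using hi⟩
    have hm := isLeastUnset_min' hne
    have := key (.b (Bᶜ.min' hne))
    simp only [Config.step, hne, dif_pos] at this
    split_ifs at this with hl
    · simp only [policy] at this
      rw [counterPolicy_b_mem (by simp)] at this
      have h1 := FullConstruction.mem_setBits.2 this.symm
      rw [setBits_counterPolicy] at h1
      exact hm.1 h1
    · push Not at hl
      have h1 := hj _ hm.1
      simp only [policy] at this
      rw [counterPolicy_b_notMem hm.1 hl.1 h1,
        counterPolicy_b_notMem hm.1 hl.1 (by omega)] at this
      simp at this
  | first B l j =>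
    have := key (.c l)
    simp [policy, Config.step, counterPolicy_c, hC.1.1] at this
  | second B l j =>
    have := key (.d l)
    have hs : ¬ P.Stuck := h
    simp [policy, Config.step, counterPolicy_d, hC.1.1, hs, increment] at this

end Config

/-! ### Optimality of the last policy -/

/-- A potential that makes up for the negative values of `c_{n+1}` and `d_{n+1}`. -/
def topPotential (P : Params n) : State n → ℝ
  | .sink => 0
  | .cTop => 2 * (P.εc (Fin.last n) + P.εd (Fin.last n))
  | _ => P.εc (Fin.last n) + P.εd (Fin.last n)

theorem topPotential_nonneg (P : Params n) (s : State n) : 0 ≤ topPotential P s := by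
  have h1 := P.εc_pos (Fin.last n)
  have h2 := P.εd_pos (Fin.last n)
  unfold topPotential
  split <;> linarith

theorem topPotential_le (P : Params n) {s : State n} (hs : s ≠ .cTop) :
    topPotential P s ≤ P.εc (Fin.last n) + P.εd (Fin.last n) := by
  have h1 := P.εc_pos (Fin.last n)
  have h2 := P.εd_pos (Fin.last n)
  cases s <;> simp_all only [topPotential, ne_eq, not_true_eq_false] <;> first | rfl | linarith

theorem entry_ne_cTop (i : Fin n) : entry i ≠ .cTop := by
  unfold entry
  split <;> simp

theorem dNext_ne_cTop (i : Fin n) : dNext i ≠ .cTop := by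
  unfold dNext
  split <;> simp

/-- No transition enters $c_{n+1}$, the only state with a larger potential. -/
theorem sum_trans_topPotential_le (P : Params n) (s : State n) (a : Action n) :
    ∑ s', trans P s a s' * topPotential P s' ≤ P.εc (Fin.last n) + P.εd (Fin.last n) := by
  have h0 : trans P s a .cTop = 0 := by
    unfold trans
    split <;> try split
    all_goals simp [goto, lottery, (entry_ne_cTop _).symm, (dNext_ne_cTop _).symm]
  have h1 := isDistr_trans P s a
  calc ∑ s', trans P s a s' * topPotential P s'
      ≤ ∑ s', trans P s a s' * (P.εc (Fin.last n) + P.εd (Fin.last n)) := by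
        refine Finset.sum_le_sum fun s' _ => ?_
        by_cases hs' : s' = .cTop
        · rw [hs', h0, zero_mul, zero_mul]
        · exact mul_le_mul_of_nonneg_left (topPotential_le P hs') (h1.1 s')
    _ = _ := by rw [← Finset.sum_mul, h1.2, one_mul]

section Optimality

variable {π : (mdp P).Policy} {v : State n → ℝ}

/-- Without switchable states, $w$ is worth at least the sink, and $b$, $c$, $d$ at least some $w$;
$b^\pm$ are nonnegative as all bits are set. Only $c_{n+1}$ and $d_{n+1}$ have negative values, and
the potential falls there by enough. -/
theorem topPotential_superharmonic (hg : P.Gaps) (hE : Evaluates P π.1 v)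
    (hs : ∀ s, ¬ (mdp P).Switchable v (appealOf P v) s) (hb : ∀ i, π.1 (.b i) = .one)
    (s : State n) (a : Action n) (ha : a ∈ avail s) :
    ∑ s', trans P s a s' * topPotential P s' ≤ topPotential P s + min (v s) 0 := by
  have hle : ∀ s, ∀ a ∈ avail s, appealOf P v s a ≤ v s := fun s a ha =>
    not_lt.1 fun hlt => hs s ⟨a, ha, hlt⟩
  have hw : ∀ k, 0 ≤ v (.w k) := fun k => by
    have := hle (.w k) .toSink (by simp [avail])
    rwa [appealOf_w_toSink, hE.sink] at this
  have hd : ∀ i, 0 ≤ v (.d i) := fun i => by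
    have := hle (.d i) .zero (by simp [avail])
    rw [appealOf_d_zero] at this
    exact (hw _).trans this
  have hc : ∀ i, 0 ≤ v (.c i) := fun i => by
    have := hle (.c i) .zero (by simp [avail])
    rw [appealOf_c_zero] at this
    exact (hw _).trans this
  have hbn : ∀ i, 0 ≤ v (.b i) := fun i => by
    by_cases h0 : i = 0
    · subst h0
      have := hle (.b 0) .zero (by simp [avail])
      rw [appealOf_b_zero] at this
      exact (hw _).trans this
    · have := hle (.b i) (.delay 0) ((b_avail h0).2 (Or.inr ⟨0, Nat.zero_le _, rfl⟩))
      rw [appealOf_b_delay_zero] at this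
      exact (hw _).trans this
  have hdAt : ∀ k, -P.εmax ≤ v (dAt k) := fun k => by
    cases k using Fin.lastCases with
    | last =>
      rw [dAt_last, hE.dTop]
      linarith [P.εd_le (Fin.last n)]
    | cast i =>
      rw [dAt_castSucc]
      linarith [hd i, P.εmax_pos]
  have hsum := sum_trans_topPotential_le P s a
  have h1 := P.εc_pos (Fin.last n)
  have h2 := P.εd_pos (Fin.last n)
  cases s with
  | sink =>
    have h3 : ∑ s', trans P .sink a s' * topPotential P s' = 0 := by
      simp [trans, sum_goto, topPotential]
    rw [h3, hE.sink]
    simp [topPotential]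
  | dTop =>
    obtain rfl : a = .only := by simpa [avail] using ha
    have h3 : ∑ s', trans P .dTop .only s' * topPotential P s' = 0 := by
      simp [trans, sum_goto, topPotential]
    rw [h3, hE.dTop, min_eq_left (by linarith)]
    simp only [topPotential]
    linarith
  | cTop =>
    rw [hE.cTop, min_eq_left (by linarith)]
    simp only [topPotential] at hsum ⊢
    linarith
  | w k => rw [min_eq_right (hw k)]; simpa [topPotential] using hsum
  | b i => rw [min_eq_right (hbn i)]; simpa [topPotential] using hsum
  | c i => rw [min_eq_right (hc i)]; simpa [topPotential] using hsum
  | d i => rw [min_eq_right (hd i)]; simpa [topPotential] using hsum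
  | bPlus i =>
    have h3 : 0 ≤ v (.bPlus i) := by
      rw [hE.bPlus, ← hE.b_one (hb i)]
      exact hbn i
    rw [min_eq_right h3]; simpa [topPotential] using hsum
  | bMinus i =>
    have h3 : 0 ≤ v (.bMinus i) := by
      rw [hE.eq, eq_only rfl, appealOf_bMinus, hE.b_one (hb i)]
      linarith [hg.lt_sub i.1, hdAt i.1.succ, hg.rewardBelow_nonneg i.1.castSucc,
        hg.δmax_nonneg, Params.εmax_le (P := P), P.εmax_pos]
    rw [min_eq_right h3]; simpa [topPotential] using hsum

end Optimality

namespace Config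

/-- A fixed point of `step` is its own Greedy successor, whereas a switchable state would have to
acquire an appeal above its value. -/
theorem Final.exists_not_switchable (hP : P.Admissible) {C : Config n} (hC : C.Valid P)
    (h : C.Final P) : ∃ v, (mdp P).HasTotalValue (C.policy P) v ∧
      ∀ s, ¬ (mdp P).Switchable v (appealOf P v) s := by
  have h1 := (greedyStep_total_iff hP hC (π' := C.policy P)).2 (by rw [h.step_eq])
  obtain ⟨v, appeal, ⟨hv, hap⟩, hs⟩ := h1
  obtain rfl : appeal = appealOf P v := funext fun s => funext fun a => hap s a
  refine ⟨v, hv, fun s hsw => ?_⟩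
  have h2 := (hs s).1 hsw
  obtain ⟨a, ha, hlt⟩ := hsw
  rw [(evaluates_of_hasTotalValue hv).eq s] at hlt
  exact (h2 a ha).not_gt hlt

theorem Final.isTerminalOptimal_total (hP : P.Admissible) {C : Config n} (hC : C.Valid P)
    (h : C.Final P) : (mdp P).IsTerminalOptimal (mdp P).totalReward (C.policy P) := by
  obtain ⟨v, hv, hs⟩ := h.exists_not_switchable hP hC
  exact MDP.isTerminalOptimal_totalReward (topPotential_superharmonic hP.gaps
    (evaluates_of_hasTotalValue hv) hs fun i => FullConstruction.mem_setBits.1 (h.mem_setBits i))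
    (topPotential_nonneg P) hv hs

theorem Final.isTerminalOptimal_average (hP : P.Admissible) {C : Config n} (hC : C.Valid P)
    (h : C.Final P) : (mdp P).IsTerminalOptimal (mdp P).averageReward (C.policy P) := by
  obtain ⟨v, hv, hs⟩ := h.exists_not_switchable hP hC
  exact MDP.isTerminalOptimal_averageReward (topPotential_superharmonic hP.gaps
    (evaluates_of_hasTotalValue hv) hs fun i => FullConstruction.mem_setBits.1 (h.mem_setBits i))
    (topPotential_nonneg P) hv hs

end Config

/-! ### Counting -/

/-- The carry: adding one sets the lowest zero bit, clears the ones below it and leaves the rest.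
Halving lowers the position of that bit. -/
theorem testBit_succ_iff (l : ℕ) : ∀ k : ℕ, (∀ i < l, k.testBit i = true) →
    k.testBit l = false → ∀ i, (k + 1).testBit i = true ↔ i = l ∨ k.testBit i = true ∧ l < i := by
  induction l with
  | zero =>
    intro k _ hk i
    have hk' : k % 2 = 0 := by simpa [Nat.testBit_zero] using hk
    cases i with
    | zero => simp [Nat.testBit_zero]; omega
    | succ i =>
      have : (k + 1) / 2 = k / 2 := by omega
      simp [Nat.testBit_succ, this]
  | succ l ih =>
    intro k hlow hk i
    have h0 : k % 2 = 1 := by simpa [Nat.testBit_zero] using hlow 0 (Nat.succ_pos _)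
    have h1 : (k + 1) / 2 = k / 2 + 1 := by omega
    cases i with
    | zero => simp [Nat.testBit_zero]; omega
    | succ i =>
      rw [Nat.testBit_succ] at hk
      rw [Nat.testBit_succ, Nat.testBit_succ, h1, ih (k / 2) (fun i hi => ?_) hk i]
      · simp
      · rw [← Nat.testBit_succ]
        exact hlow _ (by omega)

namespace Config

/-- The bits of `k`. -/
def bits (n k : ℕ) : Finset (Fin n) := Finset.univ.filter fun i => k.testBit i.val = true

theorem mem_bits {k : ℕ} {i : Fin n} : i ∈ bits n k ↔ k.testBit i.val = true := by
  simp [bits]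

theorem zero_mem_bits {k : ℕ} : (0 : Fin n) ∈ bits n k ↔ k % 2 = 1 := by
  simp [mem_bits, Nat.testBit_zero]

theorem bits_succ {k : ℕ} {l : Fin n} (hl : IsLeastUnset (bits n k) l) :
    bits n (k + 1) = increment (bits n k) l := by
  ext i
  have hlow : ∀ m < l.val, k.testBit m = true := fun m hm => by
    have := hl.2 ⟨m, hm.trans l.2⟩ hm
    rwa [mem_bits] at this
  rw [mem_bits, testBit_succ_iff l.val k hlow (by simpa [mem_bits] using hl.1)]
  simp [increment, mem_bits, Fin.ext_iff]

/-- Otherwise all $n$ bits are ones, that is $k=2^n-1$. -/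
theorem exists_isLeastUnset {k : ℕ} (hk : k + 1 < 2 ^ n) : ∃ l, IsLeastUnset (bits n k) l := by
  by_contra hc
  have hne : ¬ (bits n k)ᶜ.Nonempty := fun h => hc ⟨_, isLeastUnset_min' h⟩
  have hall : ∀ i < n, k.testBit i = true := by
    intro i hi
    by_contra hi'
    exact hne ⟨⟨i, hi⟩, by simpa [mem_bits] using hi'⟩
  have : k = 2 ^ n - 1 := by
    refine Nat.eq_of_testBit_eq fun i => ?_
    rw [Nat.testBit_two_pow_sub_one]
    by_cases hi : i < n
    · simp [hall i hi, hi]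
    · simp only [hi, decide_false]
      refine Nat.testBit_lt_two_pow (lt_of_lt_of_le (by omega : k < 2 ^ n) ?_)
      exact Nat.pow_le_pow_right (by norm_num) (not_lt.1 hi)
  omega

theorem Valid.iterate {C : Config n} (h : C.Valid P) (t : ℕ) :
    ((Config.step P)^[t] C).Valid P := by
  induction t with
  | zero => exact h
  | succ t ih => rw [Function.iterate_succ_apply']; exact ih.step

theorem step_steady {B : Finset (Fin n)} {l : Fin n} (hl : IsLeastUnset B l) (j : ℕ) :
    step P (steady B j) = if l = 0 ∨ j = f l then first B l (j + 1) else steady B (j + 1) := by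
  have hne : Bᶜ.Nonempty := ⟨l, by simpa using hl.1⟩
  simp only [step, hne, dif_pos, hl.eq_min' hne]

theorem iterate_step_wait {B : Finset (Fin n)} {l : Fin n} (hl : IsLeastUnset B l) (h0 : l ≠ 0)
    {j t : ℕ} (hj : j + t ≤ f l) : (step P)^[t] (steady B j) = steady B (j + t) := by
  induction t with
  | zero => rfl
  | succ t ih =>
    rw [Function.iterate_succ_apply', ih (by omega), step_steady hl, if_neg]
    · rfl
    · rintro (h | h)
      · exact h0 h
      · omega

theorem exists_iterate_step {B : Finset (Fin n)} {l : Fin n} (hl : IsLeastUnset B l) {j : ℕ}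
    (hj : j ≤ f l) : ∃ t, (step P)^[t + 2] (steady B j) =
      second B l (if l = 0 then j + 2 else f l + 2) := by
  obtain ⟨t, ht⟩ : ∃ t, (step P)^[t + 1] (steady B j) =
      first B l (if l = 0 then j + 1 else f l + 1) := by
    by_cases h0 : l = 0
    · refine ⟨0, ?_⟩
      rw [zero_add, Function.iterate_one, step_steady hl, if_pos (Or.inl h0), if_pos h0]
    · refine ⟨f l - j, ?_⟩
      rw [Function.iterate_succ_apply', iterate_step_wait hl h0 (by omega), step_steady hl,
        if_pos (Or.inr (by omega)), if_neg h0]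
      congr 2
      omega
  refine ⟨t, ?_⟩
  rw [Function.iterate_succ_apply', ht]
  simp only [step]
  split_ifs <;> rfl

/-- The situation in which the counter has just reached `k`, all states having adapted. -/
def count (n k : ℕ) : Config n := steady (bits n k) (if k % 2 = 0 then 0 else 3)

/-- For even $k$, $b_1$ is set and the delays advance three times, whence the $3$ in `count`; for
odd $k$ they are reset to $0$. The second claim concerns the configuration just before the target is
reached and makes the stopping time exact. -/
theorem exists_iterate_count (hs : ¬ P.Stuck) {k : ℕ} (hk : k + 1 < 2 ^ n) :
    ∃ t, (step P)^[t + 3] (count n k) = count n (k + 1) ∧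
      ¬ ((step P)^[t + 2] (count n k)).Final P := by
  obtain ⟨l, hl⟩ := exists_isLeastUnset hk
  have hj : (if k % 2 = 0 then 0 else 3) ≤ f l := by
    have := nine_le_f l
    split_ifs <;> omega
  have h0 : l = 0 ↔ k % 2 = 0 := by
    constructor
    · rintro rfl
      have := hl.1
      rw [zero_mem_bits] at this
      omega
    · intro h
      by_contra hl0
      have := hl.2 0 (Fin.pos_iff_ne_zero.2 hl0)
      rw [zero_mem_bits] at this
      omega
  obtain ⟨t, ht⟩ := exists_iterate_step (P := P) hl hj
  refine ⟨t, ?_, ?_⟩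
  · rw [Function.iterate_succ_apply', count, ht]
    simp only [step, if_neg hs, count, bits_succ hl]
    congr 1
    by_cases h : k % 2 = 0
    · rw [if_pos (h0.2 h), if_pos (h0.2 h), if_pos h, if_neg (by omega)]
    · rw [if_neg (mt h0.1 h), if_pos (by omega)]
  · rw [count, ht]
    exact hs

theorem count_zero_valid : (count n 0).Valid P :=
  ⟨fun _ => by ext i; simp [mem_bits], fun _ => rfl, fun _ _ => Nat.zero_le _⟩

theorem count_zero_policy : (count n 0).policy P = zeroPolicy P := by
  have hB : ∀ i : Fin n, i ∉ bits n 0 := fun i => by simp [mem_bits]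
  refine (eq_counterPolicy (fun k => ?_) (fun i hi => absurd hi (hB i)) (fun _ => ?_)
    (fun i _ h0 => ⟨Nat.zero_le _, ?_⟩) (fun i => ?_) fun i => ?_).symm
  · rw [target_eq_toSink fun m hm => absurd hm (hB m)]
    rfl
  · simp [zeroPolicy, zeroAction]
  · simp [zeroPolicy, zeroAction, h0]
  · rw [if_neg (hB i)]
    rfl
  · rw [if_neg (hB i)]
    rfl

theorem setBits_count (k : ℕ) (i : Fin n) :
    i ∈ setBits ((count n k).policy P) ↔ k.testBit i.val = true := by
  rw [count, policy, setBits_counterPolicy, mem_bits]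

theorem count_last_final : (count n (2 ^ n - 1)).Final P := fun i => by
  rw [mem_bits, Nat.testBit_two_pow_sub_one]
  simp

/-- The times at which the counter reaches the successive numbers. -/
theorem exists_times (P : Params n) : ∃ (T : ℕ) (τ : ℕ → ℕ), 2 ^ n ≤ T ∧
    ((step P)^[T] (count n 0)).Final P ∧
    (∀ t < T, ¬ ((step P)^[t] (count n 0)).Final P) ∧
    StrictMonoOn τ (Set.Iio (2 ^ n)) ∧ τ 0 = 0 ∧ τ (2 ^ n - 1) = T ∧
    ∀ k < 2 ^ n, ∀ i : Fin n,
      i ∈ setBits (((step P)^[τ k] (count n 0)).policy P) ↔ k.testBit i.val = true := by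
  by_cases hs : P.Stuck
  · have hn : n = 1 := hs.1
    have hl : IsLeastUnset (bits n 0) (0 : Fin n) :=
      ⟨by simp [mem_bits], fun i hi => absurd hi (Fin.not_lt_zero i)⟩
    have h1 : (step P)^[1] (count n 0) = first (bits n 0) 0 1 := by
      rw [Function.iterate_one, count, step_steady hl, if_pos (Or.inl rfl)]
      rfl
    have h2 : (step P)^[2] (count n 0) = second (bits n 0) 0 2 := by
      rw [Function.iterate_succ_apply', h1]
      rfl
    have hpow : 2 ^ n = 2 := by rw [hn]; rfl
    -- For one stuck bit the run stops after two iterations, which is exactly $2^n$; no third one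
    -- switches $d_1$.
    refine ⟨2, fun k => 2 * k, hpow.le, ?_, fun t ht => ?_, ?_, rfl, by rw [hpow], ?_⟩
    · rw [h2]
      exact hs
    · interval_cases t
      · intro h
        have := h 0
        simp [mem_bits] at this
      · rw [h1]
        exact id
    · intro a _ b _ hab
      dsimp only
      omega
    · intro k hk i
      rw [hpow] at hk
      interval_cases k
      · exact setBits_count 0 i
      · have hi : i = 0 := by ext; simp; omega
        dsimp only
        rw [mul_one, h2, hi]
        simp [policy, setBits_counterPolicy]
  · have hg : ∀ k, ∃ t, k + 1 < 2 ^ n → (step P)^[t + 3] (count n k) = count n (k + 1) ∧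
        ¬ ((step P)^[t + 2] (count n k)).Final P := by
      intro k
      by_cases hk : k + 1 < 2 ^ n
      · obtain ⟨t, ht⟩ := exists_iterate_count hs hk
        exact ⟨t, fun _ => ht⟩
      · exact ⟨0, fun h => absurd h hk⟩
    choose g hg using hg
    set τ : ℕ → ℕ := fun k => ∑ i ∈ Finset.range k, (g i + 3) with hτ
    have hτs : ∀ k, τ (k + 1) = τ k + (g k + 3) := fun k => Finset.sum_range_succ _ _
    have hmono : StrictMono τ := strictMono_nat_of_lt_succ fun k => by rw [hτs]; omega
    have hle : ∀ k, 3 * k ≤ τ k := by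
      intro k
      induction k with
      | zero => exact Nat.zero_le _
      | succ k ih => rw [hτs]; omega
    have hcount : ∀ k < 2 ^ n, (step P)^[τ k] (count n 0) = count n k := by
      intro k
      induction k with
      | zero => intro _; rfl
      | succ k ih =>
        intro hk
        rw [hτs, add_comm, Function.iterate_add_apply, ih (by omega), (hg k hk).1]
    have hpow : 2 ≤ 2 ^ n := by
      calc 2 = 2 ^ 1 := rfl
        _ ≤ 2 ^ n := Nat.pow_le_pow_right (by norm_num) (Nat.one_le_iff_ne_zero.2 (NeZero.ne n))
    have hstay : ∀ t, ((step P)^[t] (count n 0)).Final P →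
        ∀ u, ((step P)^[u + t] (count n 0)).Final P := by
      intro t ht u
      rw [Function.iterate_add_apply, Function.iterate_fixed ht.step_eq]
      exact ht
    refine ⟨τ (2 ^ n - 1), τ, ?_, ?_, fun t ht hF => ?_, fun a _ b _ hab => hmono hab, rfl, rfl, ?_⟩
    -- Each increment takes at least three iterations, and $3(2^n-1)\ge2^n$.
    · have := hle (2 ^ n - 1)
      omega
    · rw [hcount _ (by omega)]
      exact count_last_final
    -- Final configurations persist, so one before $T$ would make the configuration at $T-1$ final,
    -- contrary to the last increment.
    · obtain ⟨m, hm⟩ : ∃ m, 2 ^ n = m + 2 := ⟨2 ^ n - 2, by omega⟩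
      have h1 : 2 ^ n - 1 = m + 1 := by omega
      rw [h1, hτs] at ht
      refine (hg m (by omega)).2 ?_
      rw [← hcount m (by omega), ← Function.iterate_add_apply]
      obtain ⟨u, hu⟩ : ∃ u, g m + 2 + τ m = u + t := ⟨g m + 2 + τ m - t, by omega⟩
      rw [hu]
      exact hstay t hF u
    · intro k hk i
      rw [hcount k hk]
      exact setBits_count k i

/-- Counting, for a criterion under which Greedy PI moves through the situations above. -/
theorem countsInBinary {L : Type} [LinearOrder L] {crit : (mdp P).Criterion L}
    (hd : MDP.AppealDetermined crit)
    (hstep : ∀ C : Config n, C.Valid P → ∀ π',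
      (mdp P).GreedyStep crit (C.policy P) π' ↔ π' = (C.step P).policy P)
    (hopt : ∀ C : Config n, C.Valid P → C.Final P →
      (mdp P).IsTerminalOptimal crit (C.policy P)) :
    CountsInBinary P crit := by
  have hval : ∀ t, ((step P)^[t] (count n 0)).Valid P :=
    Valid.iterate count_zero_valid
  refine ⟨⟨fun t => ((step P)^[t] (count n 0)).policy P, count_zero_policy, fun t => ?_⟩,
    fun ρ hρ => ?_⟩
  · dsimp only
    rw [Function.iterate_succ_apply']
    exact (hstep _ (hval t) _).2 rfl
  · have hρ' : ∀ t, ρ t = ((step P)^[t] (count n 0)).policy P := by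
      intro t
      induction t with
      | zero => rw [hρ.1]; exact count_zero_policy.symm
      | succ t ih =>
        have := hρ.2 t
        rw [ih, hstep _ (hval t), ← Function.iterate_succ_apply' (step P)] at this
        exact this
    obtain ⟨T, τ, hT, hF, hnF, hτ, hτ0, hτT, hbits⟩ := exists_times P
    have hto := hopt _ (hval T) hF
    obtain ⟨val, ap, hc, hsw, hdom⟩ := id hto
    have hnt : ∀ t < T, ¬ (mdp P).IsTerminal crit (((step P)^[t] (count n 0)).policy P) := by
      rintro t ht ⟨val, ap, hc, hsw⟩
      have := (hstep _ (hval t) _).1 (MDP.GreedyStep.of_not_switchable hc hsw)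
      exact (hval t).policy_step_ne (hnF t ht) this.symm
    refine ⟨T, hT, ?_, ?_, fun t ht => ⟨fun ho => ?_, ?_⟩, τ, hτ, hτ0, hτT, fun k hk i => ?_⟩
    · rw [hρ']
      exact ⟨val, ap, hc, hdom⟩
    · rw [hρ']
      exact ⟨val, ap, hc, hsw⟩
    · rw [hρ'] at ho
      exact hnt t ht (hto.isTerminal_of_isOptimal hd ho)
    · rw [hρ']
      exact hnt t ht
    · rw [hρ']
      exact hbits k hk i

end Config

theorem countsInBinary_totalReward (hP : P.Admissible) :
    CountsInBinary P (mdp P).totalReward :=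
  Config.countsInBinary MDP.appealDetermined_totalReward
    (fun _ hC _ => Config.greedyStep_total_iff hP hC)
    fun _ hC hF => hF.isTerminalOptimal_total hP hC

theorem countsInBinary_averageReward (hP : P.Admissible) :
    CountsInBinary P (mdp P).averageReward :=
  Config.countsInBinary MDP.appealDetermined_averageReward
    (fun _ hC _ => Config.greedyStep_average_iff hP hC)
    fun _ hC hF => hF.isTerminalOptimal_average hP hC

/-! ### Bounds on the values under the weak invariant -/

namespace Ladder

variable {B : Finset (Fin n)} {w d : Fin (n + 1) → ℝ}

/-- Going through a set bit replaces $w_{i+1}$ by $d_{i+1}$, which loses between $0$ and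
$2\epsilon_{\max}$ per level. -/
theorem w_bounds (h : Ladder P B 0 w d) (k : Fin (n + 1)) :
    w k ≤ ∑ i ∈ B with k ≤ i.castSucc, (P.r i - P.c i) ∧
    ∑ i ∈ B with k ≤ i.castSucc, (P.r i - P.c i) - 2 * ((n : ℝ) - k.val) * P.εmax ≤ w k := by
  induction k using Fin.reverseInduction with
  | last =>
    have : (B.filter fun i => Fin.last n ≤ i.castSucc) = ∅ :=
      Finset.filter_eq_empty_iff.2 fun i _ => not_le.2 i.castSucc_lt_last
    simp [h.w_last]
  | cast i ih =>
    have hd := h.d_le_w (Fin.zero_le i.succ)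
    have hd' := h.w_le_d (Fin.zero_le i.succ)
    have hε := P.εmax_pos
    rw [Fin.val_succ, Nat.cast_succ] at ih
    rw [Fin.val_castSucc]
    by_cases hi : i ∈ B
    · have : (B.filter fun m => i.castSucc ≤ m.castSucc) =
          insert i (B.filter fun m => i.succ ≤ m.castSucc) := by
        ext m
        simp only [Finset.mem_filter, Finset.mem_insert, Fin.le_def, Fin.val_castSucc,
          Fin.val_succ]
        constructor
        · rintro ⟨hm, hle⟩
          rcases eq_or_ne m i with rfl | hne
          · exact Or.inl rfl
          · rw [ne_eq, Fin.ext_iff] at hne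
            exact Or.inr ⟨hm, by omega⟩
        · rintro (rfl | ⟨hm, hle⟩)
          · exact ⟨hi, le_rfl⟩
          · exact ⟨hm, by omega⟩
      rw [this, Finset.sum_insert (by simp [Fin.le_def]), h.w_mem i hi (Fin.zero_le _)]
      constructor
      · linarith [ih.1]
      · linarith [ih.2]
    · have : (B.filter fun m => i.castSucc ≤ m.castSucc) =
          B.filter fun m => i.succ ≤ m.castSucc := by
        ext m
        simp only [Finset.mem_filter, Fin.le_def, Fin.val_castSucc, Fin.val_succ]
        refine and_congr_right fun hm => ⟨fun hle => ?_, fun hle => by omega⟩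
        have hne : m ≠ i := by rintro rfl; exact hi hm
        rw [ne_eq, Fin.ext_iff] at hne
        omega
      rw [this, h.w_notMem i hi (Fin.zero_le _)]
      exact ⟨ih.1, by linarith [ih.2]⟩

end Ladder

theorem filter_succ_le (B : Finset (Fin n)) (i : Fin n) :
    (B.filter fun m => i.succ ≤ m.castSucc) = B.filter (i < ·) :=
  Finset.filter_congr fun m _ => by
    simp only [Fin.le_def, Fin.lt_def, Fin.val_castSucc, Fin.val_succ]
    omega

namespace Params

theorem Gaps.firstBitBound (hg : P.Gaps) : P.FirstBitBound := by
  intro π v hπ hv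
  have hE := evaluates_of_hasTotalValue hv
  have hL := hE.ladder_of_weakInvariant hπ
  have h1 := (hL.w_bounds (Fin.succ 0)).1
  rw [filter_succ_le] at h1
  simp only [Fin.pos_iff_ne_zero] at h1
  by_cases h0 : π.1 (.b 0) = .one
  · rw [hE.b_one h0]
    linarith [hL.d_le_w (Fin.zero_le (Fin.succ 0))]
  · rw [hE.b_zero (b_first_eq h0)]
    linarith [hg.r_pos 0]

theorem setBitBounds (P : Params n) : P.SetBitBounds := by
  intro π v hπ hv i hi
  have hE := evaluates_of_hasTotalValue hv
  have hL := hE.ladder_of_weakInvariant hπ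
  have h1 := hL.w_bounds i.succ
  rw [filter_succ_le, Fin.val_succ, Nat.cast_succ] at h1
  rw [hE.b_one (mem_setBits.1 hi)]
  exact ⟨by linarith [hL.w_le_d (Fin.zero_le i.succ), h1.2],
    by linarith [hL.d_le_w (Fin.zero_le i.succ), h1.1]⟩

/-! ### The standard parameters -/

section Standard

theorem f_le (i : Fin n) : f i ≤ 3 + 6 * n := by
  unfold f
  omega

theorem standard_εmax_le : (standard n).εmax ≤ (1 / 2) ^ (100 * n) :=
  Finset.sup'_le _ _ fun _ _ => max_le le_rfl le_rfl

theorem standard_δmax_le : (standard n).δmax ≤ 3 * (3 + 6 * n) * (1 / 2) ^ (100 * n) := by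
  refine Real.sSup_le ?_ (by positivity)
  rintro x ⟨i, -, j, -, hj, rfl⟩
  have h1 : (j : ℝ) ≤ 3 + 6 * n := by exact_mod_cast hj.trans (f_le i)
  change 3 * (j : ℝ) * (1 / 2) ^ (100 * n) ≤ _
  gcongr

theorem standard_δmax_nonneg : 0 ≤ (standard n).δmax := by
  refine Real.sSup_nonneg ?_
  rintro x ⟨i, -, j, -, hj, rfl⟩
  change 0 ≤ 3 * (j : ℝ) * (1 / 2) ^ (100 * n)
  positivity

/-- With $e=2^{-100n}$ the sum is at most $(2n+9+18n)e\le29ne$, and $n2^{-n}\le1$ leaves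
$29\cdot2^{-99}$. -/
theorem standard_small : 2 * n * (standard n).εmax + (standard n).δmax < 1 := by
  have h1 := mul_le_mul_of_nonneg_left (standard_εmax_le (n := n))
    (by positivity : (0 : ℝ) ≤ 2 * n)
  have h2 := standard_δmax_le (n := n)
  have hn : (1 : ℝ) ≤ n := one_le_cast
  have h3 : ((1 : ℝ) / 2) ^ (100 * n) ≤ (1 / 2) ^ n * (1 / 2) ^ 99 := by
    rw [← pow_add]
    refine pow_le_pow_of_le_one (by norm_num) (by norm_num) ?_
    have := NeZero.ne n
    omega
  have h4 : (n : ℝ) * (1 / 2) ^ n ≤ 1 := by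
    have : (n : ℝ) < 2 ^ n := by exact_mod_cast Nat.lt_two_pow_self
    rw [one_div, inv_pow, ← div_eq_mul_inv]
    exact div_le_one_of_le₀ this.le (by positivity)
  have h5 : (n : ℝ) * (1 / 2) ^ (100 * n) ≤ (1 / 2) ^ 99 := by
    calc (n : ℝ) * (1 / 2) ^ (100 * n) ≤ n * ((1 / 2) ^ n * (1 / 2) ^ 99) := by gcongr
      _ = (n * (1 / 2) ^ n) * (1 / 2) ^ 99 := by ring
      _ ≤ 1 * (1 / 2) ^ 99 := by gcongr
      _ = _ := one_mul _
  have h6 : ((1 : ℝ) / 2) ^ (100 * n) ≤ n * (1 / 2) ^ (100 * n) :=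
    le_mul_of_one_le_left (by positivity) hn
  have h7 : 29 * ((1 : ℝ) / 2) ^ 99 < 1 := by norm_num
  linarith

theorem standard_rewardBelow (k : Fin (n + 1)) :
    (standard n).rewardBelow k = 8 / 3 * (4 ^ k.val - 1) := by
  induction k using Fin.induction with
  | zero => simp [rewardBelow]
  | succ i ih =>
    have h4 : ((2 : ℝ) ^ (2 * (i.val + 1) + 1)) = 8 * 4 ^ i.val := by
      rw [show 2 * (i.val + 1) + 1 = 2 * i.val + 3 by ring, pow_add, pow_mul]
      norm_num
      ring
    rw [rewardBelow_succ, ih]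
    change _ + (2 : ℝ) ^ (2 * (i.val + 1) + 1) = _
    rw [h4, Fin.val_succ, Fin.val_castSucc, pow_succ]
    ring

theorem standard_r (i : Fin n) : (standard n).r i = 8 * 4 ^ i.val := by
  change (2 : ℝ) ^ (2 * (i.val + 1) + 1) = _
  rw [show 2 * (i.val + 1) + 1 = 2 * i.val + 3 by ring, pow_add, pow_mul]
  norm_num
  ring

theorem standard_c {i : Fin n} (hi : i ≠ 0) : (standard n).c i = 4 * 4 ^ i.val := by
  change (if i = 0 then (0 : ℝ) else 2 ^ (2 * (i.val + 1))) = _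
  rw [if_neg hi, pow_mul, pow_succ]
  norm_num
  ring

/-- With zero-based $i$, the lower rewards sum to $\frac83(4^i-1)$, while $r(i)-c(i)$ and, for later
bits, $c(i)$ are at least $4\cdot4^i$; the small terms stay below $1$. -/
theorem standard_gaps : (standard n).Gaps := by
  have hs := standard_small (n := n)
  refine ⟨fun i => ?_, fun i hi => ?_, standard_δmax_nonneg⟩
  · rw [← rewardBelow_castSucc, standard_rewardBelow, standard_r, Fin.val_castSucc]
    have h1 : (1 : ℝ) ≤ 4 ^ i.val := one_le_pow₀ (by norm_num)
    have h2 : (standard n).c i ≤ 4 * 4 ^ i.val := by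
      by_cases hi : i = 0
      · rw [hi, (standard n).c_first]
        positivity
      · exact (standard_c hi).le
    linarith
  · rw [← rewardBelow_castSucc, standard_rewardBelow, standard_c hi, Fin.val_castSucc]
    have h1 : (1 : ℝ) ≤ 4 ^ i.val := one_le_pow₀ (by norm_num)
    linarith

/-- The left side is at most $2^{-(998n-1)}$, and $2j+100n\le112n+6$ is smaller than that exponent.
-/
theorem standard_alpha_mul_lt (i : Fin n) {j : ℕ} (hj : j ≤ f i) :
    ((1 : ℝ) / 2) ^ (1000 * n) * (8 * 4 ^ i.val) <
      (1 / 2) ^ (2 * j) * (3 * (1 / 2) ^ (100 * n)) := by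
  have hn : 1 ≤ n := Nat.one_le_iff_ne_zero.2 (NeZero.ne n)
  have h1 : (8 : ℝ) * 4 ^ i.val ≤ 2 ^ (2 * n + 1) := by
    have h8 : (8 : ℝ) * 4 ^ i.val = 2 ^ (2 * i.val + 3) := by
      rw [pow_add, pow_mul]
      norm_num
      ring
    rw [h8]
    exact pow_le_pow_right₀ (by norm_num) (by omega)
  calc ((1 : ℝ) / 2) ^ (1000 * n) * (8 * 4 ^ i.val)
      ≤ (1 / 2) ^ (1000 * n) * 2 ^ (2 * n + 1) := by gcongr
    _ = (1 / 2) ^ (998 * n - 1) := by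
      rw [show 1000 * n = (998 * n - 1) + (2 * n + 1) by omega, pow_add, mul_assoc, ← mul_pow]
      norm_num
    _ < (1 / 2) ^ (2 * j + 100 * n) := by
      refine pow_lt_pow_right_of_lt_one₀ (by norm_num) (by norm_num) ?_
      have := f_le i
      omega
    _ = 1 / 2 ^ (2 * j) * (1 * (1 / 2) ^ (100 * n)) := by
      rw [pow_add, one_mul, one_div_pow (n := 2 * j)]
    _ ≤ (1 / 2) ^ (2 * j) * (3 * (1 / 2) ^ (100 * n)) := by
      rw [one_div_pow (n := 2 * j)]
      gcongr
      norm_num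

theorem succ_lt_four_pow {m : ℕ} (hm : 1 ≤ m) : m + 1 < 4 ^ m := by
  induction m, hm using Nat.le_induction with
  | base => norm_num
  | succ m _ ih => rw [pow_succ]; omega

/-- Among the delay actions, the next one has the greatest gain. -/
theorem standard_gain_lt {e : ℝ} (he : 0 < e) {j j' : ℕ} (hne : j' ≠ j + 1) :
    ((1 : ℝ) / 2) ^ (2 * j') * (3 * j' * e - 3 * j * e) < (1 / 2) ^ (2 * (j + 1)) * (3 * e) := by
  have hpos : (0 : ℝ) < (1 / 2) ^ (2 * (j + 1)) * (3 * e) := by positivity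
  rcases Nat.lt_or_ge j j' with hlt | hge
  -- Skipping $m$ further actions multiplies the reward difference by $m+1$ and the probability by
  -- $4^{-m}$.
  · obtain ⟨m, rfl⟩ : ∃ m, j' = j + 1 + m := ⟨j' - (j + 1), by omega⟩
    have hm : ((m : ℝ) + 1) < 4 ^ m := by
      exact_mod_cast succ_lt_four_pow (m := m) (by omega)
    have h1 : ((1 : ℝ) / 2) ^ (2 * (j + 1 + m)) * (3 * ((j + 1 + m : ℕ) : ℝ) * e - 3 * j * e) =
        (1 / 2) ^ (2 * (j + 1)) * (3 * e) * ((m + 1) / 4 ^ m) := by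
      rw [mul_add 2 (j + 1) m, pow_add, pow_mul _ 2 m]
      push_cast
      rw [show ((1 : ℝ) / 2) ^ 2 = 1 / 4 by norm_num, one_div_pow (4 : ℝ) m]
      ring
    rw [h1]
    refine mul_lt_of_lt_one_right hpos ?_
    rwa [div_lt_one (by positivity)]
  · refine lt_of_le_of_lt ?_ hpos
    have h1 : (j' : ℝ) ≤ j := by exact_mod_cast hge
    refine mul_nonpos_of_nonneg_of_nonpos (by positivity) ?_
    have := mul_le_mul_of_nonneg_right h1 he.le
    linarith

/-- Before the delays run out, $\alpha_i$ is too small for action $1$ to compete with the next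
delay; at $j=f(i)$ no delay offers a larger $\delta$, and action $1$ alone gains. -/
theorem standard_gadgetOrder : (standard n).GadgetOrder := by
  intro π v appeal hπ hva i j hi hj
  obtain ⟨hv, hap⟩ := hva
  obtain rfl : appeal = appealOf (standard n) v := funext fun s => funext fun a => hap s a
  have hg := standard_gaps (n := n)
  have hE := evaluates_of_hasTotalValue hv
  have hL := hE.ladder_of_weakInvariant hπ
  have hb0 := hE.b_first_of_weakInvariant hπ
  have hjf : j ≤ f i := by
    have h1 : Action.delay j ∈ avail (State.b i) := hj ▸ π.2 (.b i)
    simpa [b_avail hi] using h1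
  set e : ℝ := (1 / 2) ^ (100 * n) with he
  have hepos : 0 < e := by positivity
  -- The formula includes $j=0$, since $w_1$ and $b_1$ have the same value under the weak invariant.
  have hx : v (.b i) = v (.b 0) + 3 * j * e := by
    rcases Nat.eq_zero_or_pos j with rfl | hj0
    · rw [hE.b_delay_zero hj, hb0]
      simp
    · exact hE.b_delay hj0 hj
  have hδ : 3 * j * e ≤ (standard n).δmax := by
    rcases Nat.eq_zero_or_pos j with rfl | hj0
    · simpa using hg.δmax_nonneg
    · exact (standard n).δ_le hi hj0 hjf
  have hiB : i ∉ setBits π := by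
    rw [mem_setBits, hj]
    simp
  have hje : 0 ≤ 3 * j * e := by positivity
  have hα : 0 < (standard n).α i := (standard n).α_pos i
  have hdelay : ∀ j', 1 ≤ j' → appealOf (standard n) v (.b i) (.delay j') =
      v (.b i) + (1 / 2) ^ (2 * j') * (3 * j' * e - 3 * j * e) := by
    intro j' hj'
    rw [appealOf_b_delay _ v i hj', hx]
    change _ + (1 / 2) ^ (2 * j') * (3 * j' * e + _ - _) = _
    ring
  have hone : appealOf (standard n) v (.b i) .one = v (.b i) +
      (standard n).α i * ((standard n).r i + v (dAt i.succ) - v (.b i)) := by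
    rw [appealOf_b_one _ v i hi, hE.bPlus]
    ring
  have hzero : appealOf (standard n) v (.b i) (.delay 0) ≤ v (.b i) := by
    rw [appealOf_b_delay_zero, ← hb0]
    linarith
  have hYpos : 0 < (standard n).r i + v (dAt i.succ) - v (.b i) := by
    have h1 := hL.w_le hg le_rfl (Fin.zero_le i.castSucc)
    have h2 := hL.w_notMem i hiB (Fin.zero_le _)
    have h3 := hL.profit hg (Fin.zero_le i.succ)
    linarith [hg.rewardBelow_nonneg 0, hg.c_nonneg i, (standard n).εmax_pos]
  have hYle : (standard n).r i + v (dAt i.succ) - v (.b i) ≤ 8 * 4 ^ i.val := by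
    rw [standard_r]
    linarith [hL.d_le_w (Fin.zero_le i.succ), hL.w_antitone hg le_rfl (Fin.zero_le i.succ)]
  have hbest : (if j = f i then Action.one else .delay (j + 1)) ∈ avail (State.b i) := by
    rw [b_avail hi]
    split_ifs with h
    · exact Or.inl rfl
    · exact Or.inr ⟨j + 1, by omega, rfl⟩
  by_cases h : j = f i
  · rw [if_pos h] at hbest ⊢
    have hgt : v (.b i) < appealOf (standard n) v (.b i) .one := by
      rw [hone]
      linarith [mul_pos hα hYpos]
    refine ⟨⟨_, hbest, hgt⟩, fun a ha hne => ?_⟩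
    rcases (b_avail hi).1 ha with rfl | ⟨j', hj', rfl⟩
    · exact absurd rfl hne
    · refine lt_of_le_of_lt ?_ hgt
      rcases Nat.eq_zero_or_pos j' with rfl | hj0
      · exact hzero
      · rw [hdelay j' hj0]
        have h1 : (j' : ℝ) ≤ j := by rw [h]; exact_mod_cast hj'
        have h2 := mul_le_mul_of_nonneg_right h1 hepos.le
        have h3 : ((1 : ℝ) / 2) ^ (2 * j') * (3 * j' * e - 3 * j * e) ≤ 0 :=
          mul_nonpos_of_nonneg_of_nonpos (by positivity) (by linarith)
        linarith
  · rw [if_neg h] at hbest ⊢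
    have hnext : appealOf (standard n) v (.b i) (.delay (j + 1)) =
        v (.b i) + (1 / 2) ^ (2 * (j + 1)) * (3 * e) := by
      rw [hdelay _ (by omega)]
      push_cast
      ring
    have hgt : v (.b i) < appealOf (standard n) v (.b i) (.delay (j + 1)) := by
      rw [hnext]
      have : (0 : ℝ) < (1 / 2) ^ (2 * (j + 1)) * (3 * e) := by positivity
      linarith
    refine ⟨⟨_, hbest, hgt⟩, fun a ha hne => ?_⟩
    rcases (b_avail hi).1 ha with rfl | ⟨j', hj', rfl⟩
    · rw [hone, hnext]
      have h1 := standard_alpha_mul_lt i (j := j + 1) (by omega)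
      have h2 := mul_le_mul_of_nonneg_left hYle hα.le
      have h3 : (standard n).α i = (1 / 2) ^ (1000 * n) := rfl
      rw [← h3] at h1
      linarith
    · rcases Nat.eq_zero_or_pos j' with rfl | hj0
      · exact hzero.trans_lt hgt
      · rw [hdelay j' hj0, hnext]
        linarith [standard_gain_lt hepos (j := j) (j' := j') fun h' => hne (by rw [h'])]

theorem standard_admissible : (standard n).Admissible where
  rewardGap := standard_gaps.rewardGap
  costGap := standard_gaps.costGap
  firstBitBound := standard_gaps.firstBitBound
  setBitBounds := setBitBounds _
  gadgetOrder := standard_gadgetOrder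

end Standard

end Params

end FullConstruction

end

theorem mainTheorem4 (n : ℕ) [NeZero n] :
    (∀ P : FullConstruction.Params n, P.Admissible →
      FullConstruction.CountsInBinary P (FullConstruction.mdp P).totalReward ∧
      FullConstruction.CountsInBinary P (FullConstruction.mdp P).averageReward) ∧
    (FullConstruction.Params.standard n).Admissible := by
  exact ⟨fun P hP => ⟨FullConstruction.countsInBinary_totalReward hP,
    FullConstruction.countsInBinary_averageReward hP⟩,
    FullConstruction.Params.standard_admissible⟩
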